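/- Let $(M_1,g_1)$ and $(M_2,g_2)$ be smooth, oriented Riemannian manifolds, possibly with boundary, of the same dimension $d\ge 1$, with volume forms $d\mathrm{Vol}_1$, $d\mathrm{Vol}_2$. For a smooth map $f:M_1\to M_2$ let $\operatorname{Det} df=\star^d\circ\Lambda^d df\circ\star^0$ and $\operatorname{Cof} df=(-1)^{d-1}\star^{d-1}\circ\Lambda^{d-1}df\circ\star^1\in\Gamma(T^*M_1\otimes f^*TM_2)$, where $\star$ denotes the fibrewise Hodge duals on $\Lambda_\bullet TM_1$ and $\Lambda_\bullet TM_2$. Let $\nabla^{f^*TM_2}$ be the pullback of the Levi-Civita connection of $M_2$. A smooth section $\tau$ of $f^*TM_2$ is the coderivative $\delta_{\nabla^{f^*TM_2}}\rho$ of an $f^*TM_2$-valued $1$-form $\rho$ if $$\int_{M_1}\langle\sigma,\tau\rangle\,d\mathrm{Vol}_1=\int_{M_1}\langle\nabla^{f^*TM_2}\sigma,\rho\rangle_{g_1,g_2}\,d\mathrm{Vol}_1$$ for all smooth compactly supported sections $\sigma$ of $f^*TM_2$ vanishing on $\partial M_1$. For compact $K\subseteq M_1$ (one may take $K=M_1$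 if $M_1$ is compact) put $E_K(f)=\int_K f^*d\mathrm{Vol}_2$. A variation of a smooth map $\varphi$ supported in $K$ is a family $\varphi_t:M_1\to M_2$, $|t|<\varepsilon$, smooth in $(t,p)$, with $\varphi_0=\varphi$ and $\varphi_t=\varphi$ on $\partial M_1$ and outside $K$; $\varphi$ is critical for $E$ if $\frac{d}{dt}\big|_{t=0}E_K(\varphi_t)=0$ for all compact $K$ and all such variations. Then: 1. For every smooth $f$, $f^*d\mathrm{Vol}_2=\operatorname{Det} df\,d\mathrm{Vol}_1$; for every compact $K$, $\operatorname{Det} df$ is integrable on $K$ and $E_K(f)=\int_K\operatorname{Det} df\,d\mathrm{Vol}_1$. 2. The Euler–Lagrange equation of $E$ is $\delta_{\nabla^{\varphi^*TM_2}}\operatorname{Cof} d\varphi=0$: for every smooth $\varphi$, the coderivative $\delta_{\nabla^{\varphi^*TM_2}}\operatorname{Cof} d\varphi$ exists and is unique; for every compact $K$ and every variation $\varphi_t$ of $\varphi$ supported in $K$, with $V=\partial_t\varphi_t|_{t=0}\in\Gamma(\varphi^*TM_2)$, the function $t\mapsto E_K(\varphi_t)$ is differentiable at $0$ and $$\frac{d}{dt}\Big|_{t=0}E_K(\varphi_t)=\int_{M_1}\big\langle\delta_{\nabla^{\varphi^*TM_2}}\operatorname{Cof}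 d\varphi,\,V\big\rangle\,d\mathrm{Vol}_1;$$ and $\varphi$ is critical for $E$ if and only if $\delta_{\nabla^{\varphi^*TM_2}}\operatorname{Cof} d\varphi=0$. 3. $E$ is a null-Lagrangian, i.e. every smooth map $\varphi:M_1\to M_2$ is critical for $E$. 4. Consequently every smooth map $f:M_1\to M_2$ satisfies the Riemannian Piola identity $\delta_{\nabla^{f^*TM_2}}\operatorname{Cof} df=0$. -/

import Mathlib

open Bundle Manifold MeasureTheory Set Module
open scoped ContDiff Topology

noncomputable section

namespace Piola

/-! ### Linear algebra: Hodge duals, determinant and cofactor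

The dimension is written `n + 1`.  The Hodge dual `⋆ : ⋀ᵏ V → ⋀ᵈ⁻ᵏ V` is normalised by
`α ∧ ⋆ β = ⟨α, β⟩ Vol`; only the degrees `0, 1, d - 1, d` are needed. -/

section LinearAlgebra

variable {n : ℕ}
  {V : Type*} [NormedAddCommGroup V] [InnerProductSpace ℝ V] [Fact (finrank ℝ V = n + 1)]
  {W : Type*} [NormedAddCommGroup W] [InnerProductSpace ℝ W] [Fact (finrank ℝ W = n + 1)]

/-- A positively oriented orthonormal basis. -/
def orientedBasis (o : Orientation ℝ V (Fin (n + 1))) : OrthonormalBasis (Fin (n + 1)) ℝ V :=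
  o.finOrthonormalBasis n.succ_pos Fact.out

/-- `⋆⁰ : ℝ → ⋀ᵈ V`, `1 ↦ e₀ ∧ … ∧ eₙ`. -/
def hodgeZero (o : Orientation ℝ V (Fin (n + 1))) : ℝ →ₗ[ℝ] ⋀[ℝ]^(n + 1) V :=
  LinearMap.toSpanSingleton ℝ _ (exteriorPower.ιMulti ℝ (n + 1) (orientedBasis o))

/-- `⋆ᵈ : ⋀ᵈ V → ℝ`, `v₀ ∧ … ∧ vₙ ↦ Vol(v₀, …, vₙ)`. -/
def hodgeTop (o : Orientation ℝ V (Fin (n + 1))) : ⋀[ℝ]^(n + 1) V →ₗ[ℝ] ℝ :=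
  exteriorPower.alternatingMapLinearEquiv o.volumeForm

/-- `⋆¹ : V → ⋀ᵈ⁻¹ V`, `eᵢ ↦ (-1)ⁱ e₀ ∧ … ∧ êᵢ ∧ … ∧ eₙ`. -/
def hodgeOne (o : Orientation ℝ V (Fin (n + 1))) : V →ₗ[ℝ] ⋀[ℝ]^n V :=
  ∑ i : Fin (n + 1), (-1 : ℝ) ^ (i : ℕ) •
    (innerₛₗ ℝ (orientedBasis o i)).smulRight
      (exteriorPower.ιMulti ℝ n fun j : Fin n => orientedBasis o (i.succAbove j))

/-- `⋆ᵈ⁻¹ : ⋀ᵈ⁻¹ V → V`, determined by `⟨⋆β, u⟩ = Vol(β, u) = (-1)ᵈ⁻¹ Vol(u, β)`. -/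
def hodgePred (o : Orientation ℝ V (Fin (n + 1))) : ⋀[ℝ]^n V →ₗ[ℝ] V :=
  ∑ i : Fin (n + 1), (-1 : ℝ) ^ n •
    (exteriorPower.alternatingMapLinearEquiv
      (o.volumeForm.curryLeft (orientedBasis o i))).smulRight (orientedBasis o i)

/-- `Det A = ⋆ᵈ ∘ ⋀ᵈ A ∘ ⋆⁰`. -/
def Det (oV : Orientation ℝ V (Fin (n + 1))) (oW : Orientation ℝ W (Fin (n + 1)))
    (A : V →ₗ[ℝ] W) : ℝ :=
  (hodgeTop oW ∘ₗ exteriorPower.map (n + 1) A ∘ₗ hodgeZero oV) 1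

/-- `Cof A = (-1)ᵈ⁻¹ ⋆ᵈ⁻¹ ∘ ⋀ᵈ⁻¹ A ∘ ⋆¹`. -/
def Cof (oV : Orientation ℝ V (Fin (n + 1))) (oW : Orientation ℝ W (Fin (n + 1)))
    (A : V →ₗ[ℝ] W) : V →ₗ[ℝ] W :=
  (-1 : ℝ) ^ n • (hodgePred oW ∘ₗ exteriorPower.map n A ∘ₗ hodgeOne oV)

/-- The inner product on `V* ⊗ W = Hom(V, W)` induced by those of `V` and `W`. -/
def homInner [FiniteDimensional ℝ V] (A B : V →ₗ[ℝ] W) : ℝ :=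
  ∑ i, inner ℝ (A (stdOrthonormalBasis ℝ V i)) (B (stdOrthonormalBasis ℝ V i))

end LinearAlgebra

/-! ### Riemannian geometry in charts -/

section Geometry

variable {n : ℕ} {H : Type*} [TopologicalSpace H]
  (I : ModelWithCorners ℝ (EuclideanSpace ℝ (Fin (n + 1))) H)
  {M : Type*} [TopologicalSpace M] [ChartedSpace H M]

instance tangentSpace_finiteDimensional (x : M) : FiniteDimensional ℝ (TangentSpace I x) :=
  inferInstanceAs (FiniteDimensional ℝ (EuclideanSpace ℝ (Fin (n + 1))))

instance tangentSpace_finrank (x : M) : Fact (finrank ℝ (TangentSpace I x) = n + 1) :=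
  ⟨(finrank_euclideanSpace_fin : finrank ℝ (EuclideanSpace ℝ (Fin (n + 1))) = n + 1)⟩

variable [IsManifold I ∞ M]

/-- The coordinate vector field `∂ᵢ` at `x` of the chart centred at `x₀`. -/
def coordVec (x₀ x : M) (i : Fin (n + 1)) : TangentSpace I x :=
  (trivializationAt (EuclideanSpace ℝ (Fin (n + 1))) (TangentSpace I) x₀).symmL ℝ x
    (EuclideanSpace.single i 1)

variable [RiemannianBundle (fun x : M => TangentSpace I x)]

/-- The matrix `gᵢⱼ` of the metric in the chart centred at `x₀`, at the coordinate point `y`. -/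
def gram (x₀ : M) (y : EuclideanSpace ℝ (Fin (n + 1))) :
    Matrix (Fin (n + 1)) (Fin (n + 1)) ℝ :=
  Matrix.of fun i j =>
    inner ℝ (coordVec I x₀ ((extChartAt I x₀).symm y) i) (coordVec I x₀ ((extChartAt I x₀).symm y) j)

/-- The partial derivative `∂ₖ gᵢⱼ` in the chart centred at `x₀`, at the coordinate point `y`. -/
def gramDeriv (x₀ : M) (y : EuclideanSpace ℝ (Fin (n + 1))) (k i j : Fin (n + 1)) : ℝ :=
  fderivWithin ℝ (fun z => gram I x₀ z i j) (range I) y (EuclideanSpace.single k 1)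

/-- The Christoffel symbol `Γᵏᵢⱼ = ½ gᵏˡ (∂ᵢ gⱼₗ + ∂ⱼ gᵢₗ - ∂ₗ gᵢⱼ)` of the Levi-Civita
connection in the chart centred at `x₀`, at the coordinate point `y`. -/
def christoffel (x₀ : M) (y : EuclideanSpace ℝ (Fin (n + 1))) (k i j : Fin (n + 1)) : ℝ :=
  (1 / 2) * ∑ l, (gram I x₀ y)⁻¹ k l *
    (gramDeriv I x₀ y i j l + gramDeriv I x₀ y j i l - gramDeriv I x₀ y l i j)

/-- The measure `√(det g) dx` on the domain of the chart centred at `x₀`. -/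
def chartVolume [MeasurableSpace M] (x₀ : M) : Measure M :=
  (((volume : Measure (EuclideanSpace ℝ (Fin (n + 1)))).restrict
      (extChartAt I x₀).target).withDensity
    fun y => ENNReal.ofReal (Real.sqrt (gram I x₀ y).det)).map (extChartAt I x₀).symm

/-- The Riemannian volume measure.  The measures `chartVolume I x₀` agree on the overlaps of the
chart domains, so their supremum is the measure obtained by glueing them. -/
def riemannianVolume [MeasurableSpace M] : Measure M := ⨆ x₀ : M, chartVolume I x₀

/-- A pointwise choice of orientations of the tangent spaces is an orientation of the manifold if
near every point `x₀` the coordinate frame of the chart centred at `x₀` is either everywhere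
positively or everywhere negatively oriented. -/
def IsOrientation (o : ∀ x : M, Orientation ℝ (TangentSpace I x) (Fin (n + 1))) : Prop :=
  ∀ x₀ : M, ∀ᶠ x in 𝓝 x₀,
    (0 < (o x).volumeForm (coordVec I x₀ x) ↔ 0 < (o x₀).volumeForm (coordVec I x₀ x₀))

/-- The integral over `K` of a form of top degree on an oriented Riemannian manifold. -/
def integralTopForm [MeasurableSpace M]
    (o : ∀ x : M, Orientation ℝ (TangentSpace I x) (Fin (n + 1))) (K : Set M)
    (η : ∀ x : M, TangentSpace I x [⋀^Fin (n + 1)]→ₗ[ℝ] ℝ) : ℝ :=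
  ∫ x in K, η x (orientedBasis (o x)) ∂(riemannianVolume I : Measure M)

end Geometry

/-! ### Maps between manifolds -/

section Maps

variable {n : ℕ}
  {H₁ : Type*} [TopologicalSpace H₁] (I₁ : ModelWithCorners ℝ (EuclideanSpace ℝ (Fin (n + 1))) H₁)
  {M₁ : Type*} [TopologicalSpace M₁] [ChartedSpace H₁ M₁] [IsManifold I₁ ∞ M₁]
  {H₂ : Type*} [TopologicalSpace H₂] (I₂ : ModelWithCorners ℝ (EuclideanSpace ℝ (Fin (n + 1))) H₂)
  {M₂ : Type*} [TopologicalSpace M₂] [ChartedSpace H₂ M₂] [IsManifold I₂ ∞ M₂]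

/-- The differential `df` at `p`. -/
def differential (f : M₁ → M₂) (p : M₁) : TangentSpace I₁ p →ₗ[ℝ] TangentSpace I₂ (f p) :=
  (mfderiv I₁ I₂ f p).toLinearMap

/-- Smoothness of a section of `f^*TM₂`. -/
def IsSmoothSection (f : M₁ → M₂) (ξ : ∀ p, TangentSpace I₂ (f p)) : Prop :=
  ContMDiff I₁ I₂.tangent ∞ (fun p => (⟨f p, ξ p⟩ : TangentBundle I₂ M₂))

/-- `ψ t`, `|t| < ε`, is a smooth variation of `φ` that is constant on `∂M₁` and outside `K`. -/
structure IsVariation (φ : M₁ → M₂) (K : Set M₁) (ε : ℝ) (ψ : ℝ → M₁ → M₂) : Prop where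
  smooth : ContMDiffOn (𝓘(ℝ, ℝ).prod I₁) I₂ ∞ (fun q : ℝ × M₁ => ψ q.1 q.2)
    (Ioo (-ε) ε ×ˢ univ)
  zero : ψ 0 = φ
  eq_on_boundary : ∀ t ∈ Ioo (-ε) ε, ∀ p ∈ I₁.boundary M₁, ψ t p = φ p
  eq_off : ∀ t ∈ Ioo (-ε) ε, ∀ p ∉ K, ψ t p = φ p

/-- `V = ∂ψ/∂t` at `t = 0`, as a section of `φ^*TM₂`. -/
def IsVariationField (φ : M₁ → M₂) (ψ : ℝ → M₁ → M₂) (V : ∀ p, TangentSpace I₂ (φ p)) : Prop :=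
  ∀ p, tangentMap 𝓘(ℝ, ℝ) I₂ (fun t : ℝ => ψ t p) ⟨0, (1 : ℝ)⟩ = ⟨φ p, V p⟩

/-- `φ` is a critical point of the functional `E`, where `E K` is the functional restricted to the
compact set `K`: its derivative vanishes along all smooth variations relative to `∂M₁` that are
constant outside `K`. -/
def IsCritical (E : Set M₁ → (M₁ → M₂) → ℝ) (φ : M₁ → M₂) : Prop :=
  ∀ (K : Set M₁) (ε : ℝ) (ψ : ℝ → M₁ → M₂), IsCompact K → 0 < ε → IsVariation I₁ I₂ φ K ε ψ →
    HasDerivAt (fun t => E K (ψ t)) 0 0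

/-- Every smooth map is a critical point. -/
def IsNullLagrangian (E : Set M₁ → (M₁ → M₂) → ℝ) : Prop :=
  ∀ φ : M₁ → M₂, ContMDiff I₁ I₂ ∞ φ → IsCritical I₁ I₂ E φ

variable [RiemannianBundle (fun x : M₁ => TangentSpace I₁ x)]
  [RiemannianBundle (fun x : M₂ => TangentSpace I₂ x)]

/-- The linear map `v ↦ Γᵏᵢⱼ vⁱ wʲ eₖ` of coordinate vectors, in the chart of `M₂` centred at `q`
and at the point `q`. -/
def christoffelMap (q : M₂) (w : EuclideanSpace ℝ (Fin (n + 1))) :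
    EuclideanSpace ℝ (Fin (n + 1)) →L[ℝ] EuclideanSpace ℝ (Fin (n + 1)) :=
  ∑ k, ∑ i, ∑ j, (christoffel I₂ q (extChartAt I₂ q q) k i j * w j) •
    (EuclideanSpace.proj i : EuclideanSpace ℝ (Fin (n + 1)) →L[ℝ] ℝ).smulRight
      (EuclideanSpace.single k (1 : ℝ))

/-- The covariant derivative `∇ξ` of a section `ξ` of `f^*TM₂` for the pullback of the Levi-Civita
connection of `M₂`: in the chart of `M₂` centred at `f p`,
`(∇_v ξ)ᵏ = dξᵏ(v) + Γᵏᵢⱼ(f p) (df v)ⁱ ξʲ`. -/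
def pullbackConnection (f : M₁ → M₂) (ξ : ∀ p, TangentSpace I₂ (f p)) (p : M₁) :
    TangentSpace I₁ p →ₗ[ℝ] TangentSpace I₂ (f p) :=
  letI e := trivializationAt (EuclideanSpace ℝ (Fin (n + 1)))
    (TangentSpace I₂ : M₂ → Type _) (f p)
  (e.symmL ℝ (f p)).toLinearMap ∘ₗ
    ((mvfderiv I₁ (fun p' => e.continuousLinearMapAt ℝ (f p') (ξ p')) p).toLinearMap +
      (christoffelMap I₂ (f p) (e.continuousLinearMapAt ℝ (f p) (ξ p))).toLinearMap ∘ₗ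
        (e.continuousLinearMapAt ℝ (f p)).toLinearMap ∘ₗ differential I₁ I₂ f p)

/-- `τ = δ ρ`: the smooth section `τ` of `f^*TM₂` is the coderivative of the `f^*TM₂`-valued
1-form `ρ`, that is `∫ ⟨σ, τ⟩ dVol₁ = ∫ ⟨∇σ, ρ⟩ dVol₁` for all smooth compactly supported
sections `σ` that vanish on the boundary. -/
def IsCoderivative [MeasurableSpace M₁] (f : M₁ → M₂)
    (ρ : ∀ p, TangentSpace I₁ p →ₗ[ℝ] TangentSpace I₂ (f p))
    (τ : ∀ p, TangentSpace I₂ (f p)) : Prop :=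
  IsSmoothSection I₁ I₂ f τ ∧
    ∀ σ : ∀ p, TangentSpace I₂ (f p), IsSmoothSection I₁ I₂ f σ →
      IsCompact (closure {p | σ p ≠ 0}) → (∀ p ∈ I₁.boundary M₁, σ p = 0) →
      ∫ p, inner ℝ (σ p) (τ p) ∂(riemannianVolume I₁ : Measure M₁) =
        ∫ p, homInner (pullbackConnection I₁ I₂ f σ p) (ρ p) ∂(riemannianVolume I₁ : Measure M₁)

variable (o₁ : ∀ x : M₁, Orientation ℝ (TangentSpace I₁ x) (Fin (n + 1)))
  (o₂ : ∀ x : M₂, Orientation ℝ (TangentSpace I₂ x) (Fin (n + 1)))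

/-- `Det df`. -/
def DetD (f : M₁ → M₂) (p : M₁) : ℝ := Det (o₁ p) (o₂ (f p)) (differential I₁ I₂ f p)

/-- `Cof df`. -/
def CofD (f : M₁ → M₂) (p : M₁) : TangentSpace I₁ p →ₗ[ℝ] TangentSpace I₂ (f p) :=
  Cof (o₁ p) (o₂ (f p)) (differential I₁ I₂ f p)

/-- The form `f^*dVol₂`. -/
def pullbackVolume (f : M₁ → M₂) (p : M₁) : TangentSpace I₁ p [⋀^Fin (n + 1)]→ₗ[ℝ] ℝ :=
  ((o₂ (f p)).volumeForm).compLinearMap (differential I₁ I₂ f p)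

/-- The functional `E(f) = ∫_K f^*dVol₂`. -/
def volumeFunctional [MeasurableSpace M₁] (K : Set M₁) (f : M₁ → M₂) : ℝ :=
  integralTopForm I₁ o₁ K (pullbackVolume I₁ I₂ o₂ f)

end Maps

end Piola

end

/-!
The form `f^*dVol₂` equals `Det df dVol₁`. In a chart of `M₁` with coordinate frame `∂₀, …, ∂ₙ`,
the density of `⟨∇σ, Cof df⟩ dVol₁` is the divergence of the flux
`Xⁱ = dVol₂(df ∂₀, …, σ, …, df ∂ₙ)`, with `σ` in the `i`-th slot: the mixed second derivatives
of `f` cancel by antisymmetry, and the derivative of `√(det g₂)` along `σ` is the trace of the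
Christoffel symbols in `∇σ`. Stokes' theorem in charts and a partition of unity give
`∫ ⟨∇σ, Cof df⟩ dVol₁ = 0` for every compactly supported `σ` vanishing on the boundary, which is
the Piola identity. The same computation along a variation `φ_t` with velocity `V` shows
`d/dt Det dφ_t = ⟨∇V, Cof dφ⟩` at `t = 0`, so the first variation of `E` is an integral of this
kind and vanishes.
-/

noncomputable section

namespace Piola

local notation "𝔼" n:max => EuclideanSpace ℝ (Fin (n + 1))

/-! ### Multilinear algebra -/

section Alternating

variable {R V W N ι : Type*} [CommRing R] [AddCommGroup V] [Module R V] [AddCommGroup W]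
  [Module R W] [AddCommGroup N] [Module R N] [DecidableEq ι]

lemma map_update_swap (η : W [⋀^ι]→ₗ[R] N) {i j : ι} (hij : i ≠ j) (v : ι → W) (w a : W) :
    η (Function.update (Function.update v j w) i a) =
      -η (Function.update (Function.update v i w) j a) := by
  rw [← η.map_swap _ hij]
  congr 1
  ext k
  rcases eq_or_ne k i with rfl | hki
  · simp
  rcases eq_or_ne k j with rfl | hkj
  · simp [hki, hki.symm]
  · simp [Equiv.swap_apply_of_ne_of_ne hki hkj, hki, hkj]

lemma compLinearMap_update_apply (η : W [⋀^ι]→ₗ[R] N) (A B : V →ₗ[R] W) (i : ι) (v : ι → V) :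
    η.toMultilinearMap.compLinearMap (Function.update (fun _ => B) i A) v =
      η (Function.update (B ∘ v) i (A (v i))) := by
  rw [MultilinearMap.compLinearMap_apply]
  refine congrArg η (funext fun j => ?_)
  rcases eq_or_ne j i with rfl | hji
  · simp
  · simp [hji]

variable [Fintype ι]

/-- The first variation `v ↦ ∑ᵢ η (B v₀, …, A vᵢ, …, B vₙ)` of the pullback `B ↦ η ∘ B` in the
direction `A`. -/
def pullbackVariation (η : W [⋀^ι]→ₗ[R] N) (A B : V →ₗ[R] W) : V [⋀^ι]→ₗ[R] N where
  __ := ∑ i, η.toMultilinearMap.compLinearMap (Function.update (fun _ => B) i A)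
  map_eq_zero_of_eq' v p q hv hpq := by
    simp only [MultilinearMap.toFun_eq_coe, sum_apply, compLinearMap_update_apply]
    rw [← Finset.sum_subset (Finset.subset_univ {p, q}), Finset.sum_pair hpq]
    · have hp : Function.update (B ∘ v) q (B (v q)) = B ∘ v := Function.update_eq_self q (B ∘ v)
      have hq : Function.update (B ∘ v) p (B (v p)) = B ∘ v := Function.update_eq_self p (B ∘ v)
      have swap := map_update_swap η hpq (B ∘ v) (B (v q)) (A (v q))
      rw [hp, ← hv, hq] at swap
      rw [← hv, swap, neg_add_cancel]
    · intro i _ hi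
      obtain ⟨hip, hiq⟩ : i ≠ p ∧ i ≠ q := by simpa using hi
      exact η.map_eq_zero_of_eq _ (by simp [hip.symm, hiq.symm, hv]) hpq

lemma pullbackVariation_apply (η : W [⋀^ι]→ₗ[R] N) (A B : V →ₗ[R] W) (v : ι → V) :
    pullbackVariation η A B v = ∑ i, η (Function.update (B ∘ v) i (A (v i))) := by
  simp only [← compLinearMap_update_apply, ← sum_apply]
  rfl

lemma sum_map_update_map (b : Basis ι R V) (η : V [⋀^ι]→ₗ[R] R) (T : V →ₗ[R] V) (v : ι → V) :
    ∑ i, η (Function.update v i (T (v i))) = LinearMap.trace R V T * η v := by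
  have trace_eq : ∑ i, b.det (Function.update b i (T (b i))) = LinearMap.trace R V T := by
    rw [LinearMap.trace_eq_matrix_trace R b]
    refine Finset.sum_congr rfl fun i _ => ?_
    rw [Basis.det_apply, Basis.toMatrix_update, Basis.toMatrix_self, ← Matrix.cramer_apply,
      Matrix.cramer_one, Matrix.diag_apply, LinearMap.toMatrix_apply]
    rfl
  calc ∑ i, η (Function.update v i (T (v i)))
      = pullbackVariation η T .id v := (pullbackVariation_apply η T .id v).symm
    _ = pullbackVariation η T .id b * b.det v :=
        DFunLike.congr_fun ((pullbackVariation η T .id).eq_smul_basis_det b) v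
    _ = η b * (∑ i, b.det (Function.update b i (T (b i)))) * b.det v := by
        rw [pullbackVariation_apply, Finset.mul_sum]
        congr 1
        exact Finset.sum_congr rfl fun i _ => DFunLike.congr_fun (η.eq_smul_basis_det b) _
    _ = LinearMap.trace R V T * (η b * b.det v) := by rw [trace_eq]; ring
    _ = LinearMap.trace R V T * η v := by
        rw [← smul_eq_mul (η b), ← AlternatingMap.smul_apply, ← η.eq_smul_basis_det b]

/-- Cramer's rule, as the trace identity for the rank one endomorphism `x ↦ l x • w`. -/
lemma sum_mul_map_update (b : Basis ι R V) (η : V [⋀^ι]→ₗ[R] R) (l : V →ₗ[R] R) (v : ι → V)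
    (w : V) : ∑ i, l (v i) * η (Function.update v i w) = l w * η v := by
  have := Module.Free.of_basis b
  have := Module.Finite.of_basis b
  simpa [LinearMap.trace_smulRight] using sum_map_update_map b η (l.smulRight w) v

lemma sum_offDiag_map_update_update (η : W [⋀^ι]→ₗ[R] N) (v : ι → W) (w : W) {A : ι → ι → W}
    (hA : ∀ i j, A i j = A j i) :
    ∑ p ∈ Finset.univ.offDiag,
      η (Function.update (Function.update v p.1 w) p.2 (A p.1 p.2)) = 0 := by
  refine Finset.sum_involution (fun p _ => p.swap) (fun p hp => ?_) (fun p hp _ h => ?_)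
    (fun p hp => by simpa [eq_comm] using hp) fun _ _ => rfl
  · rw [Prod.fst_swap, Prod.snd_swap, map_update_swap η (Finset.mem_offDiag.1 hp).2.2, hA,
      add_neg_cancel]
  · exact (Finset.mem_offDiag.1 hp).2.2 (congrArg Prod.snd h)

end Alternating

/-! ### Determinant and cofactor in terms of the volume forms -/

section LinearAlgebra

lemma sum_inner_eq_trace {V W ι : Type*} [NormedAddCommGroup V] [InnerProductSpace ℝ V]
    [FiniteDimensional ℝ V] [NormedAddCommGroup W] [InnerProductSpace ℝ W] [FiniteDimensional ℝ W]
    [Fintype ι] (b : OrthonormalBasis ι ℝ V) (A B : V →ₗ[ℝ] W) :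
    ∑ i, inner ℝ (A (b i)) (B (b i)) = LinearMap.trace ℝ V (A.adjoint ∘ₗ B) := by
  simp [LinearMap.trace_eq_sum_inner _ b, LinearMap.adjoint_inner_right]

lemma homInner_eq_sum {V W ι : Type*} [NormedAddCommGroup V] [InnerProductSpace ℝ V]
    [FiniteDimensional ℝ V] [NormedAddCommGroup W] [InnerProductSpace ℝ W] [FiniteDimensional ℝ W]
    [Fintype ι] (b : OrthonormalBasis ι ℝ V) (A B : V →ₗ[ℝ] W) :
    homInner A B = ∑ i, inner ℝ (A (b i)) (B (b i)) := by
  rw [sum_inner_eq_trace b, homInner, sum_inner_eq_trace]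

variable {n : ℕ}
  {V : Type*} [NormedAddCommGroup V] [InnerProductSpace ℝ V] [Fact (finrank ℝ V = n + 1)]
  {W : Type*} [NormedAddCommGroup W] [InnerProductSpace ℝ W] [Fact (finrank ℝ W = n + 1)]

lemma volumeForm_eq_det (o : Orientation ℝ V (Fin (n + 1))) :
    o.volumeForm = (orientedBasis o).toBasis.det :=
  o.volumeForm_robust _ (o.finOrthonormalBasis_orientation _ _)

lemma volumeForm_orientedBasis (o : Orientation ℝ V (Fin (n + 1))) :
    o.volumeForm (orientedBasis o) = 1 := by
  rw [volumeForm_eq_det, ← OrthonormalBasis.coe_toBasis, Basis.det_self]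

lemma abs_volumeForm_eq_sqrt (o : Orientation ℝ V (Fin (n + 1))) (v : Fin (n + 1) → V) :
    |o.volumeForm v| = Real.sqrt (Matrix.of fun i j => inner ℝ (v i) (v j)).det := by
  have gram_eq : (Matrix.of fun i j => inner ℝ (v i) (v j)) =
      ((orientedBasis o).toBasis.toMatrix v).transpose * (orientedBasis o).toBasis.toMatrix v := by
    ext i j
    rw [Matrix.mul_apply, Matrix.of_apply, ← (orientedBasis o).sum_inner_mul_inner]
    refine Finset.sum_congr rfl fun k _ => ?_
    simp [Basis.toMatrix_apply, OrthonormalBasis.repr_apply_apply, real_inner_comm]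
  rw [gram_eq, Matrix.det_mul, Matrix.det_transpose, Real.sqrt_mul_self_eq_abs, volumeForm_eq_det,
    Basis.det_apply]

lemma Det_eq (oV : Orientation ℝ V (Fin (n + 1))) (oW : Orientation ℝ W (Fin (n + 1)))
    (A : V →ₗ[ℝ] W) : Det oV oW A = oW.volumeForm (A ∘ orientedBasis oV) := by
  simp [Det, hodgeTop, hodgeZero]

lemma volumeForm_compLinearMap (oV : Orientation ℝ V (Fin (n + 1)))
    (oW : Orientation ℝ W (Fin (n + 1))) (A : V →ₗ[ℝ] W) :
    oW.volumeForm.compLinearMap A = Det oV oW A • oV.volumeForm := by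
  rw [(oW.volumeForm.compLinearMap A).eq_smul_basis_det (orientedBasis oV).toBasis,
    ← volumeForm_eq_det, Det_eq]
  congr 1

lemma hodgeOne_orientedBasis (o : Orientation ℝ V (Fin (n + 1))) (i : Fin (n + 1)) :
    hodgeOne o (orientedBasis o i) = (-1 : ℝ) ^ (i : ℕ) •
      exteriorPower.ιMulti ℝ n fun j : Fin n => orientedBasis o (i.succAbove j) := by
  simp only [hodgeOne, LinearMap.sum_apply, LinearMap.smul_apply, LinearMap.smulRight_apply,
    innerₛₗ_apply_apply, OrthonormalBasis.inner_eq_ite]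
  simp

lemma inner_hodgePred_ιMulti (o : Orientation ℝ W (Fin (n + 1))) (w : W) (v : Fin n → W) :
    inner ℝ w (hodgePred o (exteriorPower.ιMulti ℝ n v)) =
      (-1 : ℝ) ^ n * o.volumeForm (Matrix.vecCons w v) := by
  have expand : o.volumeForm (Matrix.vecCons w v) = ∑ k, inner ℝ (orientedBasis o k) w *
      o.volumeForm (Matrix.vecCons (orientedBasis o k) v) := by
    have cons_eq (u : W) : Matrix.vecCons u v = Function.update (Matrix.vecCons 0 v) 0 u :=
      (Fin.update_cons_zero (α := fun _ => W) 0 v u).symm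
    conv_lhs => rw [← (orientedBasis o).sum_repr' w, cons_eq, AlternatingMap.map_update_sum]
    simp only [← cons_eq, AlternatingMap.map_vecCons_smul, smul_eq_mul]
  rw [expand, Finset.mul_sum]
  simp only [hodgePred, LinearMap.sum_apply, LinearMap.smul_apply, LinearMap.smulRight_apply,
    exteriorPower.alternatingMapLinearEquiv_apply_ιMulti, inner_sum, inner_smul_right,
    AlternatingMap.curryLeft_apply_apply, real_inner_comm w]
  exact Finset.sum_congr rfl fun k _ => by ring

lemma update_eq_insertNth {α β : Type*} (f : α → β) (b : Fin (n + 1) → α) (i : Fin (n + 1))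
    (w : β) : Function.update (f ∘ b) i w = i.insertNth w fun j : Fin n => f (b (i.succAbove j)) :=
  Fin.eq_insertNth_iff.2 ⟨by simp, by ext j; simp [Fin.removeNth, Fin.succAbove_ne]⟩

lemma inner_Cof_orientedBasis (oV : Orientation ℝ V (Fin (n + 1)))
    (oW : Orientation ℝ W (Fin (n + 1))) (B : V →ₗ[ℝ] W) (i : Fin (n + 1)) (w : W) :
    inner ℝ w (Cof oV oW B (orientedBasis oV i)) =
      oW.volumeForm (Function.update (B ∘ orientedBasis oV) i w) := by
  have sign_sq : ((-1 : ℝ) ^ n) * ((-1) ^ n) = 1 := by rw [← mul_pow]; simp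
  rw [update_eq_insertNth, AlternatingMap.map_insertNth]
  simp only [Cof, LinearMap.smul_apply, LinearMap.comp_apply, hodgeOne_orientedBasis, map_smul,
    inner_smul_right, exteriorPower.map_apply_ιMulti, inner_hodgePred_ιMulti, Function.comp_def]
  linear_combination ((-1 : ℝ) ^ (i : ℕ) *
    oW.volumeForm (Matrix.vecCons w fun j : Fin n => B (orientedBasis oV (i.succAbove j)))) *
    sign_sq

lemma pullbackVariation_volumeForm [FiniteDimensional ℝ V] (oV : Orientation ℝ V (Fin (n + 1)))
    (oW : Orientation ℝ W (Fin (n + 1))) (A B : V →ₗ[ℝ] W) :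
    pullbackVariation oW.volumeForm A B = homInner A (Cof oV oW B) • oV.volumeForm := by
  have : FiniteDimensional ℝ W := .of_fact_finrank_eq_succ n
  rw [(pullbackVariation oW.volumeForm A B).eq_smul_basis_det (orientedBasis oV).toBasis,
    ← volumeForm_eq_det, pullbackVariation_apply, homInner_eq_sum (orientedBasis oV)]
  simp only [inner_Cof_orientedBasis, OrthonormalBasis.coe_toBasis]

end LinearAlgebra

/-! ### Calculus in coordinates -/

section IntegralConvex

variable {E F : Type*} [NormedAddCommGroup E] [NormedSpace ℝ E] [NormedAddCommGroup F]
  {C k : Set E}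

lemma segment_inter_frontier_nonempty (hC : IsClosed C) {x y : E} (hx : x ∈ C) (hy : y ∉ C) :
    (segment ℝ x y ∩ frontier C).Nonempty := by
  by_contra hne
  have mem_interior (z : E) (hz : z ∈ segment ℝ x y) (hzC : z ∈ C) : z ∈ interior C := by
    by_contra hzi
    exact hne ⟨z, hz, by rw [hC.frontier_eq]; exact ⟨hzC, hzi⟩⟩
  obtain ⟨z, -, hzi, hzC⟩ := (convex_segment x y).isPreconnected (interior C) Cᶜ
    isOpen_interior hC.isOpen_compl (fun z hz => (em (z ∈ C)).imp (mem_interior z hz) id)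
    ⟨x, left_mem_segment ℝ x y, mem_interior x (left_mem_segment ℝ x y) hx⟩
    ⟨y, right_mem_segment ℝ x y, hy⟩
  exact hzC (interior_subset hzi)

lemma lipschitzWith_indicator {g : E → F} {L : NNReal} (hC : IsClosed C)
    (hg : LipschitzOnWith L g C) (hgf : ∀ x ∈ frontier C, g x = 0) :
    LipschitzWith L (C.indicator g) := by
  have crossing {x y : E} (hx : x ∈ C) (hy : y ∉ C) : ‖g x‖ ≤ L * ‖x - y‖ := by
    obtain ⟨z, hz, hzf⟩ := segment_inter_frontier_nonempty hC hx hy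
    have hxz := hg.norm_sub_le hx (hC.frontier_subset hzf)
    rw [hgf z hzf, sub_zero, ← dist_eq_norm] at hxz
    refine hxz.trans (mul_le_mul_of_nonneg_left ?_ L.2)
    rw [← dist_eq_norm, ← dist_add_dist_of_mem_segment hz]
    exact le_add_of_nonneg_right dist_nonneg
  refine LipschitzWith.of_dist_le_mul fun x y => ?_
  rw [dist_eq_norm, dist_eq_norm]
  by_cases hx : x ∈ C <;> by_cases hy : y ∈ C
  · simpa [hx, hy] using hg.norm_sub_le hx hy
  · simpa [hx, hy] using crossing hx hy
  · simpa [hx, hy, norm_sub_rev x] using crossing hy hx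
  · simpa [hx, hy] using mul_nonneg L.2 (norm_nonneg (x - y))

lemma integral_lineDeriv_eq_zero [FiniteDimensional ℝ E] [MeasurableSpace E] [BorelSpace E]
    (μ : Measure E) [μ.IsAddHaarMeasure] {g : E → ℝ} {L : NNReal} (hg : LipschitzWith L g)
    (hgc : HasCompactSupport g) (v : E) : ∫ x, lineDeriv ℝ g x v ∂μ = 0 := by
  have key := LipschitzWith.integral_lineDeriv_mul_eq (μ := μ) (C := 0) (f := fun _ : E => (1 : ℝ))
    (LipschitzWith.const 1) hg hgc (-v)
  simpa [lineDeriv] using key.symm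

variable [NormedSpace ℝ F]

lemma lineDeriv_indicator (hC : IsClosed C) {g : E → F} (hg : DifferentiableOn ℝ g C) {x : E}
    (hx : x ∉ frontier C) (v : E) :
    lineDeriv ℝ (C.indicator g) x v = C.indicator (fun x => fderivWithin ℝ g C x v) x := by
  by_cases hxC : x ∈ C
  · have hCx : C ∈ 𝓝 x := mem_interior_iff_mem_nhds.1 <| by
      by_contra h
      exact hx (by rw [hC.frontier_eq]; exact ⟨hxC, h⟩)
    have heq : C.indicator g =ᶠ[𝓝 x] g := by
      filter_upwards [hCx] with y hy using indicator_of_mem hy g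
    rw [indicator_of_mem hxC, fderivWithin_of_mem_nhds hCx, heq.lineDeriv_eq,
      ((hg x hxC).differentiableAt hCx).lineDeriv_eq_fderiv]
  · have heq : C.indicator g =ᶠ[𝓝 x] fun _ => (0 : F) := by
      filter_upwards [hC.isOpen_compl.mem_nhds hxC] with y hy using indicator_of_notMem hy g
    rw [indicator_of_notMem hxC, heq.lineDeriv_eq]
    simp [lineDeriv]

lemma fderivWithin_eq_zero_of_notMem (hk : IsClosed k) {g : E → F}
    (hgk : ∀ x ∈ C, x ∉ k → g x = 0) {x : E} (hx : x ∈ C) (hxk : x ∉ k) :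
    fderivWithin ℝ g C x = 0 := by
  have heq : g =ᶠ[𝓝[C] x] fun _ => (0 : F) := by
    filter_upwards [self_mem_nhdsWithin, mem_nhdsWithin_of_mem_nhds (hk.isOpen_compl.mem_nhds hxk)]
      with y hy hyk using hgk y hy hyk
  rw [heq.fderivWithin_eq (hgk x hx hxk), fderivWithin_const_apply]

lemma integrableOn_fderivWithin [MeasurableSpace E] [BorelSpace E] {μ : Measure E}
    [IsFiniteMeasureOnCompacts μ] (hC : IsClosed C) (hu : UniqueDiffOn ℝ C) (hk : IsCompact k)
    {g : E → F} (hg : ContDiffOn ℝ 1 g C) (hgk : ∀ x ∈ C, x ∉ k → g x = 0) (v : E) :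
    IntegrableOn (fun x => fderivWithin ℝ g C x v) C μ := by
  have hkC : IntegrableOn (fun x => fderivWithin ℝ g C x v) (k ∩ C) μ :=
    (((hg.continuousOn_fderivWithin hu le_rfl).mono inter_subset_right).clm_apply
      continuousOn_const).integrableOn_compact (hk.inter_right hC)
  refine hkC.of_forall_sdiff_eq_zero hC.measurableSet fun x hx => ?_
  rw [fderivWithin_eq_zero_of_notMem hk.isClosed hgk hx.1 fun h => hx.2 ⟨h, hx.1⟩, zero_apply]

lemma exists_lipschitzOnWith (hconv : Convex ℝ C) (hC : IsClosed C) (hu : UniqueDiffOn ℝ C)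
    (hk : IsCompact k) {g : E → F} (hg : ContDiffOn ℝ 1 g C) (hgk : ∀ x ∈ C, x ∉ k → g x = 0) :
    ∃ L, LipschitzOnWith L g C := by
  obtain ⟨B, hB⟩ := (hk.inter_right hC).exists_bound_of_continuousOn
    ((hg.continuousOn_fderivWithin hu le_rfl).mono inter_subset_right)
  refine ⟨B.toNNReal, hconv.lipschitzOnWith_of_nnnorm_fderivWithin_le
    (hg.differentiableOn one_ne_zero) fun x hx => ?_⟩
  by_cases hxk : x ∈ k
  · exact NNReal.le_toNNReal_of_coe_le (hB x ⟨hxk, hx⟩)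
  · simp [fderivWithin_eq_zero_of_notMem hk.isClosed hgk hx hxk]

/- Extended by zero, `g` is Lipschitz, so that no regularity of the frontier of `C` is needed. -/
theorem integral_fderivWithin_convex_eq_zero [FiniteDimensional ℝ E] [MeasurableSpace E]
    [BorelSpace E] (μ : Measure E) [μ.IsAddHaarMeasure] (hconv : Convex ℝ C) (hC : IsClosed C)
    (hCi : (interior C).Nonempty) (hk : IsCompact k) {g : E → ℝ} (hg : ContDiffOn ℝ 1 g C)
    (hgk : ∀ x ∈ C, x ∉ k → g x = 0) (hgf : ∀ x ∈ frontier C, g x = 0) (v : E) :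
    ∫ x in C, fderivWithin ℝ g C x v ∂μ = 0 := by
  obtain ⟨L, hL⟩ := exists_lipschitzOnWith hconv hC (uniqueDiffOn_convex hconv hCi) hk hg hgk
  have hsupp : HasCompactSupport (C.indicator g) := HasCompactSupport.intro hk fun x hx => by
    by_cases hxC : x ∈ C
    · rw [indicator_of_mem hxC, hgk x hxC hx]
    · exact indicator_of_notMem hxC _
  rw [← integral_lineDeriv_eq_zero μ (lipschitzWith_indicator hC hL hgf) hsupp v,
    ← integral_indicator hC.measurableSet]
  refine integral_congr_ae ?_
  filter_upwards [compl_mem_ae_iff.2 (hconv.addHaar_frontier μ)] with x hx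
  exact (lineDeriv_indicator hC (hg.differentiableOn one_ne_zero) hx v).symm

section Inter

lemma indicator_eventuallyEq_nhdsWithin {α β : Type*} [TopologicalSpace α] [Zero β]
    {U C : Set α} {u : α → β} (hU : IsOpen U) {x : α} (hx : x ∈ U) :
    U.indicator u =ᶠ[𝓝[C] x] u :=
  Filter.mem_of_superset (mem_nhdsWithin_of_mem_nhds (hU.mem_nhds hx)) fun _ hz =>
    indicator_of_mem hz u

lemma indicator_eq_zero_of_notMem {α β : Type*} [Zero β] {U C k : Set α} {u : α → β}
    (huk : ∀ x ∈ U ∩ C, x ∉ k → u x = 0) {x : α} (hx : x ∈ C) (hxk : x ∉ k) :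
    U.indicator u x = 0 :=
  indicator_apply_eq_zero.2 fun hxU => huk x ⟨hxU, hx⟩ hxk

variable {U : Set E} {u : E → F}

lemma fderivWithin_indicator (hU : IsOpen U) {x : E} (hx : x ∈ U) :
    fderivWithin ℝ (U.indicator u) C x = fderivWithin ℝ u C x :=
  (indicator_eventuallyEq_nhdsWithin hU hx).fderivWithin_eq (indicator_of_mem hx u)

lemma contDiffOn_indicator (hU : IsOpen U) (hk : IsClosed k) (hkU : k ⊆ U)
    (hu : ∀ x ∈ U ∩ C, ContDiffWithinAt ℝ 1 u C x) (huk : ∀ x ∈ U ∩ C, x ∉ k → u x = 0) :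
    ContDiffOn ℝ 1 (U.indicator u) C := by
  intro x hx
  by_cases hxU : x ∈ U
  · exact (hu x ⟨hxU, hx⟩).congr_of_eventuallyEq (indicator_eventuallyEq_nhdsWithin hU hxU)
      (indicator_of_mem hxU u)
  · have hxk : x ∉ k := fun h => hxU (hkU h)
    refine (contDiffWithinAt_const (c := (0 : F))).congr_of_eventuallyEq ?_
      (indicator_eq_zero_of_notMem huk hx hxk)
    filter_upwards [self_mem_nhdsWithin, mem_nhdsWithin_of_mem_nhds (hk.isOpen_compl.mem_nhds hxk)]
      with z hz hzk using indicator_eq_zero_of_notMem huk hz hzk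

variable [MeasurableSpace E] [BorelSpace E]

lemma integrableOn_fderivWithin_inter {μ : Measure E} [IsFiniteMeasureOnCompacts μ]
    (hC : IsClosed C) (hCu : UniqueDiffOn ℝ C) (hU : IsOpen U) (hk : IsCompact k) (hkU : k ⊆ U)
    (hu : ∀ x ∈ U ∩ C, ContDiffWithinAt ℝ 1 u C x) (huk : ∀ x ∈ U ∩ C, x ∉ k → u x = 0) (v : E) :
    IntegrableOn (fun x => fderivWithin ℝ u C x v) (U ∩ C) μ := by
  have hg := contDiffOn_indicator hU hk.isClosed hkU hu huk
  refine IntegrableOn.congr_fun ((integrableOn_fderivWithin hC hCu hk hg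
    (fun x hx hxk => indicator_eq_zero_of_notMem huk hx hxk) v).mono_set inter_subset_right)
    (fun x hx => ?_) (hU.measurableSet.inter hC.measurableSet)
  simp only [fderivWithin_indicator hU hx.1]

theorem integral_fderivWithin_inter_eq_zero [FiniteDimensional ℝ E] (μ : Measure E)
    [μ.IsAddHaarMeasure] (hconv : Convex ℝ C) (hC : IsClosed C) (hCi : (interior C).Nonempty)
    (hU : IsOpen U) (hk : IsCompact k) (hkU : k ⊆ U) {u : E → ℝ}
    (hu : ∀ x ∈ U ∩ C, ContDiffWithinAt ℝ 1 u C x) (huk : ∀ x ∈ U ∩ C, x ∉ k → u x = 0)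
    (huf : ∀ x ∈ U ∩ frontier C, u x = 0) (v : E) :
    ∫ x in U ∩ C, fderivWithin ℝ u C x v ∂μ = 0 := by
  have hg := contDiffOn_indicator hU hk.isClosed hkU hu huk
  have hgk : ∀ x ∈ C, x ∉ k → U.indicator u x = 0 := fun x hx hxk =>
    indicator_eq_zero_of_notMem huk hx hxk
  calc ∫ x in U ∩ C, fderivWithin ℝ u C x v ∂μ
      = ∫ x in U ∩ C, fderivWithin ℝ (U.indicator u) C x v ∂μ :=
        setIntegral_congr_fun (hU.measurableSet.inter hC.measurableSet) fun x hx => by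
          simp only [fderivWithin_indicator hU hx.1]
    _ = ∫ x in C, fderivWithin ℝ (U.indicator u) C x v ∂μ :=
        (setIntegral_eq_of_subset_of_forall_sdiff_eq_zero hC.measurableSet inter_subset_right
          fun x hx => by
            rw [fderivWithin_eq_zero_of_notMem hk.isClosed hgk hx.1
              fun h => hx.2 ⟨hkU h, hx.1⟩, zero_apply]).symm
    _ = 0 := integral_fderivWithin_convex_eq_zero μ hconv hC hCi hk hg hgk
        (fun x hx => indicator_apply_eq_zero.2 fun hxU => huf x ⟨hxU, hx⟩) v

end Inter

end IntegralConvex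

section FluxDivergence

variable {ι E W : Type*} [Fintype ι] [NormedAddCommGroup E] [NormedSpace ℝ E]
  [NormedAddCommGroup W] [NormedSpace ℝ W] (η : W [⋀^ι]→L[ℝ] ℝ)

lemma hasFDerivAt_comp_mul_continuousAlternatingMap [DecidableEq ι] {x : E} {F : E → W}
    {F' : E →L[ℝ] W} {G : W → ℝ} {G' : W →L[ℝ] ℝ} {R : Set W} {u : ι → E → W} {u' : ι → E →L[ℝ] W}
    (hG : HasFDerivWithinAt G G' R (F x)) (hF : HasFDerivAt F F' x) (hR : ∀ᶠ z in 𝓝 x, F z ∈ R)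
    (hu : ∀ i, HasFDerivAt (u i) (u' i) x) :
    HasFDerivAt (fun z => G (F z) * η (fun i => u i z))
      (G (F x) • ∑ i, η.toContinuousLinearMap (u · x) i ∘L u' i + η (u · x) • (G' ∘L F')) x := by
  have hGF : HasFDerivAt (fun z => G (F z)) (G' ∘L F') x :=
    (hG.comp x (hF.hasFDerivWithinAt (s := F ⁻¹' R)) fun z hz => hz).hasFDerivAt hR
  exact hGF.mul (HasFDerivAt.multilinear_comp (f := η.toContinuousMultilinearMap) hu)

variable {F S : E → W} {G : W → ℝ} {G' : W →L[ℝ] ℝ} {R : Set W} {x : E}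

lemma fderiv_flux_apply [DecidableEq ι] (hF : ContDiffAt ℝ 2 F x) (hS : DifferentiableAt ℝ S x)
    (hG : HasFDerivWithinAt G G' R (F x)) (hR : ∀ᶠ z in 𝓝 x, F z ∈ R) (e : ι → E) (i : ι) (v : E) :
    fderiv ℝ (fun z => G (F z) * η (Function.update (fun j => fderiv ℝ F z (e j)) i (S z))) x v =
      G (F x) * ∑ j, η (Function.update (Function.update (fun j => fderiv ℝ F x (e j)) i (S x)) j
        (if j = i then fderiv ℝ S x v else fderiv ℝ (fderiv ℝ F) x v (e j))) +
      G' (fderiv ℝ F x v) * η (Function.update (fun j => fderiv ℝ F x (e j)) i (S x)) := by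
  have hDF : HasFDerivAt (fderiv ℝ F) (fderiv ℝ (fderiv ℝ F) x) x :=
    ((hF.fderiv_right (m := 1) le_rfl).differentiableAt one_ne_zero).hasFDerivAt
  have hslot (j : ι) : HasFDerivAt
      (fun z => Function.update (fun j => fderiv ℝ F z (e j)) i (S z) j)
      (if j = i then fderiv ℝ S x else (fderiv ℝ (fderiv ℝ F) x).flip (e j)) x := by
    by_cases hij : j = i
    · subst hij
      simpa using hS.hasFDerivAt
    · simp only [Function.update_of_ne hij, if_neg hij]
      exact (ContinuousLinearMap.apply ℝ W (e j)).hasFDerivAt.comp x hDF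
  rw [(hasFDerivAt_comp_mul_continuousAlternatingMap η hG
    (hF.differentiableAt two_ne_zero).hasFDerivAt hR hslot).fderiv]
  simp only [add_apply, smul_apply, sum_apply, ContinuousLinearMap.comp_apply, smul_eq_mul,
    mul_comm (η _)]
  refine congrArg₂ _ (congrArg _ (Finset.sum_congr rfl fun j _ => ?_)) rfl
  split_ifs <;> rfl

/-- Mixed second derivatives cancel in pairs since `η` is antisymmetric, and the derivatives of `G`
combine by Cramer's rule. -/
theorem sum_fderiv_flux [DecidableEq ι] (b : Basis ι ℝ W) (hF : ContDiffAt ℝ 2 F x)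
    (hS : DifferentiableAt ℝ S x) (hG : HasFDerivWithinAt G G' R (F x))
    (hR : ∀ᶠ z in 𝓝 x, F z ∈ R) (e : ι → E) :
    ∑ i, fderiv ℝ (fun z => G (F z) *
        η (Function.update (fun j => fderiv ℝ F z (e j)) i (S z))) x (e i) =
      G' (S x) * η (fun j => fderiv ℝ F x (e j)) + G (F x) *
        ∑ i, η (Function.update (fun j => fderiv ℝ F x (e j)) i (fderiv ℝ S x (e i))) := by
  have hsymm : IsSymmSndFDerivAt ℝ F x := hF.isSymmSndFDerivAt (by simp)
  have cramer := sum_mul_map_update b η.toAlternatingMap G'.toLinearMap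
    (fun j => fderiv ℝ F x (e j)) (S x)
  have second_order := sum_offDiag_map_update_update η.toAlternatingMap
    (fun j => fderiv ℝ F x (e j)) (S x) (A := fun i j => fderiv ℝ (fderiv ℝ F) x (e i) (e j))
    fun i j => hsymm (e i) (e j)
  have first_order : ∑ i, ∑ j, η (Function.update
      (Function.update (fun j => fderiv ℝ F x (e j)) i (S x)) j
      (if j = i then fderiv ℝ S x (e i) else fderiv ℝ (fderiv ℝ F) x (e i) (e j))) =
      ∑ i, η (Function.update (fun j => fderiv ℝ F x (e j)) i (fderiv ℝ S x (e i))) := by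
    rw [← Finset.sum_product', ← Finset.diag_union_offDiag,
      Finset.sum_union (Finset.disjoint_diag_offDiag _), Finset.sum_diag, add_eq_left.2]
    · simp
    · rw [← second_order]
      refine Finset.sum_congr rfl fun p hp => ?_
      rw [if_neg (Finset.mem_offDiag.1 hp).2.2.symm]
      rfl
  simp only [fderiv_flux_apply η hF hS hG hR, Finset.sum_add_distrib, ← Finset.mul_sum, first_order]
  rw [add_comm]
  exact congrArg₂ _ cramer rfl

end FluxDivergence

section Families

variable {E W : Type*} [NormedAddCommGroup E] [NormedSpace ℝ E]
  [NormedAddCommGroup W] [NormedSpace ℝ W] {Φ : ℝ × E → W} {S : E → W} {t₀ : ℝ} {x : E}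

lemma fderiv_slice {t : ℝ} (hΦ : DifferentiableAt ℝ Φ (t, x)) :
    fderiv ℝ (fun z => Φ (t, z)) x = fderiv ℝ Φ (t, x) ∘L .inr ℝ ℝ E :=
  (hΦ.hasFDerivAt.comp x (hasFDerivAt_prodMk_right t x)).fderiv

lemma hasDerivAt_slice {t : ℝ} (hΦ : DifferentiableAt ℝ Φ (t, x)) :
    HasDerivAt (fun s => Φ (s, x)) (fderiv ℝ Φ (t, x) (1, 0)) t :=
  hΦ.hasFDerivAt.comp_hasDerivAt t ((hasDerivAt_id t).prodMk (hasDerivAt_const t x))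

lemma fderivWithin_slice {t : ℝ} {R : Set E} (hR : UniqueDiffWithinAt ℝ R x)
    (hΦ : DifferentiableWithinAt ℝ Φ (univ ×ˢ R) (t, x)) :
    fderivWithin ℝ (fun z => Φ (t, z)) R x =
      fderivWithin ℝ Φ (univ ×ˢ R) (t, x) ∘L .inr ℝ ℝ E :=
  (hΦ.hasFDerivWithinAt.comp x (hasFDerivAt_prodMk_right t x).hasFDerivWithinAt
    fun _ hz => ⟨trivial, hz⟩).fderivWithin hR

lemma hasDerivAt_slice_of_mem {t : ℝ} {R : Set E} (hx : x ∈ R)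
    (hΦ : DifferentiableWithinAt ℝ Φ (univ ×ˢ R) (t, x)) :
    HasDerivAt (fun s => Φ (s, x)) (fderivWithin ℝ Φ (univ ×ˢ R) (t, x) (1, 0)) t :=
  hΦ.hasFDerivWithinAt.comp_hasDerivAt_of_eq t ((hasDerivAt_id t).prodMk (hasDerivAt_const t x))
    (.of_forall fun _ => ⟨trivial, hx⟩) rfl

lemma fderiv_eq_of_hasDerivAt_slice (hΦ : ContDiffAt ℝ 2 Φ (t₀, x))
    (hS : ∀ᶠ z in 𝓝 x, HasDerivAt (fun t => Φ (t, z)) (S z) t₀) (v : E) :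
    fderiv ℝ S x v = fderiv ℝ (fderiv ℝ Φ) (t₀, x) (0, v) (1, 0) := by
  have hD : HasFDerivAt (fderiv ℝ Φ) (fderiv ℝ (fderiv ℝ Φ) (t₀, x)) (t₀, x) :=
    ((hΦ.fderiv_right (m := 1) le_rfl).differentiableAt one_ne_zero).hasFDerivAt
  have hΦ_nhds : ∀ᶠ z in 𝓝 x, DifferentiableAt ℝ Φ (t₀, z) :=
    ((Continuous.prodMk_right t₀).tendsto x).eventually <|
      ((hΦ.of_le one_le_two).eventually (by simp)).mono fun q hq => hq.differentiableAt one_ne_zero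
  have hS_eq : S =ᶠ[𝓝 x] fun z => fderiv ℝ Φ (t₀, z) (1, 0) := by
    filter_upwards [hΦ_nhds, hS] with z hz hSz using hSz.unique (hasDerivAt_slice hz)
  have hD_slice : HasFDerivAt (fun z => fderiv ℝ Φ (t₀, z) (1, 0))
      (.apply ℝ W ((1 : ℝ), (0 : E)) ∘L fderiv ℝ (fderiv ℝ Φ) (t₀, x) ∘L .inr ℝ ℝ E) x :=
    (ContinuousLinearMap.apply ℝ W ((1 : ℝ), (0 : E))).hasFDerivAt.comp x
      (hD.comp x (hasFDerivAt_prodMk_right t₀ x))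
  rw [hS_eq.fderiv_eq, hD_slice.fderiv]
  rfl

lemma hasDerivAt_fderiv_slice (hΦ : ContDiffAt ℝ 2 Φ (t₀, x))
    (hS : ∀ᶠ z in 𝓝 x, HasDerivAt (fun t => Φ (t, z)) (S z) t₀) (v : E) :
    HasDerivAt (fun t => fderiv ℝ (fun z => Φ (t, z)) x v) (fderiv ℝ S x v) t₀ := by
  have hD : HasFDerivAt (fderiv ℝ Φ) (fderiv ℝ (fderiv ℝ Φ) (t₀, x)) (t₀, x) :=
    ((hΦ.fderiv_right (m := 1) le_rfl).differentiableAt one_ne_zero).hasFDerivAt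
  have hΦ_nhds : ∀ᶠ t in 𝓝 t₀, DifferentiableAt ℝ Φ (t, x) :=
    ((Continuous.prodMk_left x).tendsto t₀).eventually <|
      ((hΦ.of_le one_le_two).eventually (by simp)).mono fun q hq => hq.differentiableAt one_ne_zero
  have hline : HasDerivAt (fun t => fderiv ℝ Φ (t, x) (0, v))
      (fderiv ℝ (fderiv ℝ Φ) (t₀, x) (1, 0) (0, v)) t₀ :=
    (ContinuousLinearMap.apply ℝ W ((0 : ℝ), v)).hasFDerivAt.comp_hasDerivAt t₀ <|
      hD.comp_hasDerivAt t₀ ((hasDerivAt_id t₀).prodMk (hasDerivAt_const t₀ x))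
  rw [fderiv_eq_of_hasDerivAt_slice hΦ hS,
    hΦ.isSymmSndFDerivAt (by simp) ((0 : ℝ), v) ((1 : ℝ), (0 : E))]
  refine hline.congr_of_eventuallyEq (hΦ_nhds.mono fun t ht => ?_)
  simp [fderiv_slice ht]

theorem hasDerivAt_mul_continuousAlternatingMap_slice {ι : Type*} [Fintype ι] [DecidableEq ι]
    (η : W [⋀^ι]→L[ℝ] ℝ) {G : W → ℝ} {G' : W →L[ℝ] ℝ} {R : Set W} (hΦ : ContDiffAt ℝ 2 Φ (t₀, x))
    (hS : ∀ᶠ z in 𝓝 x, HasDerivAt (fun t => Φ (t, z)) (S z) t₀)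
    (hG : HasFDerivWithinAt G G' R (Φ (t₀, x))) (hR : ∀ᶠ t in 𝓝 t₀, Φ (t, x) ∈ R) (e : ι → E) :
    HasDerivAt (fun t => G (Φ (t, x)) * η (fun j => fderiv ℝ (fun z => Φ (t, z)) x (e j)))
      (G' (S x) * η (fun j => fderiv ℝ (fun z => Φ (t₀, z)) x (e j)) + G (Φ (t₀, x)) *
        ∑ i, η (Function.update (fun j => fderiv ℝ (fun z => Φ (t₀, z)) x (e j)) i
          (fderiv ℝ S x (e i)))) t₀ := by
  convert (hasFDerivAt_comp_mul_continuousAlternatingMap η (F := fun t => Φ (t, x))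
    (u := fun j t => fderiv ℝ (fun z => Φ (t, z)) x (e j)) hG hS.self_of_nhds.hasFDerivAt hR
    fun j => (hasDerivAt_fderiv_slice hΦ hS (e j)).hasFDerivAt).hasDerivAt using 1
  simp [add_comm, mul_comm (G' _)]

end Families

section Determinant

/-- The determinant, the standard volume form of the coordinate space of the charts. -/
def stdVol (n : ℕ) : (𝔼 n) [⋀^Fin (n + 1)]→L[ℝ] ℝ where
  __ := (EuclideanSpace.basisFun (Fin (n + 1)) ℝ).toBasis.det
  cont := by
    refine Continuous.matrix_det (continuous_matrix fun i j => ?_)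
    exact (EuclideanSpace.proj i).continuous.comp (continuous_apply j)

variable {n : ℕ}

lemma stdVol_apply (v : Fin (n + 1) → 𝔼 n) :
    stdVol n v = (EuclideanSpace.basisFun (Fin (n + 1)) ℝ).toBasis.det v := rfl

lemma coe_basisFun_toBasis :
    ⇑(EuclideanSpace.basisFun (Fin (n + 1)) ℝ).toBasis = fun i => EuclideanSpace.single i 1 :=
  funext fun i => by simp

lemma stdVol_single : stdVol n (fun i => EuclideanSpace.single i 1) = 1 := by
  rw [stdVol_apply, ← coe_basisFun_toBasis, Basis.det_self]

lemma eq_mul_stdVol (η : (𝔼 n) [⋀^Fin (n + 1)]→ₗ[ℝ] ℝ) (v : Fin (n + 1) → 𝔼 n) :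
    η v = η (fun i => EuclideanSpace.single i 1) * stdVol n v := by
  rw [stdVol_apply, ← coe_basisFun_toBasis]
  exact DFunLike.congr_fun (η.eq_smul_basis_det _) v

lemma sum_stdVol_update_map (T : 𝔼 n →ₗ[ℝ] 𝔼 n) (v : Fin (n + 1) → 𝔼 n) :
    ∑ i, stdVol n (Function.update v i (T (v i))) = LinearMap.trace ℝ _ T * stdVol n v :=
  sum_map_update_map (EuclideanSpace.basisFun _ ℝ).toBasis (stdVol n).toAlternatingMap T v

lemma hasFDerivWithinAt_det {𝕜 P ι : Type*} [NontriviallyNormedField 𝕜] [NormedAddCommGroup P]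
    [NormedSpace 𝕜 P] [Fintype ι] [DecidableEq ι] {s : Set P} {x : P} {A : P → Matrix ι ι 𝕜}
    {A' : ι → ι → P →L[𝕜] 𝕜}
    (hA : ∀ i j, HasFDerivWithinAt (fun y => A y i j) (A' i j) s x) :
    HasFDerivWithinAt (fun y => (A y).det) (∑ i, ∑ j, (A x).adjugate j i • A' i j) s x := by
  let detRow : ContinuousMultilinearMap 𝕜 (fun _ : ι => ι → 𝕜) 𝕜 :=
    ⟨Matrix.detRowAlternating.toMultilinearMap, Continuous.matrix_det continuous_id⟩
  have hrow (i : ι) :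
      HasFDerivWithinAt (fun y => A y i) (ContinuousLinearMap.pi (A' i)) s x :=
    hasFDerivWithinAt_pi.2 (hA i)
  refine (HasFDerivWithinAt.multilinear_comp (f := detRow) hrow).congr_fderiv ?_
  ext w
  simp only [sum_apply, smul_apply, smul_eq_mul]
  refine Finset.sum_congr rfl fun i _ => ?_
  change ((A x).updateRow i fun j => A' i j w).det = _
  rw [← Matrix.cramer_transpose_apply, Matrix.cramer_eq_adjugate_mulVec,
    ← Matrix.adjugate_transpose]
  rfl

end Determinant

section Charts

variable {n : ℕ} {H : Type*} [TopologicalSpace H] (I : ModelWithCorners ℝ (𝔼 n) H)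
  {M : Type*} [TopologicalSpace M] [ChartedSpace H M] [IsManifold I ∞ M]

/-- The coordinates of a tangent vector at `p` in the chart centred at `q`. -/
def coords (q p : M) : TangentSpace I p →L[ℝ] 𝔼 n :=
  (trivializationAt (𝔼 n) (TangentSpace I) q).continuousLinearMapAt ℝ p

/-- The tangent vector at `p` with given coordinates in the chart centred at `q`. -/
def ofCoords (q p : M) : 𝔼 n →L[ℝ] TangentSpace I p :=
  (trivializationAt (𝔼 n) (TangentSpace I) q).symmL ℝ p

variable {I} {q p : M}

lemma mem_baseSet (hp : p ∈ (extChartAt I q).source) :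
    p ∈ (trivializationAt (𝔼 n) (TangentSpace I) q).baseSet := by
  simpa using hp

lemma coords_eq (hp : p ∈ (extChartAt I q).source) (v : TangentSpace I p) :
    coords I q p v = (trivializationAt (𝔼 n) (TangentSpace I) q ⟨p, v⟩).2 := by
  rw [coords, Trivialization.continuousLinearMapAt_apply,
    Trivialization.coe_linearMapAt_of_mem _ (mem_baseSet hp)]

lemma coords_ofCoords (hp : p ∈ (extChartAt I q).source) (v : 𝔼 n) :
    coords I q p (ofCoords I q p v) = v :=
  Trivialization.continuousLinearMapAt_symmL _ (mem_baseSet hp) v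

lemma ofCoords_coords (hp : p ∈ (extChartAt I q).source) (v : TangentSpace I p) :
    ofCoords I q p (coords I q p v) = v :=
  Trivialization.symmL_continuousLinearMapAt _ (mem_baseSet hp) v

lemma ofCoords_single (i : Fin (n + 1)) :
    ofCoords I q p (EuclideanSpace.single i 1) = coordVec I q p i := rfl

lemma contMDiffOn_coordVec (i : Fin (n + 1)) :
    ContMDiffOn I I.tangent ∞ (fun p : M => (⟨p, coordVec I q p i⟩ : TangentBundle I M))
      (extChartAt I q).source := by
  let e := trivializationAt (𝔼 n) (TangentSpace I : M → Type _) q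
  have hmaps : MapsTo (fun p : M => (⟨p, coordVec I q p i⟩ : TangentBundle I M))
      (extChartAt I q).source e.source := fun p hp => e.mem_source.2 (mem_baseSet hp)
  refine (e.contMDiffOn_iff hmaps).2 ⟨contMDiffOn_id, ?_⟩
  refine (contMDiffOn_const (c := EuclideanSpace.single i (1 : ℝ))).congr fun p hp => ?_
  rw [← coords_eq hp, ← ofCoords_single, coords_ofCoords hp]

variable [RiemannianBundle (fun x : M => TangentSpace I x)]

lemma volumeForm_eq_stdVol (hp : p ∈ (extChartAt I q).source)
    (o : Orientation ℝ (TangentSpace I p) (Fin (n + 1))) (w : Fin (n + 1) → TangentSpace I p) :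
    o.volumeForm w = o.volumeForm (coordVec I q p) * stdVol n (fun j => coords I q p (w j)) := by
  simpa [ofCoords_coords hp, ofCoords_single] using
    eq_mul_stdVol (o.volumeForm.compLinearMap (ofCoords I q p).toLinearMap)
      fun j => coords I q p (w j)

lemma volumeForm_coordVec_ne_zero (hp : p ∈ (extChartAt I q).source)
    (o : Orientation ℝ (TangentSpace I p) (Fin (n + 1))) :
    o.volumeForm (coordVec I q p) ≠ 0 := by
  intro h
  have := volumeForm_eq_stdVol hp o (orientedBasis o)
  rw [h, volumeForm_orientedBasis, zero_mul] at this
  exact one_ne_zero this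

variable (I) in
/-- The density `√(det g)` of the Riemannian volume in the chart centred at `q`. -/
def density (q : M) (y : 𝔼 n) : ℝ := Real.sqrt (gram I q y).det

lemma abs_volumeForm_coordVec (hp : p ∈ (extChartAt I q).source)
    (o : Orientation ℝ (TangentSpace I p) (Fin (n + 1))) :
    |o.volumeForm (coordVec I q p)| = density I q (extChartAt I q p) := by
  rw [abs_volumeForm_eq_sqrt, density, gram, (extChartAt I q).left_inv hp]

lemma density_pos {y : 𝔼 n} (hy : y ∈ (extChartAt I q).target) : 0 < density I q y := by
  have hp := (extChartAt I q).map_target hy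
  let o : Orientation ℝ (TangentSpace I ((extChartAt I q).symm y)) (Fin (n + 1)) :=
    (stdOrthonormalBasis ℝ _).toBasis.reindex (finCongr Fact.out) |>.orientation
  rw [← (extChartAt I q).right_inv hy, ← abs_volumeForm_coordVec hp o]
  exact abs_pos.2 (volumeForm_coordVec_ne_zero hp o)

lemma det_gram_pos {y : 𝔼 n} (hy : y ∈ (extChartAt I q).target) : 0 < (gram I q y).det :=
  Real.sqrt_pos.1 (density_pos hy)

lemma exists_volumeForm_coordVec_eq_mul_density
    {o : ∀ x : M, Orientation ℝ (TangentSpace I x) (Fin (n + 1))} (ho : IsOrientation I o) (q : M) :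
    ∃ s : ℝ, (s = 1 ∨ s = -1) ∧ ∀ᶠ p in 𝓝 q,
      (o p).volumeForm (coordVec I q p) = s * density I q (extChartAt I q p) := by
  by_cases h : 0 < (o q).volumeForm (coordVec I q q)
  · refine ⟨1, .inl rfl, ?_⟩
    filter_upwards [ho q, extChartAt_source_mem_nhds (I := I) q] with p hp hps
    rw [← abs_volumeForm_coordVec hps (o p), abs_of_pos (hp.2 h), one_mul]
  · refine ⟨-1, .inr rfl, ?_⟩
    filter_upwards [ho q, extChartAt_source_mem_nhds (I := I) q] with p hp hps
    rw [← abs_volumeForm_coordVec hps (o p), abs_of_nonpos (not_lt.1 (mt hp.1 h))]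
    ring

variable [IsContMDiffRiemannianBundle I ∞ (𝔼 n) (fun x : M => TangentSpace I x)]

lemma contDiffOn_gram (i j : Fin (n + 1)) :
    ContDiffOn ℝ ∞ (fun y => gram I q y i j) (extChartAt I q).target := by
  rw [← contMDiffOn_iff_contDiffOn]
  have h := (contMDiffOn_coordVec (I := I) (q := q) i).inner_bundle (contMDiffOn_coordVec j)
  exact h.comp (contMDiffOn_extChartAt_symm q) fun y hy => (extChartAt I q).map_target hy

lemma contDiffOn_det_gram :
    ContDiffOn ℝ ∞ (fun y => (gram I q y).det) (extChartAt I q).target := by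
  simp only [Matrix.det_apply']
  exact ContDiffOn.sum fun σ _ => contDiffOn_const.mul
    (contDiffOn_prod fun i _ => contDiffOn_gram _ _)

lemma contDiffOn_density : ContDiffOn ℝ ∞ (density I q) (extChartAt I q).target :=
  contDiffOn_det_gram.sqrt fun _ hy => (det_gram_pos hy).ne'

lemma contDiffWithinAt_density (hp : p ∈ (extChartAt I q).source) :
    ContDiffWithinAt ℝ ∞ (density I q) (range I) (extChartAt I q p) :=
  (contDiffOn_density _ ((extChartAt I q).map_source hp)).mono_of_mem_nhdsWithin
    (extChartAt_target_mem_nhdsWithin' hp)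

end Charts

/-! ### Trace of the Christoffel symbols -/

section Christoffel

variable {n : ℕ} {H : Type*} [TopologicalSpace H] {I : ModelWithCorners ℝ (𝔼 n) H}
  {M : Type*} [TopologicalSpace M] [ChartedSpace H M] [IsManifold I ∞ M]
  [RiemannianBundle (fun x : M => TangentSpace I x)]

lemma gram_isSymm (q : M) (y : 𝔼 n) : (gram I q y).IsSymm :=
  .ext fun i j => real_inner_comm (coordVec I q _ i) (coordVec I q _ j)

lemma gram_inv_isSymm (q : M) (y : 𝔼 n) : (gram I q y)⁻¹.IsSymm := by
  rw [Matrix.IsSymm, Matrix.transpose_nonsing_inv, (gram_isSymm q y).eq]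

lemma gramDeriv_comm (q : M) (y : 𝔼 n) (k i j : Fin (n + 1)) :
    gramDeriv I q y k i j = gramDeriv I q y k j i := by
  simp only [gramDeriv, (gram_isSymm q _).apply j i]

lemma sum_christoffel_self (q : M) (y : 𝔼 n) (j : Fin (n + 1)) :
    ∑ k, christoffel I q y k k j =
      (1 / 2) * ∑ k, ∑ l, (gram I q y)⁻¹ k l * gramDeriv I q y j k l := by
  have hswap : ∑ k, ∑ l, (gram I q y)⁻¹ k l * gramDeriv I q y k j l =
      ∑ k, ∑ l, (gram I q y)⁻¹ k l * gramDeriv I q y l k j := by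
    rw [Finset.sum_comm]
    refine Finset.sum_congr rfl fun k _ => Finset.sum_congr rfl fun l _ => ?_
    rw [(gram_inv_isSymm q y).apply, gramDeriv_comm]
  simp only [christoffel, ← Finset.mul_sum, mul_sub, mul_add, Finset.sum_sub_distrib,
    Finset.sum_add_distrib, hswap]
  ring

lemma trace_christoffelMap (q : M) (w : 𝔼 n) :
    LinearMap.trace ℝ (𝔼 n) (christoffelMap I q w).toLinearMap =
      ∑ j, (∑ k, christoffel I q (extChartAt I q q) k k j) * w j := by
  have htrace (i k : Fin (n + 1)) : LinearMap.trace ℝ (𝔼 n)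
      ((EuclideanSpace.proj i : 𝔼 n →L[ℝ] ℝ).smulRight
        (EuclideanSpace.single k (1 : ℝ))).toLinearMap = if i = k then 1 else 0 := by
    rw [ContinuousLinearMap.coe_smulRight, LinearMap.trace_smulRight]
    simp
  simp only [christoffelMap, ContinuousLinearMap.toLinearMap_sum, map_sum,
    ContinuousLinearMap.toLinearMap_smul, map_smul, htrace]
  simp only [smul_eq_mul, mul_ite, mul_one, mul_zero, Finset.sum_mul]
  rw [Finset.sum_comm (f := fun j k => _ * _)]
  refine Finset.sum_congr rfl fun k _ => ?_
  rw [Finset.sum_comm]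
  simp

variable [IsContMDiffRiemannianBundle I ∞ (𝔼 n) (fun x : M => TangentSpace I x)]

lemma hasFDerivWithinAt_gram (q : M) (i j : Fin (n + 1)) :
    HasFDerivWithinAt (fun z => gram I q z i j)
      (∑ k, gramDeriv I q (extChartAt I q q) k i j • (EuclideanSpace.proj k : 𝔼 n →L[ℝ] ℝ))
      (range I) (extChartAt I q q) := by
  have hd := ((contDiffOn_gram (I := I) (q := q) i j).differentiableOn (by simp) _
    (mem_extChartAt_target q)).mono_of_mem_nhdsWithin (extChartAt_target_mem_nhdsWithin q)
  refine hd.hasFDerivWithinAt.congr_fderiv (ContinuousLinearMap.ext fun w => ?_)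
  conv_lhs => rw [← (EuclideanSpace.basisFun (Fin (n + 1)) ℝ).sum_repr w]
  simp [gramDeriv, mul_comm]

lemma hasFDerivWithinAt_det_gram (q : M) :
    HasFDerivWithinAt (fun z => (gram I q z).det)
      ((gram I q (extChartAt I q q)).det • ∑ j,
        (∑ k, ∑ l, (gram I q (extChartAt I q q))⁻¹ k l * gramDeriv I q (extChartAt I q q) j k l) •
          (EuclideanSpace.proj j : 𝔼 n →L[ℝ] ℝ)) (range I) (extChartAt I q q) := by
  set y := extChartAt I q q with hy
  have hadj (k l : Fin (n + 1)) :
      (gram I q y).adjugate l k = (gram I q y).det * (gram I q y)⁻¹ k l := by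
    rw [← (gram_inv_isSymm q y).apply, Matrix.inv_def, Matrix.smul_apply, Ring.inverse_eq_inv',
      smul_eq_mul, mul_inv_cancel_left₀ (det_gram_pos (mem_extChartAt_target q)).ne']
  refine (hasFDerivWithinAt_det (hasFDerivWithinAt_gram q)).congr_fderiv ?_
  simp only [← hy, hadj, Finset.smul_sum, Finset.sum_smul, smul_smul, mul_assoc]
  rw [Finset.sum_comm_cycle]

theorem fderivWithin_density (q : M) (w : 𝔼 n) :
    fderivWithin ℝ (density I q) (range I) (extChartAt I q q) w =
      LinearMap.trace ℝ (𝔼 n) (christoffelMap I q w).toLinearMap *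
        density I q (extChartAt I q q) := by
  have hpos := det_gram_pos (I := I) (mem_extChartAt_target q)
  have hu := I.uniqueDiffOn.uniqueDiffWithinAt
    (extChartAt_target_subset_range q (mem_extChartAt_target q))
  have hsqrt := ((hasFDerivWithinAt_det_gram q).sqrt hpos.ne').fderivWithin hu
  rw [show density I q = fun z => Real.sqrt (gram I q z).det from rfl, hsqrt, trace_christoffelMap]
  simp only [sum_christoffel_self, smul_apply, sum_apply, smul_eq_mul, PiLp.proj_apply,
    mul_assoc, ← Finset.mul_sum]
  have := Real.sqrt_pos.2 hpos
  field_simp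
  rw [Real.sq_sqrt hpos.le]

end Christoffel

/-! ### Maps and vector fields along maps in charts -/

section MapsInCharts

variable {n : ℕ}
  {H₁ : Type*} [TopologicalSpace H₁] {I₁ : ModelWithCorners ℝ (𝔼 n) H₁}
  {M₁ : Type*} [TopologicalSpace M₁] [ChartedSpace H₁ M₁]
  {H₂ : Type*} [TopologicalSpace H₂] {I₂ : ModelWithCorners ℝ (𝔼 n) H₂}
  {M₂ : Type*} [TopologicalSpace M₂] [ChartedSpace H₂ M₂] [IsManifold I₂ ∞ M₂]
  {f : M₁ → M₂} {σ : ∀ p, TangentSpace I₂ (f p)} {x₀ p : M₁} {q : M₂} {y : 𝔼 n}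

lemma uniqueDiffWithinAt_range (hy : y ∈ (extChartAt I₁ x₀).target) :
    UniqueDiffWithinAt ℝ (range I₁) y :=
  I₁.uniqueDiffOn.uniqueDiffWithinAt (extChartAt_target_subset_range x₀ hy)

lemma IsSmoothSection.contMDiffAt_coords (hσ : IsSmoothSection I₁ I₂ f σ)
    (hq : f p ∈ (extChartAt I₂ q).source) :
    ContMDiffAt I₁ 𝓘(ℝ, 𝔼 n) ∞ (fun p' => coords I₂ q (f p') (σ p')) p := by
  let e := trivializationAt (𝔼 n) (TangentSpace I₂ : M₂ → Type _) q
  have hmem : (⟨f p, σ p⟩ : TangentBundle I₂ M₂) ∈ e.source := e.mem_source.2 (mem_baseSet hq)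
  obtain ⟨hf, hfst⟩ :=
    (e.contMDiffAt_iff (f := fun p' => (⟨f p', σ p'⟩ : TangentBundle I₂ M₂)) hmem).1 (hσ p)
  refine hfst.congr_of_eventuallyEq ?_
  filter_upwards [hf.continuousAt.preimage_mem_nhds (extChartAt_source_mem_nhds' hq)] with p' hp'
  exact coords_eq hp' _

lemma pullbackConnection_apply [RiemannianBundle (fun x : M₂ => TangentSpace I₂ x)]
    (v : TangentSpace I₁ p) :
    pullbackConnection I₁ I₂ f σ p v = ofCoords I₂ (f p) (f p)
      (mvfderiv I₁ (fun p' => coords I₂ (f p) (f p') (σ p')) p v +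
        christoffelMap I₂ (f p) (coords I₂ (f p) (f p) (σ p))
          (coords I₂ (f p) (f p) (mfderiv I₁ I₂ f p v))) := rfl

variable [IsManifold I₁ ∞ M₁]

lemma hasMFDerivWithinAt_extChartAt_symm (hy : y ∈ (extChartAt I₁ x₀).target) :
    HasMFDerivWithinAt 𝓘(ℝ, 𝔼 n) I₁ (extChartAt I₁ x₀).symm (range I₁)
      y (ofCoords I₁ x₀ ((extChartAt I₁ x₀).symm y)) := by
  have : IsManifold I₁ 1 M₁ := .of_le (n := ∞) (by simp)
  have hp := (extChartAt I₁ x₀).map_target hy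
  rw [ofCoords, TangentBundle.symmL_trivializationAt (by simpa using hp),
    (extChartAt I₁ x₀).right_inv hy]
  exact (mdifferentiableWithinAt_extChartAt_symm hy).hasMFDerivWithinAt

lemma hasMFDerivAt_extChartAt_coords {p : M₂} (hp : p ∈ (extChartAt I₂ q).source) :
    HasMFDerivAt I₂ 𝓘(ℝ, 𝔼 n) (extChartAt I₂ q) p (coords I₂ q p) := by
  have : IsManifold I₂ 1 M₂ := .of_le (n := ∞) (by simp)
  have hp' : p ∈ (chartAt H₂ q).source := by simpa using hp
  rw [coords, TangentBundle.continuousLinearMapAt_trivializationAt hp']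
  exact (mdifferentiableAt_extChartAt hp').hasMFDerivAt

lemma hasFDerivWithinAt_comp_extChartAt_symm {F : Type*} [NormedAddCommGroup F] [NormedSpace ℝ F]
    {g : M₁ → F} (hy : y ∈ (extChartAt I₁ x₀).target) (hp : (extChartAt I₁ x₀).symm y = p)
    (hg : MDifferentiableAt I₁ 𝓘(ℝ, F) g p) :
    HasFDerivWithinAt (fun y => g ((extChartAt I₁ x₀).symm y))
      (mvfderiv I₁ g p ∘L ofCoords I₁ x₀ p) (range I₁) y := by
  subst hp
  exact hasMFDerivWithinAt_iff_hasFDerivWithinAt.1 <|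
    hg.hasMFDerivAt.comp_hasMFDerivWithinAt _ (hasMFDerivWithinAt_extChartAt_symm hy)

variable (I₁ I₂) in
/-- The coordinate expression of a map `f` in the charts centred at `x₀` and `q`. -/
def chartMap (f : M₁ → M₂) (x₀ : M₁) (q : M₂) (y : 𝔼 n) : 𝔼 n :=
  extChartAt I₂ q (f ((extChartAt I₁ x₀).symm y))

variable (I₁ I₂) in
/-- The coordinate expression of a vector field `σ` along `f` in the charts centred at `x₀` and
`q`. -/
def chartSection (f : M₁ → M₂) (σ : ∀ p, TangentSpace I₂ (f p)) (x₀ : M₁) (q : M₂) (y : 𝔼 n) :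
    𝔼 n :=
  coords I₂ q (f ((extChartAt I₁ x₀).symm y)) (σ ((extChartAt I₁ x₀).symm y))

lemma hasFDerivWithinAt_chartMap (hy : y ∈ (extChartAt I₁ x₀).target)
    (hp : (extChartAt I₁ x₀).symm y = p) (hq : f p ∈ (extChartAt I₂ q).source)
    (hf : MDifferentiableAt I₁ I₂ f p) :
    HasFDerivWithinAt (chartMap I₁ I₂ f x₀ q)
      (coords I₂ q (f p) ∘L mfderiv I₁ I₂ f p ∘L ofCoords I₁ x₀ p) (range I₁) y := by
  subst hp
  exact hasMFDerivWithinAt_iff_hasFDerivWithinAt.1 <|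
    ((hasMFDerivAt_extChartAt_coords hq).comp _ hf.hasMFDerivAt).comp_hasMFDerivWithinAt _
      (hasMFDerivWithinAt_extChartAt_symm hy)

lemma coords_mfderiv_coordVec (hy : y ∈ (extChartAt I₁ x₀).target)
    (hp : (extChartAt I₁ x₀).symm y = p) (hq : f p ∈ (extChartAt I₂ q).source)
    (hf : MDifferentiableAt I₁ I₂ f p) (j : Fin (n + 1)) :
    coords I₂ q (f p) (mfderiv I₁ I₂ f p (coordVec I₁ x₀ p j)) =
      fderivWithin ℝ (chartMap I₁ I₂ f x₀ q) (range I₁) y (EuclideanSpace.single j 1) := by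
  rw [(hasFDerivWithinAt_chartMap hy hp hq hf).fderivWithin (uniqueDiffWithinAt_range hy)]
  rfl

variable [RiemannianBundle (fun x : M₂ => TangentSpace I₂ x)]

lemma coords_pullbackConnection_coordVec (hf : MDifferentiableAt I₁ I₂ f p)
    (hσ : IsSmoothSection I₁ I₂ f σ) (hy : y ∈ (extChartAt I₁ x₀).target)
    (hp : (extChartAt I₁ x₀).symm y = p) (i : Fin (n + 1)) :
    coords I₂ (f p) (f p) (pullbackConnection I₁ I₂ f σ p (coordVec I₁ x₀ p i)) =
      fderivWithin ℝ (chartSection I₁ I₂ f σ x₀ (f p)) (range I₁) y (EuclideanSpace.single i 1) +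
      christoffelMap I₂ (f p) (chartSection I₁ I₂ f σ x₀ (f p) y)
        (fderivWithin ℝ (chartMap I₁ I₂ f x₀ (f p)) (range I₁) y (EuclideanSpace.single i 1)) := by
  have hq : f p ∈ (extChartAt I₂ (f p)).source := mem_extChartAt_source _
  have hS : HasFDerivWithinAt (chartSection I₁ I₂ f σ x₀ (f p)) _ (range I₁) y :=
    hasFDerivWithinAt_comp_extChartAt_symm hy hp
      ((hσ.contMDiffAt_coords hq).mdifferentiableAt (by simp))
  rw [pullbackConnection_apply, coords_ofCoords hq, coords_mfderiv_coordVec hy hp hq hf,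
    hS.fderivWithin (uniqueDiffWithinAt_range hy)]
  subst hp
  rfl

variable (I₁ I₂) in
/-- The derivative of `√(det g₂) det(∂₀F, …, ∂ₙF)` in the direction of a vector field `σ` along
`f`, where `F` is the coordinate expression of `f`. -/
def chartVariation (f : M₁ → M₂) (σ : ∀ p, TangentSpace I₂ (f p)) (x₀ : M₁) (q : M₂)
    (y : 𝔼 n) : ℝ :=
  letI D := fun j =>
    fderivWithin ℝ (chartMap I₁ I₂ f x₀ q) (range I₁) y (EuclideanSpace.single j 1)
  fderivWithin ℝ (density I₂ q) (range I₂) (chartMap I₁ I₂ f x₀ q y)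
      (chartSection I₁ I₂ f σ x₀ q y) * stdVol n D +
    density I₂ q (chartMap I₁ I₂ f x₀ q y) * ∑ i, stdVol n (Function.update D i
      (fderivWithin ℝ (chartSection I₁ I₂ f σ x₀ q) (range I₁) y (EuclideanSpace.single i 1)))

variable [RiemannianBundle (fun x : M₁ => TangentSpace I₁ x)]
  [IsContMDiffRiemannianBundle I₂ ∞ (𝔼 n) (fun x : M₂ => TangentSpace I₂ x)]
  {o₁ : ∀ x : M₁, Orientation ℝ (TangentSpace I₁ x) (Fin (n + 1))}
  {o₂ : ∀ x : M₂, Orientation ℝ (TangentSpace I₂ x) (Fin (n + 1))}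

variable (I₁ I₂ o₁ o₂) in
/-- The function `⟨∇σ, Cof df⟩`, whose integral is the weak form of `δ Cof df`. -/
def cofPairing (f : M₁ → M₂) (σ : ∀ p, TangentSpace I₂ (f p)) (p : M₁) : ℝ :=
  homInner (pullbackConnection I₁ I₂ f σ p) (CofD I₁ I₂ o₁ o₂ f p)

/- The trace of the Christoffel symbols in `∇σ` accounts for the derivative of `√(det g₂)`. -/
theorem cofPairing_mul_volumeForm (hf : MDifferentiableAt I₁ I₂ f p)
    (hσ : IsSmoothSection I₁ I₂ f σ) (hy : y ∈ (extChartAt I₁ x₀).target)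
    (hp : (extChartAt I₁ x₀).symm y = p) {s : ℝ}
    (hs : (o₂ (f p)).volumeForm (coordVec I₂ (f p) (f p)) =
      s * density I₂ (f p) (extChartAt I₂ (f p) (f p))) :
    cofPairing I₁ I₂ o₁ o₂ f σ p * (o₁ p).volumeForm (coordVec I₁ x₀ p) =
      s * chartVariation I₁ I₂ f σ x₀ (f p) y := by
  have hq : f p ∈ (extChartAt I₂ (f p)).source := mem_extChartAt_source _
  have hFy : chartMap I₁ I₂ f x₀ (f p) y = extChartAt I₂ (f p) (f p) := by rw [chartMap, hp]
  set D := fun j => fderivWithin ℝ (chartMap I₁ I₂ f x₀ (f p)) (range I₁) y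
    (EuclideanSpace.single j 1)
  set Γ := christoffelMap I₂ (f p) (chartSection I₁ I₂ f σ x₀ (f p) y)
  have hterm (i : Fin (n + 1)) : (o₂ (f p)).volumeForm (Function.update
      (differential I₁ I₂ f p ∘ coordVec I₁ x₀ p) i
      (pullbackConnection I₁ I₂ f σ p (coordVec I₁ x₀ p i))) =
      s * density I₂ (f p) (extChartAt I₂ (f p) (f p)) *
        (stdVol n (Function.update D i (fderivWithin ℝ (chartSection I₁ I₂ f σ x₀ (f p))
          (range I₁) y (EuclideanSpace.single i 1))) +
        stdVol n (Function.update D i (Γ.toLinearMap (D i)))) := by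
    rw [volumeForm_eq_stdVol hq, hs, ← ContinuousAlternatingMap.map_update_add]
    congr 2 with j : 1
    rcases eq_or_ne j i with rfl | hji
    · simp only [Function.update_self]
      exact coords_pullbackConnection_coordVec hf hσ hy hp j
    · simp only [Function.update_of_ne hji]
      exact coords_mfderiv_coordVec hy hp hq hf j
  rw [cofPairing, CofD, ← smul_eq_mul, ← AlternatingMap.smul_apply, ← pullbackVariation_volumeForm,
    pullbackVariation_apply, Finset.sum_congr rfl fun i _ => hterm i, ← Finset.mul_sum,
    Finset.sum_add_distrib, sum_stdVol_update_map, chartVariation, hFy, fderivWithin_density]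
  ring

end MapsInCharts

/-! ### The flux form of a vector field along a map -/

section Flux

variable {n : ℕ}
  {H₁ : Type*} [TopologicalSpace H₁] {I₁ : ModelWithCorners ℝ (𝔼 n) H₁}
  {M₁ : Type*} [TopologicalSpace M₁] [ChartedSpace H₁ M₁]
  {H₂ : Type*} [TopologicalSpace H₂] {I₂ : ModelWithCorners ℝ (𝔼 n) H₂}
  {M₂ : Type*} [TopologicalSpace M₂] [ChartedSpace H₂ M₂]
  {f : M₁ → M₂} {σ : ∀ p, TangentSpace I₂ (f p)} {x₀ p : M₁} {q : M₂} {y : 𝔼 n}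

lemma two_le_infty : (2 : WithTop ℕ∞) ≤ ∞ := WithTop.coe_le_coe.2 le_top

lemma extChartAt_mem_range (q p : M₂) : extChartAt I₂ q p ∈ range I₂ := by
  simp [extChartAt]

lemma chartMap_mem_range : chartMap I₁ I₂ f x₀ q y ∈ range I₂ := extChartAt_mem_range _ _

lemma tendsto_extChartAt_symm (hy : y ∈ (extChartAt I₁ x₀).target)
    (hp : (extChartAt I₁ x₀).symm y = p) :
    Filter.Tendsto (extChartAt I₁ x₀).symm (𝓝[range I₁] y) (𝓝 p) :=
  hp ▸ (continuousAt_extChartAt_symm'' hy).tendsto.mono_left nhdsWithin_le_nhds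

lemma target_mem_nhdsWithin_range (hy : y ∈ (extChartAt I₁ x₀).target) :
    (extChartAt I₁ x₀).target ∈ 𝓝[range I₁] y := by
  rw [← (extChartAt I₁ x₀).right_inv hy]
  exact extChartAt_target_mem_nhdsWithin' ((extChartAt I₁ x₀).map_target hy)

variable [IsManifold I₁ ∞ M₁]

lemma contDiffWithinAt_comp_extChartAt_symm {F : Type*} [NormedAddCommGroup F]
    [NormedSpace ℝ F] {g : M₁ → F} (hy : y ∈ (extChartAt I₁ x₀).target)
    (hp : (extChartAt I₁ x₀).symm y = p) (hg : ContMDiffAt I₁ 𝓘(ℝ, F) ∞ g p) :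
    ContDiffWithinAt ℝ ∞ (fun y => g ((extChartAt I₁ x₀).symm y)) (range I₁) y := by
  subst hp
  have hsymm : ContMDiffWithinAt 𝓘(ℝ, 𝔼 n) I₁ ∞ (extChartAt I₁ x₀).symm (range I₁) y :=
    (contMDiffOn_extChartAt_symm x₀ y hy).mono_of_mem_nhdsWithin (target_mem_nhdsWithin_range hy)
  exact contMDiffWithinAt_iff_contDiffWithinAt.1 (hg.comp_contMDiffWithinAt y hsymm)

variable [IsManifold I₂ ∞ M₂]

lemma contDiffWithinAt_chartMap (hf : ContMDiffAt I₁ I₂ ∞ f p) (hy : y ∈ (extChartAt I₁ x₀).target)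
    (hp : (extChartAt I₁ x₀).symm y = p) (hq : f p ∈ (extChartAt I₂ q).source) :
    ContDiffWithinAt ℝ ∞ (chartMap I₁ I₂ f x₀ q) (range I₁) y :=
  contDiffWithinAt_comp_extChartAt_symm (g := fun p => extChartAt I₂ q (f p)) hy hp <|
    (contMDiffAt_extChartAt' (by simpa using hq)).comp p hf

lemma contDiffWithinAt_chartSection (hσ : IsSmoothSection I₁ I₂ f σ)
    (hy : y ∈ (extChartAt I₁ x₀).target) (hp : (extChartAt I₁ x₀).symm y = p)
    (hq : f p ∈ (extChartAt I₂ q).source) :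
    ContDiffWithinAt ℝ ∞ (chartSection I₁ I₂ f σ x₀ q) (range I₁) y :=
  contDiffWithinAt_comp_extChartAt_symm (g := fun p => coords I₂ q (f p) (σ p)) hy hp
    (hσ.contMDiffAt_coords hq)

variable [RiemannianBundle (fun x : M₂ => TangentSpace I₂ x)]
  {o₂ : ∀ x : M₂, Orientation ℝ (TangentSpace I₂ x) (Fin (n + 1))}

variable (I₁ I₂) in
/-- The components `Xⁱ = dVol₂(df ∂₀, …, σ, …, df ∂ₙ)`, with `σ` at the place `i`, in the chart
centred at `x₀`. -/
def flux (o₂ : ∀ x : M₂, Orientation ℝ (TangentSpace I₂ x) (Fin (n + 1))) (f : M₁ → M₂)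
    (σ : ∀ p, TangentSpace I₂ (f p)) (x₀ : M₁) (i : Fin (n + 1)) (y : 𝔼 n) : ℝ :=
  letI p := (extChartAt I₁ x₀).symm y
  (o₂ (f p)).volumeForm
    (Function.update (fun j => mfderiv I₁ I₂ f p (coordVec I₁ x₀ p j)) i (σ p))

variable (I₁ I₂) in
/-- The coordinate divergence `∂ᵢXⁱ` of `flux` in the chart centred at `x₀`. -/
def fluxDivergence (o₂ : ∀ x : M₂, Orientation ℝ (TangentSpace I₂ x) (Fin (n + 1))) (f : M₁ → M₂)
    (σ : ∀ p, TangentSpace I₂ (f p)) (x₀ : M₁) (y : 𝔼 n) : ℝ :=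
  ∑ i, fderivWithin ℝ (flux I₁ I₂ o₂ f σ x₀ i) (range I₁) y (EuclideanSpace.single i 1)

variable (I₁ I₂) in
/-- The component `√(det g₂) det(∂₀F, …, S, …, ∂ₙF)`, with `S` at the place `i`, where `F` and `S`
are the coordinate expressions of `f` and `σ`.  Up to the sign of the chart centred at `q` it is
`flux`. -/
def chartFlux (f : M₁ → M₂) (σ : ∀ p, TangentSpace I₂ (f p)) (x₀ : M₁) (q : M₂)
    (i : Fin (n + 1)) (y : 𝔼 n) : ℝ :=
  density I₂ q (chartMap I₁ I₂ f x₀ q y) * stdVol n (Function.update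
    (fun j => fderivWithin ℝ (chartMap I₁ I₂ f x₀ q) (range I₁) y (EuclideanSpace.single j 1)) i
    (chartSection I₁ I₂ f σ x₀ q y))

lemma flux_eventuallyEq (hf : ContMDiff I₁ I₂ ∞ f) (hy : y ∈ (extChartAt I₁ x₀).target)
    (hp : (extChartAt I₁ x₀).symm y = p) (hq : f p ∈ (extChartAt I₂ q).source) {s : ℝ}
    (hs : ∀ᶠ x in 𝓝 (f p),
      (o₂ x).volumeForm (coordVec I₂ q x) = s * density I₂ q (extChartAt I₂ q x))
    (i : Fin (n + 1)) :
    flux I₁ I₂ o₂ f σ x₀ i =ᶠ[𝓝[range I₁] y] s • chartFlux I₁ I₂ f σ x₀ q i := by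
  have htend : Filter.Tendsto (fun z => f ((extChartAt I₁ x₀).symm z)) (𝓝[range I₁] y) (𝓝 (f p)) :=
    (hf.continuous.tendsto p).comp (tendsto_extChartAt_symm hy hp)
  filter_upwards [target_mem_nhdsWithin_range hy, htend.eventually hs,
    htend.eventually (extChartAt_source_mem_nhds' hq)] with z hz hzs hzq
  rw [flux, volumeForm_eq_stdVol hzq, hzs, mul_assoc, Pi.smul_apply, smul_eq_mul, chartFlux]
  congr 3 with j : 1
  rcases eq_or_ne j i with rfl | hji
  · simp only [Function.update_self]
    rfl
  · simp only [Function.update_of_ne hji]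
    exact coords_mfderiv_coordVec hz rfl hzq (hf.mdifferentiableAt (by simp)) j

variable [IsContMDiffRiemannianBundle I₂ ∞ (𝔼 n) (fun x : M₂ => TangentSpace I₂ x)]

lemma contDiffWithinAt_chartFlux (hf : ContMDiffAt I₁ I₂ ∞ f p) (hσ : IsSmoothSection I₁ I₂ f σ)
    (hy : y ∈ (extChartAt I₁ x₀).target) (hp : (extChartAt I₁ x₀).symm y = p)
    (hq : f p ∈ (extChartAt I₂ q).source) (i : Fin (n + 1)) :
    ContDiffWithinAt ℝ 1 (chartFlux I₁ I₂ f σ x₀ q i) (range I₁) y := by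
  have hF := contDiffWithinAt_chartMap hf hy hp hq
  have hFy : chartMap I₁ I₂ f x₀ q y = extChartAt I₂ q (f p) := by rw [chartMap, hp]
  have hDF : ContDiffWithinAt ℝ 1 (fderivWithin ℝ (chartMap I₁ I₂ f x₀ q) (range I₁))
      (range I₁) y :=
    hF.fderivWithin_right I₁.uniqueDiffOn two_le_infty (extChartAt_target_subset_range x₀ hy)
  have hG : ContDiffWithinAt ℝ ∞ (density I₂ q) (range I₂) (chartMap I₁ I₂ f x₀ q y) :=
    hFy ▸ contDiffWithinAt_density hq
  refine ((hG.comp y hF fun z _ => chartMap_mem_range).of_le (by simp)).mul <|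
    (stdVol n).toContinuousMultilinearMap.contDiff.comp_contDiffWithinAt <|
      contDiffWithinAt_pi.2 fun j => ?_
  rcases eq_or_ne j i with rfl | hji
  · simpa only [Function.update_self] using
      (contDiffWithinAt_chartSection hσ hy hp hq).of_le (by simp)
  · simpa only [Function.update_of_ne hji] using hDF.clm_apply contDiffWithinAt_const

lemma contDiffWithinAt_flux (ho₂ : IsOrientation I₂ o₂) (hf : ContMDiff I₁ I₂ ∞ f)
    (hσ : IsSmoothSection I₁ I₂ f σ) (hy : y ∈ (extChartAt I₁ x₀).target) (i : Fin (n + 1)) :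
    ContDiffWithinAt ℝ 1 (flux I₁ I₂ o₂ f σ x₀ i) (range I₁) y := by
  have hq := mem_extChartAt_source (I := I₂) (f ((extChartAt I₁ x₀).symm y))
  obtain ⟨s, -, hs⟩ := exists_volumeForm_coordVec_eq_mul_density ho₂ _
  have heq := flux_eventuallyEq (σ := σ) hf hy rfl hq hs i
  exact (contDiffWithinAt_const.smul (contDiffWithinAt_chartFlux (hf _) hσ hy rfl hq i))
    |>.congr_of_eventuallyEq heq (heq.eq_of_nhdsWithin (extChartAt_target_subset_range x₀ hy))

lemma sum_fderiv_chartFlux (hf : ContMDiffAt I₁ I₂ ∞ f p)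
    (hσ : IsSmoothSection I₁ I₂ f σ) (hy : y ∈ (extChartAt I₁ x₀).target)
    (hp : (extChartAt I₁ x₀).symm y = p) (hyi : y ∈ interior (range I₁))
    (hq : f p ∈ (extChartAt I₂ q).source) :
    ∑ i, fderiv ℝ (chartFlux I₁ I₂ f σ x₀ q i) y (EuclideanSpace.single i 1) =
      chartVariation I₁ I₂ f σ x₀ q y := by
  have hn : range I₁ ∈ 𝓝 y := mem_interior_iff_mem_nhds.1 hyi
  have hF := (contDiffWithinAt_chartMap hf hy hp hq).contDiffAt hn
  have hS := (contDiffWithinAt_chartSection hσ hy hp hq).contDiffAt hn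
  have hFy : chartMap I₁ I₂ f x₀ q y = extChartAt I₂ q (f p) := by rw [chartMap, hp]
  have hG : DifferentiableWithinAt ℝ (density I₂ q) (range I₂) (chartMap I₁ I₂ f x₀ q y) :=
    hFy ▸ (contDiffWithinAt_density hq).differentiableWithinAt (by simp)
  have hDF : fderivWithin ℝ (chartMap I₁ I₂ f x₀ q) (range I₁) =ᶠ[𝓝 y]
      fderiv ℝ (chartMap I₁ I₂ f x₀ q) := by
    filter_upwards [isOpen_interior.mem_nhds hyi] with z hz
    exact fderivWithin_of_mem_nhds (mem_interior_iff_mem_nhds.1 hz)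
  have hflux (i : Fin (n + 1)) : chartFlux I₁ I₂ f σ x₀ q i =ᶠ[𝓝 y] fun z =>
      density I₂ q (chartMap I₁ I₂ f x₀ q z) * stdVol n (Function.update
        (fun j => fderiv ℝ (chartMap I₁ I₂ f x₀ q) z (EuclideanSpace.single j 1)) i
        (chartSection I₁ I₂ f σ x₀ q z)) :=
    hDF.mono fun z hz => by simp only [chartFlux, hz]
  simp only [chartVariation, hDF.self_of_nhds,
    fderivWithin_of_mem_nhds hn (f := chartSection I₁ I₂ f σ x₀ q), (hflux _).fderiv_eq]
  exact sum_fderiv_flux (stdVol n) (EuclideanSpace.basisFun _ ℝ).toBasis (hF.of_le two_le_infty)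
    (hS.differentiableAt (by simp)) hG.hasFDerivWithinAt (.of_forall fun _ => chartMap_mem_range) _

theorem fluxDivergence_eq_mul_chartVariation (hf : ContMDiff I₁ I₂ ∞ f)
    (hσ : IsSmoothSection I₁ I₂ f σ) (hy : y ∈ (extChartAt I₁ x₀).target)
    (hp : (extChartAt I₁ x₀).symm y = p) (hyi : y ∈ interior (range I₁))
    (hq : f p ∈ (extChartAt I₂ q).source) {s : ℝ}
    (hs : ∀ᶠ x in 𝓝 (f p),
      (o₂ x).volumeForm (coordVec I₂ q x) = s * density I₂ q (extChartAt I₂ q x)) :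
    fluxDivergence I₁ I₂ o₂ f σ x₀ y = s * chartVariation I₁ I₂ f σ x₀ q y := by
  have hn : range I₁ ∈ 𝓝 y := mem_interior_iff_mem_nhds.1 hyi
  rw [fluxDivergence, ← sum_fderiv_chartFlux (hf p) hσ hy hp hyi hq, Finset.mul_sum]
  refine Finset.sum_congr rfl fun i _ => ?_
  have heq := flux_eventuallyEq (σ := σ) hf hy hp hq hs i
  rw [nhdsWithin_eq_nhds.2 hn] at heq
  rw [fderivWithin_of_mem_nhds hn, heq.fderiv_eq, fderiv_const_smul_field]
  rfl

end Flux

/-! ### The Riemannian volume in charts -/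

lemma iSup_measure_restrict {α ι : Type*} [MeasurableSpace α] {μ : ι → Measure α} {U : ι → Set α}
    (hU : ∀ i, MeasurableSet (U i)) {u : ℕ → ι} (hu : ⋃ k, U (u k) = univ)
    (hμ : ∀ i, (μ i).restrict (U i) = μ i)
    (hcompat : ∀ i j, (μ i).restrict (U i ∩ U j) = (μ j).restrict (U i ∩ U j)) (i : ι) :
    (⨆ j, μ j).restrict (U i) = μ i := by
  let D : ℕ → Set α := disjointed fun k => U (u k)
  have hD (k : ℕ) : MeasurableSet (D k) := .disjointed (fun k => hU (u k)) k
  have hDU (k : ℕ) : D k ⊆ U (u k) := disjointed_subset _ k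
  have hD_univ : ⋃ k, D k = univ := by rw [iUnion_disjointed, hu]
  let ν : Measure α := .sum fun k => (μ (u k)).restrict (D k)
  have hpiece (j : ι) (k : ℕ) :
      (μ j).restrict (D k ∩ U j) = (μ (u k)).restrict (D k ∩ U j) := by
    have := congrArg (Measure.restrict · (D k)) (hcompat j (u k))
    simpa only [Measure.restrict_restrict (hD k), inter_comm (U j), ← inter_assoc,
      inter_eq_self_of_subset_left (hDU k)] using this
  have hν (j : ι) : ν.restrict (U j) = μ j := by
    calc ν.restrict (U j) = .sum fun k => (μ (u k)).restrict (D k ∩ U j) := by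
          simp only [ν, Measure.restrict_sum _ (hU j), Measure.restrict_restrict (hU j),
            inter_comm (U j)]
      _ = .sum fun k => ((μ j).restrict (U j)).restrict (D k) := by
          simp only [← hpiece, Measure.restrict_restrict (hD _)]
      _ = μ j := by
          rw [← Measure.restrict_iUnion (disjoint_disjointed _) hD, hD_univ,
            Measure.restrict_univ, hμ]
  refine le_antisymm ?_ ?_
  · calc (⨆ j, μ j).restrict (U i) ≤ ν.restrict (U i) :=
          Measure.restrict_mono le_rfl (iSup_le fun j => hν j ▸ Measure.restrict_le_self)
      _ = μ i := hν i
  · exact (hμ i).ge.trans (Measure.restrict_mono le_rfl (le_iSup μ i))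

section Volume

variable {n : ℕ} {H : Type*} [TopologicalSpace H] {I : ModelWithCorners ℝ (𝔼 n) H}
  {M : Type*} [TopologicalSpace M] [ChartedSpace H M]

lemma measurableSet_extChartAt_target (q : M) : MeasurableSet (extChartAt I q).target := by
  rw [extChartAt_target]
  exact ((chartAt H q).open_target.preimage I.continuous_symm).measurableSet.inter
    I.isClosed_range.measurableSet

lemma volume_pos_of_mem_nhdsWithin_range {B : Set (𝔼 n)} {y : 𝔼 n} (hy : y ∈ range I)
    (hB : B ∈ 𝓝[range I] y) : 0 < volume B := by
  obtain ⟨V, hV, hyV, hVB⟩ := mem_nhdsWithin.1 hB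
  have hcl : y ∈ closure (interior (range I)) := by
    rw [I.convex_range.closure_interior_eq_closure_of_nonempty_interior I.nonempty_interior]
    exact subset_closure hy
  exact ((hV.inter isOpen_interior).measure_pos volume (mem_closure_iff.1 hcl V hV hyV)).trans_le
    (measure_mono ((inter_subset_inter_right V interior_subset).trans hVB))

lemma ae_target_mem_interior_range {q : M} : ∀ᵐ y ∂volume.restrict (extChartAt I q).target,
    y ∈ (extChartAt I q).target ∧ y ∈ interior (range I) := by
  have hnull : volume (frontier (range I)) = 0 := I.convex_range.addHaar_frontier volume
  filter_upwards [ae_restrict_mem (measurableSet_extChartAt_target q),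
    ae_restrict_of_ae (compl_mem_ae_iff.2 hnull)] with y hy hyf
  rw [I.isClosed_range.frontier_eq] at hyf
  by_contra hyi
  exact hyf ⟨extChartAt_target_subset_range q hy, fun h => hyi ⟨hy, h⟩⟩

variable [MeasurableSpace M] [BorelSpace M]

lemma measurableSet_extChartAt_source (q : M) : MeasurableSet (extChartAt I q).source :=
  (isOpen_extChartAt_source q).measurableSet

lemma measurableSet_target_inter_preimage (q : M) {A : Set M} (hA : MeasurableSet A) :
    MeasurableSet ((extChartAt I q).target ∩ (extChartAt I q).symm ⁻¹' A) := by
  classical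
  have h := (measurableSet_extChartAt_target (I := I) q).inter <|
    (continuousOn_extChartAt_symm (I := I) q).measurable_piecewise (g := fun _ => q)
      continuousOn_const (measurableSet_extChartAt_target q) hA
  convert h using 1
  ext y
  refine and_congr_right fun hy => ?_
  rw [mem_preimage, mem_preimage, piecewise_eq_of_mem _ _ _ hy]

lemma aemeasurable_extChartAt_symm (q : M) (ρ : 𝔼 n → ENNReal) :
    AEMeasurable (extChartAt I q).symm
      ((volume.restrict (extChartAt I q).target).withDensity ρ) :=
  ((continuousOn_extChartAt_symm q).aemeasurable (measurableSet_extChartAt_target q)).mono_ac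
    (withDensity_absolutelyContinuous _ _)

variable [IsManifold I ∞ M]

omit [MeasurableSpace M] [BorelSpace M] in
lemma hasFDerivWithinAt_extChartAt_comp_symm {q q' : M} {y : 𝔼 n} (hy : y ∈ (extChartAt I q).target)
    (hq' : (extChartAt I q).symm y ∈ (extChartAt I q').source) :
    HasFDerivWithinAt (extChartAt I q' ∘ (extChartAt I q).symm)
      (coords I q' ((extChartAt I q).symm y) ∘L ofCoords I q ((extChartAt I q).symm y))
      (range I) y := by
  have h := hasFDerivWithinAt_chartMap (I₁ := I) (I₂ := I) (f := id) hy rfl hq' mdifferentiableAt_id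
  rwa [mfderiv_id] at h

variable [RiemannianBundle (fun x : M => TangentSpace I x)]

omit [BorelSpace M] in
lemma chartVolume_eq_map (q : M) :
    chartVolume I q = ((volume.restrict (extChartAt I q).target).withDensity
      fun y => ENNReal.ofReal (density I q y)).map (extChartAt I q).symm := rfl

lemma chartVolume_apply (q : M) {A : Set M} (hA : MeasurableSet A) :
    chartVolume I q A = ∫⁻ y in (extChartAt I q).target ∩ (extChartAt I q).symm ⁻¹' A,
      ENNReal.ofReal (density I q y) := by
  rw [chartVolume_eq_map, Measure.map_apply_of_aemeasurable (aemeasurable_extChartAt_symm q _) hA,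
    withDensity_apply', Measure.restrict_restrict' (measurableSet_extChartAt_target q), inter_comm]

lemma chartVolume_restrict_source (q : M) :
    (chartVolume I q).restrict (extChartAt I q).source = chartVolume I q := by
  ext A hA
  rw [Measure.restrict_apply hA, chartVolume_apply q hA,
    chartVolume_apply q (hA.inter (measurableSet_extChartAt_source q))]
  congr 2
  ext y
  exact and_congr_right fun hy => and_iff_left ((extChartAt I q).map_target hy)

omit [MeasurableSpace M] [BorelSpace M] in
lemma density_eq_abs_det_mul {q q' p : M} (hp : p ∈ (extChartAt I q).source)
    (hp' : p ∈ (extChartAt I q').source) :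
    density I q (extChartAt I q p) =
      |(coords I q' p ∘L ofCoords I q p).det| * density I q' (extChartAt I q' p) := by
  let o : Orientation ℝ (TangentSpace I p) (Fin (n + 1)) :=
    (stdOrthonormalBasis ℝ (TangentSpace I p)).toBasis.reindex (finCongr Fact.out) |>.orientation
  have hdet : stdVol n (fun j => coords I q' p (coordVec I q p j)) =
      (coords I q' p ∘L ofCoords I q p).det := by
    have := (EuclideanSpace.basisFun (Fin (n + 1)) ℝ).toBasis.det_comp
      (coords I q' p ∘L ofCoords I q p).toLinearMap (fun i => EuclideanSpace.single i 1)
    rwa [← stdVol_apply, ← stdVol_apply, stdVol_single, mul_one] at this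
  rw [← abs_volumeForm_coordVec hp o, ← abs_volumeForm_coordVec hp' o, volumeForm_eq_stdVol hp',
    hdet, abs_mul, mul_comm]

lemma chartVolume_eq_of_subset {q q' : M} {A : Set M} (hA : MeasurableSet A)
    (hq : A ⊆ (extChartAt I q).source) (hq' : A ⊆ (extChartAt I q').source) :
    chartVolume I q A = chartVolume I q' A := by
  have himage : (extChartAt I q' ∘ (extChartAt I q).symm) '' (extChartAt I q '' A) =
      extChartAt I q' '' A := by
    rw [image_image]
    exact image_congr fun p hp => congrArg _ ((extChartAt I q).left_inv (hq hp))
  have hinj : InjOn (extChartAt I q' ∘ (extChartAt I q).symm) (extChartAt I q '' A) := by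
    rintro _ ⟨p, hp, rfl⟩ _ ⟨p', hp', rfl⟩ h
    simp only [Function.comp_apply, (extChartAt I q).left_inv (hq hp),
      (extChartAt I q).left_inv (hq hp')] at h
    rw [(extChartAt I q').injOn (hq' hp) (hq' hp') h]
  have himage_target : extChartAt I q '' A ⊆ (extChartAt I q).target :=
    image_subset_iff.2 fun p hp => (extChartAt I q).map_source (hq hp)
  have hmeas : MeasurableSet (extChartAt I q '' A) := by
    rw [(extChartAt I q).image_eq_target_inter_inv_preimage hq]
    exact measurableSet_target_inter_preimage q hA
  have hder : ∀ y ∈ extChartAt I q '' A, HasFDerivWithinAt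
      (extChartAt I q' ∘ (extChartAt I q).symm)
      (coords I q' ((extChartAt I q).symm y) ∘L ofCoords I q ((extChartAt I q).symm y))
      (extChartAt I q '' A) y := by
    rintro _ ⟨p, hp, rfl⟩
    exact (hasFDerivWithinAt_extChartAt_comp_symm ((extChartAt I q).map_source (hq hp))
      (by rw [(extChartAt I q).left_inv (hq hp)]; exact hq' hp)).mono
      (himage_target.trans (extChartAt_target_subset_range q))
  rw [chartVolume_apply q hA, chartVolume_apply q' hA,
    ← (extChartAt I q).image_eq_target_inter_inv_preimage hq,
    ← (extChartAt I q').image_eq_target_inter_inv_preimage hq', ← himage,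
    lintegral_image_eq_lintegral_abs_det_fderiv_mul volume hmeas hder hinj]
  refine setLIntegral_congr_fun hmeas ?_
  rintro _ ⟨p, hp, rfl⟩
  simp only [Function.comp_apply]
  rw [(extChartAt I q).left_inv (hq hp), density_eq_abs_det_mul (hq hp) (hq' hp),
    ENNReal.ofReal_mul (abs_nonneg _)]

lemma ae_chartVolume_of_forall_interior {q : M} {P : M → Prop}
    (h : ∀ y ∈ (extChartAt I q).target, y ∈ interior (range I) → P ((extChartAt I q).symm y)) :
    ∀ᵐ p ∂(chartVolume I q), P p := by
  have hopen : IsOpen ((extChartAt I q).source ∩ extChartAt I q ⁻¹' interior (range I)) :=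
    isOpen_extChartAt_preimage' q isOpen_interior
  suffices hae : ∀ᵐ p ∂(chartVolume I q),
      p ∈ (extChartAt I q).source ∩ extChartAt I q ⁻¹' interior (range I) by
    filter_upwards [hae] with p hp
    simpa only [(extChartAt I q).left_inv hp.1] using h _ ((extChartAt I q).map_source hp.1) hp.2
  refine (ae_map_iff (aemeasurable_extChartAt_symm q _) hopen.measurableSet).2
    ((withDensity_absolutelyContinuous _ _).ae_le ?_)
  filter_upwards [ae_target_mem_interior_range] with y hy
  exact ⟨(extChartAt I q).map_target hy.1, by
    rw [mem_preimage, (extChartAt I q).right_inv hy.1]; exact hy.2⟩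

variable [SecondCountableTopology M]

theorem riemannianVolume_restrict_source (q : M) :
    (riemannianVolume I : Measure M).restrict (extChartAt I q).source = chartVolume I q := by
  obtain ⟨t, htc, ht⟩ := TopologicalSpace.countable_cover_nhds
    (fun x : M => extChartAt_source_mem_nhds (I := I) x)
  obtain ⟨x, hx, -⟩ := mem_iUnion₂.1 (ht ▸ mem_univ q)
  obtain ⟨u, rfl⟩ := htc.exists_eq_range ⟨x, hx⟩
  rw [biUnion_range] at ht
  refine iSup_measure_restrict measurableSet_extChartAt_source ht chartVolume_restrict_source
    (fun i j => ?_) q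
  ext A hA
  have hAij := hA.inter ((measurableSet_extChartAt_source (I := I) i).inter
    (measurableSet_extChartAt_source (I := I) j))
  rw [Measure.restrict_apply hA, Measure.restrict_apply hA]
  exact chartVolume_eq_of_subset hAij (fun p hp => hp.2.1) (fun p hp => hp.2.2)

lemma riemannianVolume_apply (q : M) {A : Set M} (hq : A ⊆ (extChartAt I q).source) :
    riemannianVolume I A = chartVolume I q A := by
  rw [← riemannianVolume_restrict_source, Measure.restrict_eq_self _ hq]

end Volume

section Integration

variable {n : ℕ} {H : Type*} [TopologicalSpace H] {I : ModelWithCorners ℝ (𝔼 n) H}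
  {M : Type*} [TopologicalSpace M] [ChartedSpace H M] [IsManifold I ∞ M]
  [MeasurableSpace M] [BorelSpace M] [SecondCountableTopology M]
  [RiemannianBundle (fun x : M => TangentSpace I x)]
  [IsContMDiffRiemannianBundle I ∞ (𝔼 n) (fun x : M => TangentSpace I x)]

omit [MeasurableSpace M] [BorelSpace M] [SecondCountableTopology M] in
lemma aemeasurable_density (q : M) : AEMeasurable (fun y => ENNReal.ofReal (density I q y))
    (volume.restrict (extChartAt I q).target) :=
  ((contDiffOn_density (I := I) (q := q)).continuousOn.aemeasurable
    (measurableSet_extChartAt_target q)).ennreal_ofReal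

lemma integral_riemannianVolume_eq {q : M} {h : M → ℝ} (h0 : ∀ p ∉ (extChartAt I q).source, h p = 0)
    (hm : AEStronglyMeasurable h (chartVolume I q)) :
    ∫ p, h p ∂(riemannianVolume I : Measure M) =
      ∫ y in (extChartAt I q).target, density I q y * h ((extChartAt I q).symm y) := by
  rw [← setIntegral_eq_integral_of_forall_compl_eq_zero h0, riemannianVolume_restrict_source]
  rw [chartVolume_eq_map] at hm ⊢
  rw [integral_map (aemeasurable_extChartAt_symm q _) hm,
    integral_withDensity_eq_integral_toReal_smul₀ (aemeasurable_density q) (by simp)]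
  refine integral_congr_ae (.of_forall fun y => ?_)
  simp only [smul_eq_mul, ENNReal.toReal_ofReal (Real.sqrt_nonneg _), density]

instance riemannianVolume_isLocallyFinite :
    IsLocallyFiniteMeasure (riemannianVolume I : Measure M) := by
  refine ⟨fun q => ?_⟩
  have hcont : ContinuousWithinAt (density I q) (extChartAt I q).target (extChartAt I q q) :=
    (contDiffOn_density (I := I) (q := q)).continuousOn _ (mem_extChartAt_target q)
  obtain ⟨C, hC⟩ := exists_gt (density I q (extChartAt I q q))
  obtain ⟨r, hr, hball⟩ := Metric.mem_nhdsWithin_iff.1 (hcont.eventually_lt_const hC)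
  let A := (extChartAt I q).source ∩ extChartAt I q ⁻¹' Metric.ball (extChartAt I q q) r
  have hA : IsOpen A := isOpen_extChartAt_preimage' q Metric.isOpen_ball
  have hA_ball : (extChartAt I q).target ∩ (extChartAt I q).symm ⁻¹' A ⊆
      Metric.ball (extChartAt I q q) r := fun y hy => by
    simpa only [(extChartAt I q).right_inv hy.1, mem_preimage] using hy.2.2
  refine ⟨A, hA.mem_nhds ⟨mem_extChartAt_source q, Metric.mem_ball_self hr⟩, ?_⟩
  rw [riemannianVolume_apply q inter_subset_left, chartVolume_apply q hA.measurableSet]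
  exact setLIntegral_lt_top_of_le_nnreal
    ((measure_mono hA_ball).trans_lt measure_ball_lt_top).ne
    ⟨C.toNNReal, fun y hy => ENNReal.ofReal_le_ofReal (le_of_lt (hball ⟨hA_ball hy, hy.1⟩))⟩

instance riemannianVolume_isOpenPos :
    (riemannianVolume I : Measure M).IsOpenPosMeasure := by
  refine ⟨fun U hU ⟨q, hq⟩ h0 => ?_⟩
  have hW : IsOpen (U ∩ (extChartAt I q).source) := hU.inter (isOpen_extChartAt_source q)
  have hac : volume.restrict (extChartAt I q).target ≪ _ :=
    withDensity_absolutelyContinuous' (aemeasurable_density q) <|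
      (ae_restrict_mem (measurableSet_extChartAt_target q)).mono fun y hy => by
        simpa using density_pos hy
  have hnull : volume.restrict (extChartAt I q).target
      ((extChartAt I q).symm ⁻¹' (U ∩ (extChartAt I q).source)) = 0 := by
    refine hac ?_
    rw [← Measure.map_apply_of_aemeasurable (aemeasurable_extChartAt_symm q _) hW.measurableSet,
      ← chartVolume_eq_map, ← riemannianVolume_apply q inter_subset_right]
    exact measure_mono_null inter_subset_left h0
  rw [Measure.restrict_apply' (measurableSet_extChartAt_target q)] at hnull
  have hy := mem_extChartAt_target (I := I) q
  refine (volume_pos_of_mem_nhdsWithin_range (extChartAt_target_subset_range q hy) ?_).ne' hnull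
  exact Filter.inter_mem (tendsto_extChartAt_symm hy (extChartAt_to_inv q)
    (hW.mem_nhds ⟨hq, mem_extChartAt_source q⟩)) (target_mem_nhdsWithin_range hy)

end Integration

/-! ### The weak Piola identity -/

section Sections

lemma homInner_zero_left {V W : Type*} [NormedAddCommGroup V] [InnerProductSpace ℝ V]
    [NormedAddCommGroup W] [InnerProductSpace ℝ W] [FiniteDimensional ℝ V] (B : V →ₗ[ℝ] W) :
    homInner 0 B = 0 := by
  simp [homInner]

lemma homInner_add_left {V W : Type*} [NormedAddCommGroup V] [InnerProductSpace ℝ V]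
    [NormedAddCommGroup W] [InnerProductSpace ℝ W] [FiniteDimensional ℝ V] (A A' B : V →ₗ[ℝ] W) :
    homInner (A + A') B = homInner A B + homInner A' B := by
  simp [homInner, inner_add_left, Finset.sum_add_distrib]

lemma eventually_eq_zero_of_notMem_closure {X : Type*} [TopologicalSpace X] {F : X → Type*}
    [∀ x, Zero (F x)] {σ : ∀ x, F x} {x : X} (hx : x ∉ closure {x | σ x ≠ 0}) :
    ∀ᶠ x' in 𝓝 x, σ x' = 0 :=
  Filter.mem_of_superset (isClosed_closure.isOpen_compl.mem_nhds hx) fun _ hx' =>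
    by_contra fun hne => hx' (subset_closure hne)

lemma closure_smul_ne_zero_subset {X : Type*} [TopologicalSpace X] {F : X → Type*}
    [∀ x, AddCommMonoid (F x)] [∀ x, Module ℝ (F x)] (χ : X → ℝ) (σ : ∀ x, F x) :
    closure {x | χ x • σ x ≠ 0} ⊆ tsupport χ ∩ closure {x | σ x ≠ 0} :=
  subset_inter (closure_mono fun _ hx => left_ne_zero_of_smul hx)
    (closure_mono fun _ hx => right_ne_zero_of_smul hx)

lemma sum_mul_smul_add {m : ℕ} {F : Type*} [AddCommMonoid F] [Module ℝ F]
    (c : Fin m → Fin m → Fin m → ℝ) (A : Fin m → Fin m → F) (w w' : EuclideanSpace ℝ (Fin m)) :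
    ∑ k, ∑ i, ∑ j, (c k i j * (w + w') j) • A k i =
      ∑ k, ∑ i, ∑ j, (c k i j * w j) • A k i + ∑ k, ∑ i, ∑ j, (c k i j * w' j) • A k i := by
  simp only [PiLp.add_apply, mul_add, add_smul, Finset.sum_add_distrib]

variable {n : ℕ}
  {H₁ : Type*} [TopologicalSpace H₁] {I₁ : ModelWithCorners ℝ (𝔼 n) H₁}
  {M₁ : Type*} [TopologicalSpace M₁] [ChartedSpace H₁ M₁]
  {H₂ : Type*} [TopologicalSpace H₂] {I₂ : ModelWithCorners ℝ (𝔼 n) H₂}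
  {M₂ : Type*} [TopologicalSpace M₂] [ChartedSpace H₂ M₂] [IsManifold I₂ ∞ M₂]
  {f : M₁ → M₂} {σ σ' : ∀ p, TangentSpace I₂ (f p)}

lemma isSmoothSection_of_coords (hf : ContMDiff I₁ I₂ ∞ f)
    (h : ∀ p, ContMDiffAt I₁ 𝓘(ℝ, 𝔼 n) ∞ (fun p' => coords I₂ (f p) (f p') (σ p')) p) :
    IsSmoothSection I₁ I₂ f σ := by
  intro p
  let e := trivializationAt (𝔼 n) (TangentSpace I₂ : M₂ → Type _) (f p)
  have hq := mem_extChartAt_source (I := I₂) (f p)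
  have hmem : (⟨f p, σ p⟩ : TangentBundle I₂ M₂) ∈ e.source := e.mem_source.2 (mem_baseSet hq)
  refine (e.contMDiffAt_iff (f := fun p' => (⟨f p', σ p'⟩ : TangentBundle I₂ M₂)) hmem).2
    ⟨hf p, (h p).congr_of_eventuallyEq ?_⟩
  filter_upwards [hf.continuous.continuousAt.preimage_mem_nhds (extChartAt_source_mem_nhds' hq)]
    with p' hp'
  exact (coords_eq hp' _).symm

lemma isSmoothSection_zero (hf : ContMDiff I₁ I₂ ∞ f) : IsSmoothSection I₁ I₂ f (fun _ => 0) :=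
  isSmoothSection_of_coords hf fun p => by simpa only [map_zero] using contMDiffAt_const

lemma IsSmoothSection.add (hf : ContMDiff I₁ I₂ ∞ f) (hσ : IsSmoothSection I₁ I₂ f σ)
    (hσ' : IsSmoothSection I₁ I₂ f σ') : IsSmoothSection I₁ I₂ f (fun p => σ p + σ' p) :=
  isSmoothSection_of_coords hf fun p => by
    simp only [map_add]
    exact (hσ.contMDiffAt_coords (mem_extChartAt_source _)).add
      (hσ'.contMDiffAt_coords (mem_extChartAt_source _))

lemma IsSmoothSection.sum {ι : Type*} {S : Finset ι} {σ : ι → ∀ p, TangentSpace I₂ (f p)}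
    (hf : ContMDiff I₁ I₂ ∞ f) (hσ : ∀ i ∈ S, IsSmoothSection I₁ I₂ f (σ i)) :
    IsSmoothSection I₁ I₂ f (fun p => ∑ i ∈ S, σ i p) := by
  classical
  induction S using Finset.induction_on with
  | empty => simpa only [Finset.sum_empty] using isSmoothSection_zero hf
  | insert i S hi ih =>
    simp only [Finset.sum_insert hi]
    exact (hσ i (S.mem_insert_self i)).add hf (ih fun j hj => hσ j (Finset.mem_insert_of_mem hj))

lemma IsSmoothSection.smul (hf : ContMDiff I₁ I₂ ∞ f) (hσ : IsSmoothSection I₁ I₂ f σ)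
    {χ : M₁ → ℝ} (hχ : ContMDiff I₁ 𝓘(ℝ, ℝ) ∞ χ) :
    IsSmoothSection I₁ I₂ f (fun p => χ p • σ p) :=
  isSmoothSection_of_coords hf fun p => by
    simp only [map_smul]
    exact (hχ p).smul (hσ.contMDiffAt_coords (mem_extChartAt_source _))

variable [RiemannianBundle (fun x : M₂ => TangentSpace I₂ x)]

lemma christoffelMap_add (q : M₂) (w w' : 𝔼 n) :
    christoffelMap I₂ q (w + w') = christoffelMap I₂ q w + christoffelMap I₂ q w' :=
  sum_mul_smul_add _ _ w w'

lemma christoffelMap_zero (q : M₂) : christoffelMap I₂ q 0 = 0 := by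
  have h := christoffelMap_add (I₂ := I₂) q 0 0
  rw [add_zero] at h
  exact left_eq_add.1 h

lemma pullbackConnection_eq_zero {p : M₁} (h : ∀ᶠ p' in 𝓝 p, σ p' = 0) :
    pullbackConnection I₁ I₂ f σ p = 0 := by
  have hcoords : (fun p' => coords I₂ (f p) (f p') (σ p')) =ᶠ[𝓝 p] fun _ => 0 := by
    filter_upwards [h] with p' hp'
    rw [hp', map_zero]
  have hderiv : mvfderiv I₁ (fun p' => coords I₂ (f p) (f p') (σ p')) p = 0 := by
    rw [mvfderiv, hcoords.mfderiv_eq, mfderiv_const]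
    exact ContinuousLinearMap.comp_zero _
  ext v
  rw [pullbackConnection_apply, hderiv, h.self_of_nhds, map_zero, christoffelMap_zero]
  simp

lemma pullbackConnection_add (hσ : IsSmoothSection I₁ I₂ f σ)
    (hσ' : IsSmoothSection I₁ I₂ f σ') (p : M₁) :
    pullbackConnection I₁ I₂ f (fun p => σ p + σ' p) p =
      pullbackConnection I₁ I₂ f σ p + pullbackConnection I₁ I₂ f σ' p := by
  have hq := mem_extChartAt_source (I := I₂) (f p)
  have hderiv := mvfderiv_fun_add ((hσ.contMDiffAt_coords hq).mdifferentiableAt (by simp))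
    ((hσ'.contMDiffAt_coords hq).mdifferentiableAt (by simp))
  ext1 v
  simp only [LinearMap.add_apply, pullbackConnection_apply, map_add, hderiv, christoffelMap_add,
    add_apply]
  abel

variable [RiemannianBundle (fun x : M₁ => TangentSpace I₁ x)]
  {o₁ : ∀ x : M₁, Orientation ℝ (TangentSpace I₁ x) (Fin (n + 1))}
  {o₂ : ∀ x : M₂, Orientation ℝ (TangentSpace I₂ x) (Fin (n + 1))}

lemma cofPairing_eq_zero {p : M₁} (h : ∀ᶠ p' in 𝓝 p, σ p' = 0) :
    cofPairing I₁ I₂ o₁ o₂ f σ p = 0 := by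
  rw [cofPairing, pullbackConnection_eq_zero h, homInner_zero_left]

lemma cofPairing_sum {ι : Type*} {S : Finset ι} {σ : ι → ∀ p, TangentSpace I₂ (f p)}
    (hf : ContMDiff I₁ I₂ ∞ f) (hσ : ∀ i ∈ S, IsSmoothSection I₁ I₂ f (σ i)) (p : M₁) :
    cofPairing I₁ I₂ o₁ o₂ f (fun p => ∑ i ∈ S, σ i p) p =
      ∑ i ∈ S, cofPairing I₁ I₂ o₁ o₂ f (σ i) p := by
  classical
  induction S using Finset.induction_on with
  | empty =>
    simp only [Finset.sum_empty]
    exact cofPairing_eq_zero (.of_forall fun _ => rfl)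
  | insert i S hi ih =>
    have hσS := fun j hj => hσ j (Finset.mem_insert_of_mem hj)
    simp only [Finset.sum_insert hi]
    rw [cofPairing, pullbackConnection_add (hσ i (S.mem_insert_self i)) (.sum hf hσS),
      homInner_add_left, ← cofPairing, ← cofPairing, ih hσS]

end Sections

section Stokes

variable {n : ℕ}
  {H₁ : Type*} [TopologicalSpace H₁] {I₁ : ModelWithCorners ℝ (𝔼 n) H₁}
  {M₁ : Type*} [TopologicalSpace M₁] [ChartedSpace H₁ M₁] [IsManifold I₁ ∞ M₁]
  {H₂ : Type*} [TopologicalSpace H₂] {I₂ : ModelWithCorners ℝ (𝔼 n) H₂}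
  {M₂ : Type*} [TopologicalSpace M₂] [ChartedSpace H₂ M₂]
  {x₀ : M₁} {y : 𝔼 n}

lemma symm_mem_interior_iff (hy : y ∈ (extChartAt I₁ x₀).target) :
    (extChartAt I₁ x₀).symm y ∈ I₁.interior M₁ ↔ y ∈ interior (range I₁) := by
  have hsource : (extChartAt I₁ x₀).symm y ∈ (chartAt H₁ x₀).source := by
    simpa only [extChartAt_source] using (extChartAt I₁ x₀).map_target hy
  have hinterior : (extChartAt I₁ x₀).symm y ∈ I₁.interior M₁ ↔
      extChartAt I₁ x₀ ((extChartAt I₁ x₀).symm y) ∈ interior (extChartAt I₁ x₀).target :=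
    I₁.isInteriorPoint_iff_of_mem_atlas (n := ∞) (by simp) (chart_mem_atlas H₁ x₀) hsource
  rw [hinterior, (extChartAt I₁ x₀).right_inv hy]
  refine ⟨fun h => interior_mono (extChartAt_target_subset_range x₀) h, fun h => ?_⟩
  rw [mem_interior_iff_mem_nhds] at h ⊢
  simpa only [nhdsWithin_eq_nhds.2 h] using target_mem_nhdsWithin_range hy

variable [RiemannianBundle (fun x : M₂ => TangentSpace I₂ x)]
  {o₁ : ∀ x : M₁, Orientation ℝ (TangentSpace I₁ x) (Fin (n + 1))}
  {o₂ : ∀ x : M₂, Orientation ℝ (TangentSpace I₂ x) (Fin (n + 1))}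
  {f : M₁ → M₂} {σ : ∀ p, TangentSpace I₂ (f p)}

lemma flux_eq_zero (h : σ ((extChartAt I₁ x₀).symm y) = 0) (i : Fin (n + 1)) :
    flux I₁ I₂ o₂ f σ x₀ i y = 0 := by
  rw [flux, h]
  exact AlternatingMap.map_coord_zero _ i (Function.update_self _ _ _)

variable [IsManifold I₂ ∞ M₂]
  [IsContMDiffRiemannianBundle I₂ ∞ (𝔼 n) (fun x : M₂ => TangentSpace I₂ x)]

lemma continuousOn_fluxDivergence (ho₂ : IsOrientation I₂ o₂) (hf : ContMDiff I₁ I₂ ∞ f)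
    (hσ : IsSmoothSection I₁ I₂ f σ) :
    ContinuousOn (fluxDivergence I₁ I₂ o₂ f σ x₀) (extChartAt I₁ x₀).target := by
  refine continuousOn_finsetSum _ fun i _ y hy => ?_
  have hderiv : ContDiffWithinAt ℝ 0 (fderivWithin ℝ (flux I₁ I₂ o₂ f σ x₀ i) (range I₁))
      (range I₁) y :=
    (contDiffWithinAt_flux ho₂ hf hσ hy i).fderivWithin_right I₁.uniqueDiffOn (by simp)
      (extChartAt_target_subset_range x₀ hy)
  exact (hderiv.continuousWithinAt.mono (extChartAt_target_subset_range x₀)).clm_apply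
    continuousWithinAt_const

theorem integral_fluxDivergence_eq_zero (ho₂ : IsOrientation I₂ o₂) (hf : ContMDiff I₁ I₂ ∞ f)
    (hσ : IsSmoothSection I₁ I₂ f σ) (hσb : ∀ p ∈ I₁.boundary M₁, σ p = 0)
    (hσc : IsCompact (closure {p | σ p ≠ 0}))
    (hσx : closure {p | σ p ≠ 0} ⊆ (extChartAt I₁ x₀).source) :
    ∫ y in (extChartAt I₁ x₀).target, fluxDivergence I₁ I₂ o₂ f σ x₀ y = 0 := by
  let U : Set (𝔼 n) := I₁.symm ⁻¹' (chartAt H₁ x₀).target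
  let k : Set (𝔼 n) := extChartAt I₁ x₀ '' closure {p | σ p ≠ 0}
  have hU : IsOpen U := (chartAt H₁ x₀).open_target.preimage I₁.continuous_symm
  have htarget : (extChartAt I₁ x₀).target = U ∩ range I₁ := extChartAt_target I₁ x₀
  have hk : IsCompact k := hσc.image_of_continuousOn ((continuousOn_extChartAt x₀).mono hσx)
  have hkU : k ⊆ U := by
    rintro _ ⟨p, hp, rfl⟩
    exact (htarget.subset ((extChartAt I₁ x₀).map_source (hσx hp))).1
  have hsmooth (i : Fin (n + 1)) : ∀ y ∈ U ∩ range I₁,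
      ContDiffWithinAt ℝ 1 (flux I₁ I₂ o₂ f σ x₀ i) (range I₁) y := fun y hy =>
    contDiffWithinAt_flux ho₂ hf hσ (htarget.superset hy) i
  have hzero (i : Fin (n + 1)) : ∀ y ∈ U ∩ range I₁, y ∉ k → flux I₁ I₂ o₂ f σ x₀ i y = 0 :=
    fun y hy hyk => flux_eq_zero (by_contra fun hne => hyk
      ⟨_, subset_closure hne, (extChartAt I₁ x₀).right_inv (htarget.superset hy)⟩) i
  have hfrontier (i : Fin (n + 1)) : ∀ y ∈ U ∩ frontier (range I₁),
      flux I₁ I₂ o₂ f σ x₀ i y = 0 := fun y hy =>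
    flux_eq_zero (hσb _ (I₁.compl_interior.subset fun hint => hy.2.2 ((symm_mem_interior_iff
      (htarget.superset ⟨hy.1, I₁.isClosed_range.frontier_subset hy.2⟩)).1 hint))) i
  rw [htarget]
  simp only [fluxDivergence]
  rw [integral_finsetSum _ fun i _ => integrableOn_fderivWithin_inter I₁.isClosed_range
    I₁.uniqueDiffOn hU hk hkU (hsmooth i) (hzero i) _]
  exact Finset.sum_eq_zero fun i _ => integral_fderivWithin_inter_eq_zero volume I₁.convex_range
    I₁.isClosed_range I₁.nonempty_interior hU hk hkU (hsmooth i) (hzero i) (hfrontier i) _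

variable [RiemannianBundle (fun x : M₁ => TangentSpace I₁ x)]

lemma cofPairing_mul_volumeForm_eq_fluxDivergence (ho₂ : IsOrientation I₂ o₂)
    (hf : ContMDiff I₁ I₂ ∞ f) (hσ : IsSmoothSection I₁ I₂ f σ)
    (hy : y ∈ (extChartAt I₁ x₀).target) (hyi : y ∈ interior (range I₁)) :
    letI p := (extChartAt I₁ x₀).symm y
    cofPairing I₁ I₂ o₁ o₂ f σ p * (o₁ p).volumeForm (coordVec I₁ x₀ p) =
      fluxDivergence I₁ I₂ o₂ f σ x₀ y := by
  obtain ⟨s, -, hs⟩ :=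
    exists_volumeForm_coordVec_eq_mul_density ho₂ (f ((extChartAt I₁ x₀).symm y))
  rw [fluxDivergence_eq_mul_chartVariation hf hσ hy rfl hyi (mem_extChartAt_source _) hs]
  exact cofPairing_mul_volumeForm (hf.mdifferentiableAt (by simp)) hσ hy rfl hs.self_of_nhds

lemma density_mul_cofPairing (ho₂ : IsOrientation I₂ o₂) (hf : ContMDiff I₁ I₂ ∞ f)
    (hσ : IsSmoothSection I₁ I₂ f σ) {s : ℝ} (hs : s ≠ 0)
    (hvol : ∀ p ∈ closure {p | σ p ≠ 0}, (o₁ p).volumeForm (coordVec I₁ x₀ p) =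
      s * density I₁ x₀ (extChartAt I₁ x₀ p))
    (hy : y ∈ (extChartAt I₁ x₀).target) (hyi : y ∈ interior (range I₁)) :
    density I₁ x₀ y * cofPairing I₁ I₂ o₁ o₂ f σ ((extChartAt I₁ x₀).symm y) =
      s⁻¹ * fluxDivergence I₁ I₂ o₂ f σ x₀ y := by
  rw [← cofPairing_mul_volumeForm_eq_fluxDivergence (o₁ := o₁) ho₂ hf hσ hy hyi]
  by_cases hp : (extChartAt I₁ x₀).symm y ∈ closure {p | σ p ≠ 0}
  · rw [hvol _ hp, (extChartAt I₁ x₀).right_inv hy]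
    field_simp
  · rw [cofPairing_eq_zero (eventually_eq_zero_of_notMem_closure hp)]
    ring

lemma continuousOn_fluxDivergence_div_density
    [IsContMDiffRiemannianBundle I₁ ∞ (𝔼 n) (fun x : M₁ => TangentSpace I₁ x)]
    (ho₂ : IsOrientation I₂ o₂) (hf : ContMDiff I₁ I₂ ∞ f) (hσ : IsSmoothSection I₁ I₂ f σ)
    (c : ℝ) :
    ContinuousOn (fun p => c * fluxDivergence I₁ I₂ o₂ f σ x₀ (extChartAt I₁ x₀ p) /
      density I₁ x₀ (extChartAt I₁ x₀ p)) (extChartAt I₁ x₀).source :=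
  have hmaps := (extChartAt I₁ x₀).mapsTo
  (continuousOn_const.mul ((continuousOn_fluxDivergence ho₂ hf hσ).comp
    (continuousOn_extChartAt x₀) hmaps)).div
    (contDiffOn_density.continuousOn.comp (continuousOn_extChartAt x₀) hmaps)
    fun _ hp => (density_pos (hmaps hp)).ne'

variable [MeasurableSpace M₁] [BorelSpace M₁]

lemma cofPairing_ae_eq (ho₂ : IsOrientation I₂ o₂) (hf : ContMDiff I₁ I₂ ∞ f)
    (hσ : IsSmoothSection I₁ I₂ f σ) {s : ℝ} (hs : s ≠ 0)
    (hvol : ∀ p ∈ closure {p | σ p ≠ 0}, (o₁ p).volumeForm (coordVec I₁ x₀ p) =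
      s * density I₁ x₀ (extChartAt I₁ x₀ p)) :
    cofPairing I₁ I₂ o₁ o₂ f σ =ᵐ[chartVolume I₁ x₀] fun p =>
      s⁻¹ * fluxDivergence I₁ I₂ o₂ f σ x₀ (extChartAt I₁ x₀ p) /
        density I₁ x₀ (extChartAt I₁ x₀ p) := by
  refine ae_chartVolume_of_forall_interior fun y hy hyi => ?_
  simp only
  rw [(extChartAt I₁ x₀).right_inv hy, ← density_mul_cofPairing ho₂ hf hσ hs hvol hy hyi,
    mul_div_cancel_left₀ _ (density_pos hy).ne']

variable [IsContMDiffRiemannianBundle I₁ ∞ (𝔼 n) (fun x : M₁ => TangentSpace I₁ x)]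
  [SecondCountableTopology M₁]

lemma aestronglyMeasurable_cofPairing_of_chart (ho₂ : IsOrientation I₂ o₂)
    (hf : ContMDiff I₁ I₂ ∞ f) (hσ : IsSmoothSection I₁ I₂ f σ) {s : ℝ} (hs : s ≠ 0)
    (hvol : ∀ p ∈ closure {p | σ p ≠ 0}, (o₁ p).volumeForm (coordVec I₁ x₀ p) =
      s * density I₁ x₀ (extChartAt I₁ x₀ p)) :
    AEStronglyMeasurable (cofPairing I₁ I₂ o₁ o₂ f σ) (chartVolume I₁ x₀) := by
  refine AEStronglyMeasurable.congr ?_ (cofPairing_ae_eq ho₂ hf hσ hs hvol).symm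
  rw [← riemannianVolume_restrict_source]
  exact (continuousOn_fluxDivergence_div_density ho₂ hf hσ _).aestronglyMeasurable
    (measurableSet_extChartAt_source x₀)

lemma integrable_cofPairing_of_chart (ho₂ : IsOrientation I₂ o₂)
    (hf : ContMDiff I₁ I₂ ∞ f) (hσ : IsSmoothSection I₁ I₂ f σ)
    (hσc : IsCompact (closure {p | σ p ≠ 0}))
    (hσx : closure {p | σ p ≠ 0} ⊆ (extChartAt I₁ x₀).source) {s : ℝ} (hs : s ≠ 0)
    (hvol : ∀ p ∈ closure {p | σ p ≠ 0}, (o₁ p).volumeForm (coordVec I₁ x₀ p) =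
      s * density I₁ x₀ (extChartAt I₁ x₀ p)) :
    Integrable (cofPairing I₁ I₂ o₁ o₂ f σ) (riemannianVolume I₁ : Measure M₁) := by
  have hae := cofPairing_ae_eq ho₂ hf hσ hs hvol
  rw [← riemannianVolume_restrict_source] at hae
  have hcont := (continuousOn_fluxDivergence_div_density (x₀ := x₀) ho₂ hf hσ s⁻¹).mono hσx
  exact ((hcont.integrableOn_compact' hσc isClosed_closure.measurableSet).congr_fun_ae
    (Filter.EventuallyEq.symm (ae_mono (Measure.restrict_mono hσx le_rfl) hae))
    ).integrable_of_forall_notMem_eq_zero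
    fun p hp => cofPairing_eq_zero (eventually_eq_zero_of_notMem_closure hp)

theorem integral_cofPairing_eq_zero_of_chart (ho₂ : IsOrientation I₂ o₂)
    (hf : ContMDiff I₁ I₂ ∞ f) (hσ : IsSmoothSection I₁ I₂ f σ)
    (hσb : ∀ p ∈ I₁.boundary M₁, σ p = 0) (hσc : IsCompact (closure {p | σ p ≠ 0}))
    (hσx : closure {p | σ p ≠ 0} ⊆ (extChartAt I₁ x₀).source) {s : ℝ} (hs : s ≠ 0)
    (hvol : ∀ p ∈ closure {p | σ p ≠ 0}, (o₁ p).volumeForm (coordVec I₁ x₀ p) =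
      s * density I₁ x₀ (extChartAt I₁ x₀ p)) :
    ∫ p, cofPairing I₁ I₂ o₁ o₂ f σ p ∂(riemannianVolume I₁ : Measure M₁) = 0 := by
  rw [integral_riemannianVolume_eq
    (fun p hp => cofPairing_eq_zero (eventually_eq_zero_of_notMem_closure fun h => hp (hσx h)))
    (aestronglyMeasurable_cofPairing_of_chart ho₂ hf hσ hs hvol)]
  calc ∫ y in (extChartAt I₁ x₀).target,
        density I₁ x₀ y * cofPairing I₁ I₂ o₁ o₂ f σ ((extChartAt I₁ x₀).symm y)
      = ∫ y in (extChartAt I₁ x₀).target, s⁻¹ * fluxDivergence I₁ I₂ o₂ f σ x₀ y :=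
        integral_congr_ae <| ae_target_mem_interior_range.mono fun y hy =>
          density_mul_cofPairing ho₂ hf hσ hs hvol hy.1 hy.2
    _ = 0 := by
        rw [integral_const_mul, integral_fluxDivergence_eq_zero ho₂ hf hσ hσb hσc hσx, mul_zero]

end Stokes

section GlobalStokes

variable {n : ℕ}
  {H₁ : Type*} [TopologicalSpace H₁] {I₁ : ModelWithCorners ℝ (𝔼 n) H₁}
  {M₁ : Type*} [TopologicalSpace M₁] [ChartedSpace H₁ M₁] [IsManifold I₁ ∞ M₁]
  {H₂ : Type*} [TopologicalSpace H₂] {I₂ : ModelWithCorners ℝ (𝔼 n) H₂}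
  {M₂ : Type*} [TopologicalSpace M₂] [ChartedSpace H₂ M₂] [IsManifold I₂ ∞ M₂]
  [RiemannianBundle (fun x : M₁ => TangentSpace I₁ x)]
  [RiemannianBundle (fun x : M₂ => TangentSpace I₂ x)]
  [IsContMDiffRiemannianBundle I₂ ∞ (𝔼 n) (fun x : M₂ => TangentSpace I₂ x)]
  {o₁ : ∀ x : M₁, Orientation ℝ (TangentSpace I₁ x) (Fin (n + 1))}
  {o₂ : ∀ x : M₂, Orientation ℝ (TangentSpace I₂ x) (Fin (n + 1))}
  {f : M₁ → M₂} {σ : ∀ p, TangentSpace I₂ (f p)}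

lemma IsOrientation.exists_isOpen_volumeForm_eq (ho₁ : IsOrientation I₁ o₁) (q : M₁) :
    ∃ U : Set M₁, IsOpen U ∧ q ∈ U ∧ U ⊆ (extChartAt I₁ q).source ∧ ∃ s : ℝ, s ≠ 0 ∧
      ∀ p ∈ U, (o₁ p).volumeForm (coordVec I₁ q p) = s * density I₁ q (extChartAt I₁ q p) := by
  obtain ⟨s, -, hs⟩ := exists_volumeForm_coordVec_eq_mul_density ho₁ q
  have hs0 : s ≠ 0 := fun h => volumeForm_coordVec_ne_zero (mem_extChartAt_source q) (o₁ q) <| by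
    rw [hs.self_of_nhds, h, zero_mul]
  obtain ⟨U, hU, hUo, hqU⟩ := mem_nhds_iff.1
    (Filter.inter_mem (extChartAt_source_mem_nhds (I := I₁) q) hs)
  exact ⟨U, hUo, hqU, fun p hp => (hU hp).1, s, hs0, fun p hp => (hU hp).2⟩

variable [IsContMDiffRiemannianBundle I₁ ∞ (𝔼 n) (fun x : M₁ => TangentSpace I₁ x)]
  [T2Space M₁] [SecondCountableTopology M₁] [MeasurableSpace M₁] [BorelSpace M₁]

theorem integral_cofPairing_eq_zero (ho₁ : IsOrientation I₁ o₁) (ho₂ : IsOrientation I₂ o₂)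
    (hf : ContMDiff I₁ I₂ ∞ f) (hσ : IsSmoothSection I₁ I₂ f σ)
    (hσc : IsCompact (closure {p | σ p ≠ 0})) (hσb : ∀ p ∈ I₁.boundary M₁, σ p = 0) :
    ∫ p, cofPairing I₁ I₂ o₁ o₂ f σ p ∂(riemannianVolume I₁ : Measure M₁) = 0 := by
  have : LocallyCompactSpace M₁ := Manifold.locallyCompact_of_finiteDimensional I₁
  choose U hU hqU hUx s hs hvol using ho₁.exists_isOpen_volumeForm_eq
  obtain ⟨χ, hχ⟩ := SmoothPartitionOfUnity.exists_isSubordinate I₁ isClosed_closure U hU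
    fun p _ => mem_iUnion.2 ⟨p, hqU p⟩
  let S := (χ.locallyFinite.finite_nonempty_inter_compact hσc).toFinset
  have hsum : σ = fun p => ∑ i ∈ S, χ i p • σ p := by
    funext p
    by_cases hp : p ∈ closure {p | σ p ≠ 0}
    · rw [← Finset.sum_smul, ← finsum_eq_sum_of_support_subset, χ.sum_eq_one hp, one_smul]
      exact fun i hi => (Finite.coe_toFinset _).superset ⟨p, hi, hp⟩
    · simp [(eventually_eq_zero_of_notMem_closure hp).self_of_nhds]
  have hsmooth (i : M₁) : IsSmoothSection I₁ I₂ f fun p => χ i p • σ p :=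
    hσ.smul hf (χ i).contMDiff
  have hsub (i : M₁) := closure_smul_ne_zero_subset (χ i) σ
  have hcompact (i : M₁) : IsCompact (closure {p | χ i p • σ p ≠ 0}) :=
    hσc.of_isClosed_subset isClosed_closure ((hsub i).trans inter_subset_right)
  have hU (i : M₁) : closure {p | χ i p • σ p ≠ 0} ⊆ U i := fun p hp => hχ i (hsub i hp).1
  rw [hsum]
  simp only [cofPairing_sum hf fun i _ => hsmooth i]
  rw [integral_finsetSum _ fun i _ => integrable_cofPairing_of_chart ho₂ hf (hsmooth i)
    (hcompact i) ((hU i).trans (hUx i)) (hs i) fun p hp => hvol i p (hU i hp)]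
  exact Finset.sum_eq_zero fun i _ => integral_cofPairing_eq_zero_of_chart ho₂ hf (hsmooth i)
    (fun p hp => by rw [hσb p hp, smul_zero]) (hcompact i) ((hU i).trans (hUx i)) (hs i)
    fun p hp => hvol i p (hU i hp)

end GlobalStokes

/-! ### Uniqueness of the coderivative -/

section Uniqueness

variable {n : ℕ}
  {H₁ : Type*} [TopologicalSpace H₁] {I₁ : ModelWithCorners ℝ (𝔼 n) H₁}
  {M₁ : Type*} [TopologicalSpace M₁] [ChartedSpace H₁ M₁] [IsManifold I₁ ∞ M₁]

variable (I₁) in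
lemma exists_smoothBumpFunction_eq_zero_on_boundary [T2Space M₁] {p : M₁}
    (hp : p ∈ I₁.interior M₁) :
    ∃ χ : SmoothBumpFunction I₁ p, ∀ p' ∈ I₁.boundary M₁, χ p' = 0 := by
  obtain ⟨χ, -, hχ⟩ := (SmoothBumpFunction.nhds_basis_tsupport (I := I₁) p).mem_iff.1
    ((I₁.isOpen_interior (n := ∞) (by simp)).mem_nhds hp)
  exact ⟨χ, fun p' hp' => image_eq_zero_of_notMem_tsupport fun hmem =>
    I₁.compl_interior.superset hp' (hχ hmem)⟩

variable [RiemannianBundle (fun x : M₁ => TangentSpace I₁ x)] [SecondCountableTopology M₁]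
  [MeasurableSpace M₁] [BorelSpace M₁]

lemma ae_mem_interior : ∀ᵐ p ∂(riemannianVolume I₁ : Measure M₁), p ∈ I₁.interior M₁ := by
  obtain ⟨t, ht, hcover⟩ := TopologicalSpace.countable_cover_nhds
    fun x : M₁ => extChartAt_source_mem_nhds (I := I₁) x
  rw [← Measure.restrict_univ (μ := (riemannianVolume I₁ : Measure M₁)), ← hcover,
    ae_restrict_biUnion_iff _ ht]
  intro x _
  rw [riemannianVolume_restrict_source]
  exact ae_chartVolume_of_forall_interior fun y hy => (symm_mem_interior_iff hy).2

variable [IsContMDiffRiemannianBundle I₁ ∞ (𝔼 n) (fun x : M₁ => TangentSpace I₁ x)]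

lemma dense_interior : Dense (I₁.interior M₁) :=
  Measure.dense_of_ae ae_mem_interior

variable [T2Space M₁]
  {H₂ : Type*} [TopologicalSpace H₂] {I₂ : ModelWithCorners ℝ (𝔼 n) H₂}
  {M₂ : Type*} [TopologicalSpace M₂] [ChartedSpace H₂ M₂] [IsManifold I₂ ∞ M₂]
  [RiemannianBundle (fun x : M₂ => TangentSpace I₂ x)]
  [IsContMDiffRiemannianBundle I₂ ∞ (𝔼 n) (fun x : M₂ => TangentSpace I₂ x)]
  {f : M₁ → M₂} {τ : ∀ p, TangentSpace I₂ (f p)}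

theorem IsSmoothSection.eq_zero_of_integral_inner_eq_zero (hf : ContMDiff I₁ I₂ ∞ f)
    (hτ : IsSmoothSection I₁ I₂ f τ)
    (h : ∀ σ : ∀ p, TangentSpace I₂ (f p), IsSmoothSection I₁ I₂ f σ →
      IsCompact (closure {p | σ p ≠ 0}) → (∀ p ∈ I₁.boundary M₁, σ p = 0) →
      ∫ p, inner ℝ (σ p) (τ p) ∂(riemannianVolume I₁ : Measure M₁) = 0) : τ = fun _ => 0 := by
  have : LocallyCompactSpace M₁ := Manifold.locallyCompact_of_finiteDimensional I₁
  have hnorm : Continuous fun p => inner ℝ (τ p) (τ p) :=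
    (ContMDiff.inner_bundle hτ hτ).continuous
  by_contra hne
  obtain ⟨p₀, hp₀⟩ := Function.ne_iff.1 hne
  obtain ⟨p, hpτ, hp⟩ := dense_interior (I₁ := I₁).inter_open_nonempty _
    (isOpen_ne_fun hnorm continuous_const) ⟨p₀, inner_self_ne_zero.2 hp₀⟩
  obtain ⟨χ, hχ⟩ := exists_smoothBumpFunction_eq_zero_on_boundary I₁ hp
  have hcutoff : ∫ p, χ p * inner ℝ (τ p) (τ p) ∂(riemannianVolume I₁ : Measure M₁) = 0 := by
    simp only [← real_inner_smul_left]
    refine h _ (hτ.smul hf χ.contMDiff) ?_ fun p' hp' => by rw [hχ p' hp', zero_smul]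
    exact χ.hasCompactSupport.of_isClosed_subset isClosed_closure
      ((closure_smul_ne_zero_subset χ τ).trans inter_subset_left)
  refine (Continuous.integral_pos_of_hasCompactSupport_nonneg_nonzero (x := p)
    (χ.continuous.mul hnorm) χ.hasCompactSupport.mul_right
    (fun p' => mul_nonneg χ.nonneg real_inner_self_nonneg) ?_).ne' hcutoff
  rwa [Pi.mul_apply, χ.eq_one, one_mul]

end Uniqueness

/-! ### Smooth families of maps -/

section Families

variable {n : ℕ}
  {H₁ : Type*} [TopologicalSpace H₁] (I₁ : ModelWithCorners ℝ (𝔼 n) H₁)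
  {M₁ : Type*} [TopologicalSpace M₁] [ChartedSpace H₁ M₁]
  {H₂ : Type*} [TopologicalSpace H₂] (I₂ : ModelWithCorners ℝ (𝔼 n) H₂)
  {M₂ : Type*} [TopologicalSpace M₂] [ChartedSpace H₂ M₂]

/-- The family of maps `ψ s`, with `s` near `t`, is jointly smooth in time and position. -/
def IsSmoothFamilyAt (ψ : ℝ → M₁ → M₂) (t : ℝ) : Prop :=
  ∀ᶠ s in 𝓝 t, ∀ p, ContMDiffAt (𝓘(ℝ, ℝ).prod I₁) I₂ ∞ (fun z : ℝ × M₁ => ψ z.1 z.2) (s, p)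

/-- The family of maps `ψ` as a function of time and of the position in the charts centred at `x₀`
and `q`. -/
def chartFamily (ψ : ℝ → M₁ → M₂) (x₀ : M₁) (q : M₂) (z : ℝ × 𝔼 n) : 𝔼 n :=
  chartMap I₁ I₂ (ψ z.1) x₀ q z.2

variable {I₁ I₂} {ψ : ℝ → M₁ → M₂} {x₀ p : M₁} {q : M₂} {t : ℝ} {y : 𝔼 n}

lemma IsVariation.isSmoothFamilyAt {φ : M₁ → M₂} {K : Set M₁} {ε : ℝ}
    (h : IsVariation I₁ I₂ φ K ε ψ) (ht : t ∈ Ioo (-ε) ε) : IsSmoothFamilyAt I₁ I₂ ψ t :=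
  Filter.mem_of_superset (isOpen_Ioo.mem_nhds ht) fun _ hs _ =>
    h.smooth.contMDiffAt ((isOpen_Ioo.prod isOpen_univ).mem_nhds ⟨hs, trivial⟩)

lemma isSmoothFamilyAt_const {f : M₁ → M₂} (hf : ContMDiff I₁ I₂ ∞ f) (t : ℝ) :
    IsSmoothFamilyAt I₁ I₂ (fun _ => f) t :=
  .of_forall fun _ _ => (hf.comp contMDiff_snd).contMDiffAt

lemma IsSmoothFamilyAt.contMDiffAt (hψ : IsSmoothFamilyAt I₁ I₂ ψ t) (p : M₁) :
    ContMDiffAt (𝓘(ℝ, ℝ).prod I₁) I₂ ∞ (fun z : ℝ × M₁ => ψ z.1 z.2) (t, p) :=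
  hψ.self_of_nhds p

lemma IsSmoothFamilyAt.eventually_contMDiffAt (hψ : IsSmoothFamilyAt I₁ I₂ ψ t) (p : M₁) :
    ∀ᶠ z in 𝓝 (t, p), ContMDiffAt (𝓘(ℝ, ℝ).prod I₁) I₂ ∞ (fun z : ℝ × M₁ => ψ z.1 z.2) z :=
  (hψ.prod_inl_nhds p).mono fun z hz => hz z.2

lemma contMDiffAt_slice
    (hψ : ContMDiffAt (𝓘(ℝ, ℝ).prod I₁) I₂ ∞ (fun z : ℝ × M₁ => ψ z.1 z.2) (t, p)) :
    ContMDiffAt I₁ I₂ ∞ (ψ t) p :=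
  ContMDiffAt.comp (g := fun z : ℝ × M₁ => ψ z.1 z.2) p hψ
    (contMDiffAt_const.prodMk contMDiffAt_id)

lemma contMDiffAt_curve
    (hψ : ContMDiffAt (𝓘(ℝ, ℝ).prod I₁) I₂ ∞ (fun z : ℝ × M₁ => ψ z.1 z.2) (t, p)) :
    ContMDiffAt 𝓘(ℝ, ℝ) I₂ ∞ (fun s => ψ s p) t :=
  ContMDiffAt.comp (g := fun z : ℝ × M₁ => ψ z.1 z.2) t hψ
    (contMDiffAt_id.prodMk contMDiffAt_const)

lemma IsSmoothFamilyAt.contMDiff (hψ : IsSmoothFamilyAt I₁ I₂ ψ t) : ContMDiff I₁ I₂ ∞ (ψ t) :=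
  fun p => contMDiffAt_slice (hψ.contMDiffAt p)

lemma chartFamily_extChartAt (hp : p ∈ (extChartAt I₁ x₀).source) (t : ℝ) :
    chartFamily I₁ I₂ ψ x₀ q (t, extChartAt I₁ x₀ p) = extChartAt I₂ q (ψ t p) := by
  rw [chartFamily, chartMap, (extChartAt I₁ x₀).left_inv hp]

lemma tendsto_prodMk_extChartAt (t : ℝ) (p : M₁) :
    Filter.Tendsto (fun z : ℝ × M₁ => (z.1, extChartAt I₁ p z.2)) (𝓝 (t, p))
      (𝓝[univ ×ˢ range I₁] (t, extChartAt I₁ p p)) := by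
  refine tendsto_nhdsWithin_iff.2 ⟨?_, .of_forall fun z => ⟨trivial, extChartAt_mem_range _ _⟩⟩
  rw [nhds_prod_eq, nhds_prod_eq]
  exact Filter.tendsto_id.prodMap (continuousAt_extChartAt p)

lemma uniqueDiffOn_univ_prod_range : UniqueDiffOn ℝ ((univ : Set ℝ) ×ˢ range I₁) :=
  uniqueDiffOn_univ.prod I₁.uniqueDiffOn

variable [IsManifold I₁ ∞ M₁] [IsManifold I₂ ∞ M₂]

lemma contDiffWithinAt_chartFamily
    (hψ : ContMDiffAt (𝓘(ℝ, ℝ).prod I₁) I₂ ∞ (fun z : ℝ × M₁ => ψ z.1 z.2) (t, p))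
    (hp : p ∈ (extChartAt I₁ x₀).source) (hq : ψ t p ∈ (extChartAt I₂ q).source) :
    ContDiffWithinAt ℝ ∞ (chartFamily I₁ I₂ ψ x₀ q) (univ ×ˢ range I₁)
      (t, extChartAt I₁ x₀ p) := by
  have htarget := (extChartAt I₁ x₀).map_source hp
  have hsymm : ContMDiffWithinAt 𝓘(ℝ, 𝔼 n) I₁ ∞ (extChartAt I₁ x₀).symm (range I₁)
      (extChartAt I₁ x₀ p) :=
    (contMDiffOn_extChartAt_symm x₀ _ htarget).mono_of_mem_nhdsWithin
      (target_mem_nhdsWithin_range htarget)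
  have hparam : ContMDiffWithinAt 𝓘(ℝ, ℝ × 𝔼 n) (𝓘(ℝ, ℝ).prod I₁) ∞
      (fun z : ℝ × 𝔼 n => (z.1, (extChartAt I₁ x₀).symm z.2)) (univ ×ˢ range I₁)
      (t, extChartAt I₁ x₀ p) :=
    contDiff_fst.contDiffWithinAt.contMDiffWithinAt.prodMk <|
      hsymm.comp (t, extChartAt I₁ x₀ p) contDiff_snd.contDiffWithinAt.contMDiffWithinAt
        fun z hz => hz.2
  have hchart : ContMDiffAt (𝓘(ℝ, ℝ).prod I₁) 𝓘(ℝ, 𝔼 n) ∞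
      (fun z : ℝ × M₁ => extChartAt I₂ q (ψ z.1 z.2))
      (t, (extChartAt I₁ x₀).symm (extChartAt I₁ x₀ p)) := by
    rw [(extChartAt I₁ x₀).left_inv hp]
    exact (contMDiffAt_extChartAt' (by simpa using hq)).comp _ hψ
  exact contMDiffWithinAt_iff_contDiffWithinAt.1 <|
    ContMDiffAt.comp_contMDiffWithinAt (g := fun z : ℝ × M₁ => extChartAt I₂ q (ψ z.1 z.2))
      (t, extChartAt I₁ x₀ p) hchart hparam

lemma contDiffWithinAt_fderivWithin_chartFamily
    (hψ : ContMDiffAt (𝓘(ℝ, ℝ).prod I₁) I₂ ∞ (fun z : ℝ × M₁ => ψ z.1 z.2) (t, p))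
    (hp : p ∈ (extChartAt I₁ x₀).source) (hq : ψ t p ∈ (extChartAt I₂ q).source) :
    ContDiffWithinAt ℝ ∞
      (fderivWithin ℝ (chartFamily I₁ I₂ ψ x₀ q) (univ ×ˢ range I₁)) (univ ×ˢ range I₁)
      (t, extChartAt I₁ x₀ p) :=
  (contDiffWithinAt_chartFamily hψ hp hq).fderivWithin_right uniqueDiffOn_univ_prod_range
    (by simp) ⟨trivial, extChartAt_mem_range _ _⟩

end Families

section DeterminantFamilies

variable {n : ℕ}
  {H₁ : Type*} [TopologicalSpace H₁] (I₁ : ModelWithCorners ℝ (𝔼 n) H₁)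
  {M₁ : Type*} [TopologicalSpace M₁] [ChartedSpace H₁ M₁] [IsManifold I₁ ∞ M₁]
  [RiemannianBundle (fun x : M₁ => TangentSpace I₁ x)]
  {H₂ : Type*} [TopologicalSpace H₂] (I₂ : ModelWithCorners ℝ (𝔼 n) H₂)
  {M₂ : Type*} [TopologicalSpace M₂] [ChartedSpace H₂ M₂] [IsManifold I₂ ∞ M₂]
  [RiemannianBundle (fun x : M₂ => TangentSpace I₂ x)]

/-- `√(det g₂) det (∂ψ) / √(det g₁)` in the charts centred at `x₀` and `q`: the determinant of the
differential of `ψ t` up to the orientation signs, as a function of time and position. -/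
def chartDet (ψ : ℝ → M₁ → M₂) (x₀ : M₁) (q : M₂) (z : ℝ × 𝔼 n) : ℝ :=
  density I₂ q (chartFamily I₁ I₂ ψ x₀ q z) * stdVol n (fun j =>
    fderivWithin ℝ (chartFamily I₁ I₂ ψ x₀ q) (univ ×ˢ range I₁) z
      (0, EuclideanSpace.single j 1)) / density I₁ x₀ z.2

variable {I₁ I₂} {ψ : ℝ → M₁ → M₂} {x₀ p : M₁} {q : M₂} {t : ℝ}
  {o₁ : ∀ x : M₁, Orientation ℝ (TangentSpace I₁ x) (Fin (n + 1))}
  {o₂ : ∀ x : M₂, Orientation ℝ (TangentSpace I₂ x) (Fin (n + 1))}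

lemma DetD_mul_volumeForm {f : M₁ → M₂} (hp : p ∈ (extChartAt I₁ x₀).source)
    (hq : f p ∈ (extChartAt I₂ q).source) (hf : MDifferentiableAt I₁ I₂ f p) :
    DetD I₁ I₂ o₁ o₂ f p * (o₁ p).volumeForm (coordVec I₁ x₀ p) =
      (o₂ (f p)).volumeForm (coordVec I₂ q (f p)) * stdVol n (fun j =>
        fderivWithin ℝ (chartMap I₁ I₂ f x₀ q) (range I₁) (extChartAt I₁ x₀ p)
          (EuclideanSpace.single j 1)) := by
  have hpullback := DFunLike.congr_fun (volumeForm_compLinearMap (o₁ p) (o₂ (f p))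
    (differential I₁ I₂ f p)) (coordVec I₁ x₀ p)
  rw [AlternatingMap.smul_apply, smul_eq_mul] at hpullback
  rw [DetD, ← hpullback, AlternatingMap.compLinearMap_apply, volumeForm_eq_stdVol hq]
  congr 2
  funext j
  exact coords_mfderiv_coordVec ((extChartAt I₁ x₀).map_source hp)
    ((extChartAt I₁ x₀).left_inv hp) hq hf j

lemma DetD_eq_mul_chartDet
    (hψ : ContMDiffAt (𝓘(ℝ, ℝ).prod I₁) I₂ ∞ (fun z : ℝ × M₁ => ψ z.1 z.2) (t, p))
    (hp : p ∈ (extChartAt I₁ x₀).source) (hq : ψ t p ∈ (extChartAt I₂ q).source) {s₁ s₂ : ℝ}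
    (hs₁ : s₁ ≠ 0) (hvol₁ : (o₁ p).volumeForm (coordVec I₁ x₀ p) =
      s₁ * density I₁ x₀ (extChartAt I₁ x₀ p))
    (hvol₂ : (o₂ (ψ t p)).volumeForm (coordVec I₂ q (ψ t p)) =
      s₂ * density I₂ q (extChartAt I₂ q (ψ t p))) :
    DetD I₁ I₂ o₁ o₂ (ψ t) p =
      s₁⁻¹ * s₂ * chartDet I₁ I₂ ψ x₀ q (t, extChartAt I₁ x₀ p) := by
  have hdensity : density I₁ x₀ (extChartAt I₁ x₀ p) ≠ 0 :=
    (density_pos ((extChartAt I₁ x₀).map_source hp)).ne'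
  have hslice : fderivWithin ℝ (chartMap I₁ I₂ (ψ t) x₀ q) (range I₁) (extChartAt I₁ x₀ p) =
      fderivWithin ℝ (chartFamily I₁ I₂ ψ x₀ q) (univ ×ˢ range I₁)
        (t, extChartAt I₁ x₀ p) ∘L .inr ℝ ℝ (𝔼 n) :=
    fderivWithin_slice (Φ := chartFamily I₁ I₂ ψ x₀ q)
      (I₁.uniqueDiffOn _ (extChartAt_mem_range _ _))
      ((contDiffWithinAt_chartFamily hψ hp hq).differentiableWithinAt (by simp))
  have hDet := DetD_mul_volumeForm (o₁ := o₁) (o₂ := o₂) hp hq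
    ((contMDiffAt_slice hψ).mdifferentiableAt (by simp))
  simp only [hvol₁, hvol₂, hslice, ContinuousLinearMap.comp_apply,
    ContinuousLinearMap.inr_apply] at hDet
  rw [chartDet, chartFamily_extChartAt hp]
  field_simp
  linear_combination hDet

lemma IsSmoothFamilyAt.exists_eventually_DetD_eq (hψ : IsSmoothFamilyAt I₁ I₂ ψ t)
    (ho₁ : IsOrientation I₁ o₁) (ho₂ : IsOrientation I₂ o₂) (p : M₁) :
    ∃ c : ℝ, ∀ᶠ z in 𝓝 (t, p), DetD I₁ I₂ o₁ o₂ (ψ z.1) z.2 =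
      c * chartDet I₁ I₂ ψ p (ψ t p) (z.1, extChartAt I₁ p z.2) := by
  obtain ⟨U, hU, hpU, hUp, s₁, hs₁, hvol₁⟩ := ho₁.exists_isOpen_volumeForm_eq p
  obtain ⟨V, hV, hqV, hVq, s₂, -, hvol₂⟩ := ho₂.exists_isOpen_volumeForm_eq (ψ t p)
  refine ⟨s₁⁻¹ * s₂, ?_⟩
  filter_upwards [hψ.eventually_contMDiffAt p,
    continuous_snd.continuousAt.eventually (hU.mem_nhds hpU),
    (hψ.contMDiffAt p).continuousAt.eventually (hV.mem_nhds hqV)] with z hz hzU hzV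
  exact DetD_eq_mul_chartDet hz (hUp hzU) (hVq hzV) hs₁ (hvol₁ _ hzU) (hvol₂ _ hzV)

variable [IsContMDiffRiemannianBundle I₁ ∞ (𝔼 n) (fun x : M₁ => TangentSpace I₁ x)]
  [IsContMDiffRiemannianBundle I₂ ∞ (𝔼 n) (fun x : M₂ => TangentSpace I₂ x)]

lemma contDiffWithinAt_chartDet
    (hψ : ContMDiffAt (𝓘(ℝ, ℝ).prod I₁) I₂ ∞ (fun z : ℝ × M₁ => ψ z.1 z.2) (t, p))
    (hp : p ∈ (extChartAt I₁ x₀).source) (hq : ψ t p ∈ (extChartAt I₂ q).source) :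
    ContDiffWithinAt ℝ ∞ (chartDet I₁ I₂ ψ x₀ q) (univ ×ˢ range I₁)
      (t, extChartAt I₁ x₀ p) := by
  have hdensity₂ : ContDiffWithinAt ℝ ∞ (fun z => density I₂ q (chartFamily I₁ I₂ ψ x₀ q z))
      (univ ×ˢ range I₁) (t, extChartAt I₁ x₀ p) := by
    have hdensity := contDiffWithinAt_density (I := I₂) hq
    rw [← chartFamily_extChartAt hp] at hdensity
    exact hdensity.comp (t, extChartAt I₁ x₀ p) (contDiffWithinAt_chartFamily hψ hp hq)
      fun z _ => chartMap_mem_range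
  have hdensity₁ : ContDiffWithinAt ℝ ∞ (fun z : ℝ × 𝔼 n => density I₁ x₀ z.2)
      (univ ×ˢ range I₁) (t, extChartAt I₁ x₀ p) :=
    ContDiffWithinAt.comp (g := density I₁ x₀) (t := range I₁) (t, extChartAt I₁ x₀ p)
      (contDiffWithinAt_density hp) contDiffWithinAt_snd fun z hz => hz.2
  refine (hdensity₂.mul ?_).div hdensity₁ (density_pos ((extChartAt I₁ x₀).map_source hp)).ne'
  exact (stdVol n).toContinuousMultilinearMap.contDiff.comp_contDiffWithinAt <|
    contDiffWithinAt_pi.2 fun j =>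
      (contDiffWithinAt_fderivWithin_chartFamily hψ hp hq).clm_apply contDiffWithinAt_const

lemma IsSmoothFamilyAt.eventually_contDiffWithinAt_chartDet (hψ : IsSmoothFamilyAt I₁ I₂ ψ t)
    (p : M₁) : ∀ᶠ z in 𝓝 (t, p), ContDiffWithinAt ℝ ∞ (chartDet I₁ I₂ ψ p (ψ t p))
      (univ ×ˢ range I₁) (z.1, extChartAt I₁ p z.2) := by
  filter_upwards [hψ.eventually_contMDiffAt p,
    continuous_snd.continuousAt.eventually (extChartAt_source_mem_nhds (I := I₁) p),
    (hψ.contMDiffAt p).continuousAt.eventually (extChartAt_source_mem_nhds (I := I₂) _)]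
    with z hz hp hq using contDiffWithinAt_chartDet hz hp hq

lemma IsSmoothFamilyAt.exists_eventually_hasDerivAt_DetD (hψ : IsSmoothFamilyAt I₁ I₂ ψ t)
    (ho₁ : IsOrientation I₁ o₁) (ho₂ : IsOrientation I₂ o₂) (p : M₁) :
    ∃ c : ℝ, ∀ᶠ z in 𝓝 (t, p), HasDerivAt (fun s => DetD I₁ I₂ o₁ o₂ (ψ s) z.2)
      (c * fderivWithin ℝ (chartDet I₁ I₂ ψ p (ψ t p)) (univ ×ˢ range I₁)
        (z.1, extChartAt I₁ p z.2) (1, 0)) z.1 := by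
  obtain ⟨c, hc⟩ := hψ.exists_eventually_DetD_eq ho₁ ho₂ p
  refine ⟨c, ?_⟩
  filter_upwards [hψ.eventually_contDiffWithinAt_chartDet p, hc.eventually_nhds] with z hz hcz
  exact ((hasDerivAt_slice_of_mem (extChartAt_mem_range _ _)
    (hz.differentiableWithinAt (by simp))).const_mul c).congr_of_eventuallyEq
      ((Continuous.prodMk_left z.2).tendsto z.1 |>.eventually hcz)

lemma IsSmoothFamilyAt.differentiableAt_DetD (hψ : IsSmoothFamilyAt I₁ I₂ ψ t)
    (ho₁ : IsOrientation I₁ o₁) (ho₂ : IsOrientation I₂ o₂) (p : M₁) :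
    DifferentiableAt ℝ (fun s => DetD I₁ I₂ o₁ o₂ (ψ s) p) t :=
  have ⟨_, hderiv⟩ := hψ.exists_eventually_hasDerivAt_DetD ho₁ ho₂ p
  hderiv.self_of_nhds.differentiableAt

lemma IsSmoothFamilyAt.continuousAt_deriv_DetD (hψ : IsSmoothFamilyAt I₁ I₂ ψ t)
    (ho₁ : IsOrientation I₁ o₁) (ho₂ : IsOrientation I₂ o₂) (p : M₁) :
    ContinuousAt (fun z : ℝ × M₁ => deriv (fun s => DetD I₁ I₂ o₁ o₂ (ψ s) z.2) z.1) (t, p) := by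
  obtain ⟨c, hderiv⟩ := hψ.exists_eventually_hasDerivAt_DetD ho₁ ho₂ p
  refine ContinuousAt.congr ?_ (hderiv.mono fun z hz => hz.deriv.symm)
  have hfderiv : ContinuousWithinAt
      (fderivWithin ℝ (chartDet I₁ I₂ ψ p (ψ t p)) (univ ×ˢ range I₁)) (univ ×ˢ range I₁)
      (t, extChartAt I₁ p p) :=
    ((contDiffWithinAt_chartDet (hψ.contMDiffAt p) (mem_extChartAt_source p)
      (mem_extChartAt_source _)).fderivWithin_right (m := 0) uniqueDiffOn_univ_prod_range
      (by simp) ⟨trivial, extChartAt_mem_range _ _⟩).continuousWithinAt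
  exact continuousAt_const.mul (ContinuousAt.clm_apply
    (hfderiv.tendsto.comp (tendsto_prodMk_extChartAt t p)) continuousAt_const)

lemma IsSmoothFamilyAt.continuousAt_DetD (hψ : IsSmoothFamilyAt I₁ I₂ ψ t)
    (ho₁ : IsOrientation I₁ o₁) (ho₂ : IsOrientation I₂ o₂) (p : M₁) :
    ContinuousAt (fun z : ℝ × M₁ => DetD I₁ I₂ o₁ o₂ (ψ z.1) z.2) (t, p) := by
  obtain ⟨c, hc⟩ := hψ.exists_eventually_DetD_eq ho₁ ho₂ p
  have hchartDet : ContinuousWithinAt (chartDet I₁ I₂ ψ p (ψ t p)) (univ ×ˢ range I₁)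
      (t, extChartAt I₁ p p) :=
    (contDiffWithinAt_chartDet (hψ.contMDiffAt p) (mem_extChartAt_source p)
      (mem_extChartAt_source _)).continuousWithinAt
  refine ContinuousAt.congr ?_ (hc.mono fun z hz => hz.symm)
  exact continuousAt_const.mul (hchartDet.tendsto.comp (tendsto_prodMk_extChartAt t p))

lemma continuous_DetD (ho₁ : IsOrientation I₁ o₁) (ho₂ : IsOrientation I₂ o₂) {f : M₁ → M₂}
    (hf : ContMDiff I₁ I₂ ∞ f) : Continuous (DetD I₁ I₂ o₁ o₂ f) := by
  refine continuous_iff_continuousAt.2 fun p => ?_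
  have hconst := (isSmoothFamilyAt_const hf (0 : ℝ)).continuousAt_DetD ho₁ ho₂ p
  exact ContinuousAt.comp (f := fun p' : M₁ => ((0 : ℝ), p')) hconst
    (Continuous.prodMk_right (0 : ℝ)).continuousAt

end DeterminantFamilies

/-! ### The first variation -/

section ParametricIntegral

lemma hasDerivAt_setIntegral_of_continuousAt_deriv {X : Type*} [TopologicalSpace X]
    [MeasurableSpace X] [OpensMeasurableSpace X] {μ : Measure X} [IsFiniteMeasureOnCompacts μ]
    {K : Set X} (hK : IsCompact K) (hKm : MeasurableSet K) {F : ℝ → X → ℝ} {t : ℝ}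
    (hcont : ∀ᶠ s in 𝓝 t, Continuous (F s))
    (hdiff : ∀ᶠ s in 𝓝 t, ∀ x, DifferentiableAt ℝ (fun s => F s x) s)
    (hderiv : ∀ᶠ s in 𝓝 t, ∀ x,
      ContinuousAt (fun z : ℝ × X => deriv (fun s => F s z.2) z.1) (s, x)) :
    HasDerivAt (fun s => ∫ x in K, F s x ∂μ) (∫ x in K, deriv (fun s => F s x) t ∂μ) t := by
  obtain ⟨r, hr, hball⟩ := Metric.nhds_basis_closedBall.mem_iff.1 (hdiff.and hderiv)
  obtain ⟨C, hC⟩ := ((isCompact_closedBall t r).prod hK).exists_bound_of_continuousOn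
    fun z hz => ((hball hz.1).2 z.2).continuousWithinAt
  have hderiv_cont : Continuous fun x => deriv (fun s => F s x) t :=
    continuous_iff_continuousAt.2 fun x => ContinuousAt.comp (f := fun x => (t, x))
      (hderiv.self_of_nhds x) (Continuous.prodMk_right t).continuousAt
  refine (hasDerivAt_integral_of_dominated_loc_of_deriv_le (bound := fun _ => C)
    (Metric.closedBall_mem_nhds t hr) (hcont.mono fun s hs => hs.aestronglyMeasurable)
    (hcont.self_of_nhds.continuousOn.integrableOn_compact' hK hKm)
    hderiv_cont.aestronglyMeasurable ?_ (integrableOn_const hK.measure_lt_top.ne)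
    (.of_forall fun x s hs => ((hball hs).1 x).hasDerivAt)).2
  filter_upwards [ae_restrict_mem hKm] with x hx s hs using hC (s, x) ⟨hs, hx⟩

end ParametricIntegral

section VariationField

variable {n : ℕ}
  {H₁ : Type*} [TopologicalSpace H₁] {I₁ : ModelWithCorners ℝ (𝔼 n) H₁}
  {M₁ : Type*}
  {H₂ : Type*} [TopologicalSpace H₂] {I₂ : ModelWithCorners ℝ (𝔼 n) H₂}
  {M₂ : Type*} [TopologicalSpace M₂] [ChartedSpace H₂ M₂]
  {ψ : ℝ → M₁ → M₂} {p : M₁} {q : M₂}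

variable (I₂) in
/-- The velocity at time zero of the family of maps `ψ`, a vector field along `ψ 0`. -/
def variationField (ψ : ℝ → M₁ → M₂) (p : M₁) : TangentSpace I₂ (ψ 0 p) :=
  mfderiv 𝓘(ℝ, ℝ) I₂ (fun t => ψ t p) 0 (1 : ℝ)

lemma variationField_eq_zero (h : ∀ᶠ t in 𝓝 (0 : ℝ), ψ t p = ψ 0 p) :
    variationField I₂ ψ p = 0 := by
  have hconst : (fun t => ψ t p) =ᶠ[𝓝 (0 : ℝ)] fun _ => ψ 0 p := h
  rw [variationField, hconst.mfderiv_eq, mfderiv_const]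
  rfl

variable [TopologicalSpace M₁] [ChartedSpace H₁ M₁] [IsManifold I₂ ∞ M₂]

lemma hasDerivAt_extChartAt_variationField
    (hψ : ContMDiffAt (𝓘(ℝ, ℝ).prod I₁) I₂ ∞ (fun z : ℝ × M₁ => ψ z.1 z.2) (0, p))
    (hq : ψ 0 p ∈ (extChartAt I₂ q).source) :
    HasDerivAt (fun t => extChartAt I₂ q (ψ t p))
      (coords I₂ q (ψ 0 p) (variationField I₂ ψ p)) 0 := by
  have hcurve := ((contMDiffAt_curve hψ).mdifferentiableAt (by simp)).hasMFDerivAt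
  have hcoords : HasFDerivAt (𝕜 := ℝ) (E := ℝ) (F := 𝔼 n) (fun t => extChartAt I₂ q (ψ t p)) _ 0 :=
    hasMFDerivAt_iff_hasFDerivAt.1 (HasMFDerivAt.comp (0 : ℝ)
      (hasMFDerivAt_extChartAt_coords hq) hcurve)
  exact hcoords.hasDerivAt

variable [IsManifold I₁ ∞ M₁]

lemma coords_variationField_eq {x₀ : M₁}
    (hψ : ContMDiffAt (𝓘(ℝ, ℝ).prod I₁) I₂ ∞ (fun z : ℝ × M₁ => ψ z.1 z.2) (0, p))
    (hp : p ∈ (extChartAt I₁ x₀).source) (hq : ψ 0 p ∈ (extChartAt I₂ q).source) :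
    coords I₂ q (ψ 0 p) (variationField I₂ ψ p) =
      fderivWithin ℝ (chartFamily I₁ I₂ ψ x₀ q) (univ ×ˢ range I₁)
        (0, extChartAt I₁ x₀ p) (1, 0) := by
  have hslice := hasDerivAt_slice_of_mem (extChartAt_mem_range _ _)
    ((contDiffWithinAt_chartFamily hψ hp hq).differentiableWithinAt (by simp))
  simp only [chartFamily_extChartAt hp] at hslice
  exact (hasDerivAt_extChartAt_variationField hψ hq).unique hslice

lemma isSmoothSection_variationField (hψ : IsSmoothFamilyAt I₁ I₂ ψ 0) :
    IsSmoothSection I₁ I₂ (ψ 0) (variationField I₂ ψ) := by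
  refine isSmoothSection_of_coords hψ.contMDiff fun p => ?_
  have hderiv : ContDiffWithinAt ℝ ∞ (fun y => fderivWithin ℝ (chartFamily I₁ I₂ ψ p (ψ 0 p))
      (univ ×ˢ range I₁) (0, y) (1, 0)) (range I₁) (extChartAt I₁ p p) :=
    (ContDiffWithinAt.comp (extChartAt I₁ p p)
      (contDiffWithinAt_fderivWithin_chartFamily (hψ.contMDiffAt p) (mem_extChartAt_source p)
        (mem_extChartAt_source _))
      (contDiffWithinAt_const.prodMk contDiffWithinAt_id) fun y hy => ⟨trivial, hy⟩).clm_apply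
      contDiffWithinAt_const
  have hsmooth : ContMDiffAt I₁ 𝓘(ℝ, 𝔼 n) ∞ (fun p' => fderivWithin ℝ
      (chartFamily I₁ I₂ ψ p (ψ 0 p)) (univ ×ˢ range I₁) (0, extChartAt I₁ p p') (1, 0)) p :=
    ContMDiffWithinAt.comp (g := fun y => fderivWithin ℝ (chartFamily I₁ I₂ ψ p (ψ 0 p))
      (univ ×ˢ range I₁) (0, y) (1, 0)) p hderiv.contMDiffWithinAt
      (contMDiffAt_extChartAt (I := I₁)).contMDiffWithinAt fun p' _ => extChartAt_mem_range _ _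
  refine hsmooth.congr_of_eventuallyEq ?_
  filter_upwards [extChartAt_source_mem_nhds (I := I₁) p,
    hψ.contMDiff.continuous.continuousAt.preimage_mem_nhds
      (extChartAt_source_mem_nhds (I := I₂) (ψ 0 p))] with p' hp hq
  exact coords_variationField_eq (hψ.contMDiffAt p') hp hq

variable [RiemannianBundle (fun x : M₂ => TangentSpace I₂ x)]
  [IsContMDiffRiemannianBundle I₂ ∞ (𝔼 n) (fun x : M₂ => TangentSpace I₂ x)]

lemma hasDerivAt_chartVariation (hψ : IsSmoothFamilyAt I₁ I₂ ψ 0) (hp : p ∈ I₁.interior M₁) :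
    HasDerivAt (fun t => density I₂ (ψ 0 p) (extChartAt I₂ (ψ 0 p) (ψ t p)) *
        stdVol n (fun j => fderivWithin ℝ (chartMap I₁ I₂ (ψ t) p (ψ 0 p)) (range I₁)
          (extChartAt I₁ p p) (EuclideanSpace.single j 1)))
      (chartVariation I₁ I₂ (ψ 0) (variationField I₂ ψ) p (ψ 0 p) (extChartAt I₁ p p)) 0 := by
  have hp_source := mem_extChartAt_source (I := I₁) p
  have hq_source := mem_extChartAt_source (I := I₂) (ψ 0 p)
  have hrange : range I₁ ∈ 𝓝 (extChartAt I₁ p p) := mem_interior_iff_mem_nhds.1 hp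
  have hfamily : ContDiffAt ℝ 2 (chartFamily I₁ I₂ ψ p (ψ 0 p)) (0, extChartAt I₁ p p) :=
    ((contDiffWithinAt_chartFamily (hψ.contMDiffAt p) hp_source hq_source).contDiffAt
      (prod_mem_nhds Filter.univ_mem hrange)).of_le two_le_infty
  have hsymm : Filter.Tendsto (extChartAt I₁ p).symm (𝓝 (extChartAt I₁ p p)) (𝓝 p) :=
    nhdsWithin_eq_nhds.2 hrange ▸
      tendsto_extChartAt_symm (mem_extChartAt_target p) (extChartAt_to_inv p)
  have hvelocity : ∀ᶠ z in 𝓝 (extChartAt I₁ p p),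
      HasDerivAt (fun t => chartFamily I₁ I₂ ψ p (ψ 0 p) (t, z))
        (chartSection I₁ I₂ (ψ 0) (variationField I₂ ψ) p (ψ 0 p) z) 0 := by
    filter_upwards [((hψ.contMDiff.continuous.tendsto p).comp hsymm).eventually
      (extChartAt_source_mem_nhds (I := I₂) _)] with z hz
    exact hasDerivAt_extChartAt_variationField (hψ.contMDiffAt _) hz
  have hdensity := (contDiffWithinAt_density hq_source).differentiableWithinAt (by simp)
  rw [← chartFamily_extChartAt hp_source 0] at hdensity
  have hderiv := hasDerivAt_mul_continuousAlternatingMap_slice (stdVol n) hfamily hvelocity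
    hdensity.hasFDerivWithinAt (.of_forall fun _ => chartMap_mem_range)
    fun j => EuclideanSpace.single j 1
  simp only [chartVariation, fderivWithin_of_mem_nhds hrange]
  refine hderiv.congr_of_eventuallyEq (.of_forall fun t => ?_)
  simp only [chartFamily_extChartAt hp_source]
  rfl

end VariationField

section FirstVariation

variable {n : ℕ}
  {H₁ : Type*} [TopologicalSpace H₁] {I₁ : ModelWithCorners ℝ (𝔼 n) H₁}
  {M₁ : Type*} [TopologicalSpace M₁] [ChartedSpace H₁ M₁]
  {H₂ : Type*} [TopologicalSpace H₂] {I₂ : ModelWithCorners ℝ (𝔼 n) H₂}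
  {M₂ : Type*} [TopologicalSpace M₂] [ChartedSpace H₂ M₂]
  [RiemannianBundle (fun x : M₁ => TangentSpace I₁ x)]
  [RiemannianBundle (fun x : M₂ => TangentSpace I₂ x)]
  {o₁ : ∀ x : M₁, Orientation ℝ (TangentSpace I₁ x) (Fin (n + 1))}
  {o₂ : ∀ x : M₂, Orientation ℝ (TangentSpace I₂ x) (Fin (n + 1))}
  {ψ : ℝ → M₁ → M₂} {p : M₁}

lemma pullbackVolume_eq (f : M₁ → M₂) (p : M₁) :
    pullbackVolume I₁ I₂ o₂ f p = DetD I₁ I₂ o₁ o₂ f p • (o₁ p).volumeForm :=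
  volumeForm_compLinearMap _ _ _

variable [IsManifold I₁ ∞ M₁]

lemma volumeFunctional_eq [MeasurableSpace M₁] (K : Set M₁) (f : M₁ → M₂) :
    volumeFunctional I₁ I₂ o₁ o₂ K f =
      ∫ p in K, DetD I₁ I₂ o₁ o₂ f p ∂(riemannianVolume I₁ : Measure M₁) := by
  simp only [volumeFunctional, integralTopForm, pullbackVolume_eq (o₁ := o₁),
    AlternatingMap.smul_apply, volumeForm_orientedBasis, smul_eq_mul, mul_one]

variable [IsManifold I₂ ∞ M₂]
  [IsContMDiffRiemannianBundle I₂ ∞ (𝔼 n) (fun x : M₂ => TangentSpace I₂ x)]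

theorem hasDerivAt_DetD (ho₂ : IsOrientation I₂ o₂) (hψ : IsSmoothFamilyAt I₁ I₂ ψ 0)
    (hp : p ∈ I₁.interior M₁) :
    HasDerivAt (fun t => DetD I₁ I₂ o₁ o₂ (ψ t) p)
      (cofPairing I₁ I₂ o₁ o₂ (ψ 0) (variationField I₂ ψ) p) 0 := by
  have hp_source := mem_extChartAt_source (I := I₁) p
  obtain ⟨s, -, hs⟩ := exists_volumeForm_coordVec_eq_mul_density ho₂ (ψ 0 p)
  have hvol : (o₁ p).volumeForm (coordVec I₁ p p) ≠ 0 := volumeForm_coordVec_ne_zero hp_source _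
  have hpairing := cofPairing_mul_volumeForm (o₁ := o₁)
    (hψ.contMDiff.mdifferentiableAt (by simp)) (isSmoothSection_variationField hψ)
    (mem_extChartAt_target p) (extChartAt_to_inv p) hs.self_of_nhds
  have hderiv := ((hasDerivAt_chartVariation hψ hp).const_mul s).div_const
    ((o₁ p).volumeForm (coordVec I₁ p p))
  rw [← hpairing, mul_div_cancel_right₀ _ hvol] at hderiv
  have hcurve := (contMDiffAt_curve (hψ.contMDiffAt p)).continuousAt
  refine hderiv.congr_of_eventuallyEq ?_
  filter_upwards [hψ, hcurve.eventually hs,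
    hcurve.eventually (extChartAt_source_mem_nhds (I := I₂) _)] with t ht hst hqt
  rw [eq_div_iff hvol, ← mul_assoc, ← hst]
  exact DetD_mul_volumeForm hp_source hqt ((contMDiffAt_slice (ht p)).mdifferentiableAt (by simp))

variable [IsContMDiffRiemannianBundle I₁ ∞ (𝔼 n) (fun x : M₁ => TangentSpace I₁ x)]
  [T2Space M₁] [SecondCountableTopology M₁] [MeasurableSpace M₁] [BorelSpace M₁]
  {K : Set M₁}

theorem hasDerivAt_volumeFunctional (ho₁ : IsOrientation I₁ o₁) (ho₂ : IsOrientation I₂ o₂)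
    (hK : IsCompact K) (hψ : IsSmoothFamilyAt I₁ I₂ ψ 0) :
    HasDerivAt (fun t => volumeFunctional I₁ I₂ o₁ o₂ K (ψ t))
      (∫ p in K, cofPairing I₁ I₂ o₁ o₂ (ψ 0) (variationField I₂ ψ) p
        ∂(riemannianVolume I₁ : Measure M₁)) 0 := by
  have hnear : ∀ᶠ t in 𝓝 0, IsSmoothFamilyAt I₁ I₂ ψ t := eventually_eventually_nhds.2 hψ
  have hderiv := hasDerivAt_setIntegral_of_continuousAt_deriv (μ := riemannianVolume I₁)
    hK hK.measurableSet
    (hnear.mono fun t ht => continuous_DetD ho₁ ho₂ ht.contMDiff)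
    (hnear.mono fun t ht => ht.differentiableAt_DetD ho₁ ho₂)
    (hnear.mono fun t ht => ht.continuousAt_deriv_DetD ho₁ ho₂)
  simp only [volumeFunctional_eq]
  refine hderiv.congr_deriv (integral_congr_ae (ae_restrict_of_ae ?_))
  filter_upwards [ae_mem_interior (I₁ := I₁)] with p hp using (hasDerivAt_DetD ho₂ hψ hp).deriv

theorem isCritical_volumeFunctional (ho₁ : IsOrientation I₁ o₁) (ho₂ : IsOrientation I₂ o₂)
    (φ : M₁ → M₂) : IsCritical I₁ I₂ (volumeFunctional I₁ I₂ o₁ o₂) φ := by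
  intro K ε ψ hK hε h
  have hzero : (0 : ℝ) ∈ Ioo (-ε) ε := ⟨neg_lt_zero.2 hε, hε⟩
  have hψ := h.isSmoothFamilyAt hzero
  obtain ⟨-, rfl, hboundary, hoff⟩ := h
  have hV_off (p : M₁) (hp : p ∉ K) : variationField I₂ ψ p = 0 := variationField_eq_zero <|
    Filter.mem_of_superset (isOpen_Ioo.mem_nhds hzero) fun t ht => hoff t ht p hp
  have hV_boundary (p : M₁) (hp : p ∈ I₁.boundary M₁) : variationField I₂ ψ p = 0 :=
    variationField_eq_zero <|
      Filter.mem_of_superset (isOpen_Ioo.mem_nhds hzero) fun t ht => hboundary t ht p hp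
  have hsupport : closure {p | variationField I₂ ψ p ≠ 0} ⊆ K :=
    closure_minimal (fun p hp => by_contra fun hpK => hp (hV_off p hpK)) hK.isClosed
  refine (hasDerivAt_volumeFunctional ho₁ ho₂ hK hψ).congr_deriv ?_
  rw [setIntegral_eq_integral_of_forall_compl_eq_zero fun p hp => cofPairing_eq_zero
    (eventually_eq_zero_of_notMem_closure fun hmem => hp (hsupport hmem))]
  exact integral_cofPairing_eq_zero ho₁ ho₂ hψ.contMDiff (isSmoothSection_variationField hψ)
    (hK.of_isClosed_subset isClosed_closure hsupport) hV_boundary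

theorem isCoderivative_CofD_zero (ho₁ : IsOrientation I₁ o₁) (ho₂ : IsOrientation I₂ o₂)
    {f : M₁ → M₂} (hf : ContMDiff I₁ I₂ ∞ f) :
    IsCoderivative I₁ I₂ f (CofD I₁ I₂ o₁ o₂ f) (fun _ => 0) :=
  ⟨isSmoothSection_zero hf, fun σ hσ hσc hσb =>
    .trans (by simp) (integral_cofPairing_eq_zero ho₁ ho₂ hf hσ hσc hσb).symm⟩

theorem IsCoderivative.eq_zero (ho₁ : IsOrientation I₁ o₁) (ho₂ : IsOrientation I₂ o₂)
    {f : M₁ → M₂} (hf : ContMDiff I₁ I₂ ∞ f) {τ : ∀ p, TangentSpace I₂ (f p)}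
    (hτ : IsCoderivative I₁ I₂ f (CofD I₁ I₂ o₁ o₂ f) τ) : τ = fun _ => 0 :=
  hτ.1.eq_zero_of_integral_inner_eq_zero hf fun σ hσ hσc hσb =>
    (hτ.2 σ hσ hσc hσb).trans (integral_cofPairing_eq_zero ho₁ ho₂ hf hσ hσc hσb)

end FirstVariation

end Piola

end

theorem mainTheorem3_general {n : ℕ}
    {H₁ : Type*} [TopologicalSpace H₁]
    (I₁ : ModelWithCorners ℝ (EuclideanSpace ℝ (Fin (n + 1))) H₁)
    {M₁ : Type*} [TopologicalSpace M₁] [ChartedSpace H₁ M₁] [IsManifold I₁ ∞ M₁]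
    [T2Space M₁] [SecondCountableTopology M₁] [MeasurableSpace M₁] [BorelSpace M₁]
    [RiemannianBundle (fun x : M₁ => TangentSpace I₁ x)]
    [IsContMDiffRiemannianBundle I₁ ∞ (EuclideanSpace ℝ (Fin (n + 1)))
      (fun x : M₁ => TangentSpace I₁ x)]
    (o₁ : ∀ x : M₁, Orientation ℝ (TangentSpace I₁ x) (Fin (n + 1)))
    (ho₁ : Piola.IsOrientation I₁ o₁)
    {H₂ : Type*} [TopologicalSpace H₂]
    (I₂ : ModelWithCorners ℝ (EuclideanSpace ℝ (Fin (n + 1))) H₂)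
    {M₂ : Type*} [TopologicalSpace M₂] [ChartedSpace H₂ M₂] [IsManifold I₂ ∞ M₂]
    [RiemannianBundle (fun x : M₂ => TangentSpace I₂ x)]
    [IsContMDiffRiemannianBundle I₂ ∞ (EuclideanSpace ℝ (Fin (n + 1)))
      (fun x : M₂ => TangentSpace I₂ x)]
    (o₂ : ∀ x : M₂, Orientation ℝ (TangentSpace I₂ x) (Fin (n + 1)))
    (ho₂ : Piola.IsOrientation I₂ o₂) :
    (∀ f : M₁ → M₂, ContMDiff I₁ I₂ ∞ f →
      (∀ p, Piola.pullbackVolume I₁ I₂ o₂ f p =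
        Piola.DetD I₁ I₂ o₁ o₂ f p • (o₁ p).volumeForm) ∧
      ∀ K : Set M₁, IsCompact K →
        IntegrableOn (Piola.DetD I₁ I₂ o₁ o₂ f) K (Piola.riemannianVolume I₁) ∧
        Piola.volumeFunctional I₁ I₂ o₁ o₂ K f =
          ∫ p in K, Piola.DetD I₁ I₂ o₁ o₂ f p ∂(Piola.riemannianVolume I₁)) ∧
    (∀ φ : M₁ → M₂, ContMDiff I₁ I₂ ∞ φ →
      ∃ τ : ∀ p, TangentSpace I₂ (φ p),
        Piola.IsCoderivative I₁ I₂ φ (Piola.CofD I₁ I₂ o₁ o₂ φ) τ ∧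
        (∀ τ', Piola.IsCoderivative I₁ I₂ φ (Piola.CofD I₁ I₂ o₁ o₂ φ) τ' → τ' = τ) ∧
        (∀ (K : Set M₁) (ε : ℝ) (ψ : ℝ → M₁ → M₂) (V : ∀ p, TangentSpace I₂ (φ p)),
          IsCompact K → 0 < ε → Piola.IsVariation I₁ I₂ φ K ε ψ →
          Piola.IsVariationField I₂ φ ψ V →
          HasDerivAt (fun t => Piola.volumeFunctional I₁ I₂ o₁ o₂ K (ψ t))
            (∫ p, inner ℝ (τ p) (V p) ∂(Piola.riemannianVolume I₁)) 0) ∧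
        (Piola.IsCritical I₁ I₂ (Piola.volumeFunctional I₁ I₂ o₁ o₂) φ ↔ ∀ p, τ p = 0)) ∧
    Piola.IsNullLagrangian I₁ I₂ (Piola.volumeFunctional I₁ I₂ o₁ o₂) ∧
    (∀ f : M₁ → M₂, ContMDiff I₁ I₂ ∞ f →
      Piola.IsCoderivative I₁ I₂ f (Piola.CofD I₁ I₂ o₁ o₂ f) (fun _ => 0)) := by
  have hcritical := Piola.isCritical_volumeFunctional (I₁ := I₁) (I₂ := I₂) ho₁ ho₂
  refine ⟨fun f hf => ⟨Piola.pullbackVolume_eq f, fun K hK =>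
      ⟨(Piola.continuous_DetD ho₁ ho₂ hf).continuousOn.integrableOn_compact hK,
        Piola.volumeFunctional_eq K f⟩⟩,
    fun φ hφ => ⟨fun _ => 0, Piola.isCoderivative_CofD_zero ho₁ ho₂ hφ,
      fun τ' hτ' => hτ'.eq_zero ho₁ ho₂ hφ, fun K ε ψ V hK hε hψ _ => ?_,
      fun _ _ => rfl, fun _ => hcritical φ⟩,
    fun φ _ => hcritical φ, fun f hf => Piola.isCoderivative_CofD_zero ho₁ ho₂ hf⟩
  simpa only [inner_zero_left, integral_zero] using hcritical φ K ε ψ hK hε hψ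

theorem mainTheorem3 {n : ℕ}
    {H₁ : Type*} [TopologicalSpace H₁]
    (I₁ : ModelWithCorners ℝ (EuclideanSpace ℝ (Fin (n + 1))) H₁)
    {M₁ : Type*} [TopologicalSpace M₁] [ChartedSpace H₁ M₁] [IsManifold I₁ ∞ M₁]
    [T2Space M₁] [SecondCountableTopology M₁] [MeasurableSpace M₁] [BorelSpace M₁]
    [RiemannianBundle (fun x : M₁ => TangentSpace I₁ x)]
    [IsContMDiffRiemannianBundle I₁ ∞ (EuclideanSpace ℝ (Fin (n + 1)))
      (fun x : M₁ => TangentSpace I₁ x)]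
    (o₁ : ∀ x : M₁, Orientation ℝ (TangentSpace I₁ x) (Fin (n + 1)))
    (ho₁ : Piola.IsOrientation I₁ o₁)
    {H₂ : Type*} [TopologicalSpace H₂]
    (I₂ : ModelWithCorners ℝ (EuclideanSpace ℝ (Fin (n + 1))) H₂)
    {M₂ : Type*} [TopologicalSpace M₂] [ChartedSpace H₂ M₂] [IsManifold I₂ ∞ M₂]
    [T2Space M₂] [SecondCountableTopology M₂]
    [RiemannianBundle (fun x : M₂ => TangentSpace I₂ x)]
    [IsContMDiffRiemannianBundle I₂ ∞ (EuclideanSpace ℝ (Fin (n + 1)))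
      (fun x : M₂ => TangentSpace I₂ x)]
    (o₂ : ∀ x : M₂, Orientation ℝ (TangentSpace I₂ x) (Fin (n + 1)))
    (ho₂ : Piola.IsOrientation I₂ o₂) :
    -- `f^*dVol₂ = Det df dVol₁`, and the two expressions of the functional `E` agree
    (∀ f : M₁ → M₂, ContMDiff I₁ I₂ ∞ f →
      (∀ p, Piola.pullbackVolume I₁ I₂ o₂ f p =
        Piola.DetD I₁ I₂ o₁ o₂ f p • (o₁ p).volumeForm) ∧
      ∀ K : Set M₁, IsCompact K →
        IntegrableOn (Piola.DetD I₁ I₂ o₁ o₂ f) K (Piola.riemannianVolume I₁) ∧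
        Piola.volumeFunctional I₁ I₂ o₁ o₂ K f =
          ∫ p in K, Piola.DetD I₁ I₂ o₁ o₂ f p ∂(Piola.riemannianVolume I₁)) ∧
    -- the Euler–Lagrange equation of `E` is `δ Cof dφ = 0`
    (∀ φ : M₁ → M₂, ContMDiff I₁ I₂ ∞ φ →
      ∃ τ : ∀ p, TangentSpace I₂ (φ p),
        Piola.IsCoderivative I₁ I₂ φ (Piola.CofD I₁ I₂ o₁ o₂ φ) τ ∧
        (∀ τ', Piola.IsCoderivative I₁ I₂ φ (Piola.CofD I₁ I₂ o₁ o₂ φ) τ' → τ' = τ) ∧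
        (∀ (K : Set M₁) (ε : ℝ) (ψ : ℝ → M₁ → M₂) (V : ∀ p, TangentSpace I₂ (φ p)),
          IsCompact K → 0 < ε → Piola.IsVariation I₁ I₂ φ K ε ψ →
          Piola.IsVariationField I₂ φ ψ V →
          HasDerivAt (fun t => Piola.volumeFunctional I₁ I₂ o₁ o₂ K (ψ t))
            (∫ p, inner ℝ (τ p) (V p) ∂(Piola.riemannianVolume I₁)) 0) ∧
        (Piola.IsCritical I₁ I₂ (Piola.volumeFunctional I₁ I₂ o₁ o₂) φ ↔ ∀ p, τ p = 0)) ∧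
    -- `E` is a null-Lagrangian
    Piola.IsNullLagrangian I₁ I₂ (Piola.volumeFunctional I₁ I₂ o₁ o₂) ∧
    -- the Riemannian Piola identity `δ Cof df = 0`
    (∀ f : M₁ → M₂, ContMDiff I₁ I₂ ∞ f →
      Piola.IsCoderivative I₁ I₂ f (Piola.CofD I₁ I₂ o₁ o₂ f) (fun _ => 0)) :=
  mainTheorem3_general I₁ o₁ ho₁ I₂ o₂ ho₂
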